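/- Let $d\ge 2$ and let $V$ be the set of the $2d$ vectors $e\in\mathbb Z^d$ with $|e|_2=1$. An environment is a family $\omega=(\omega(x,e))_{x\in\mathbb Z^d,e\in V}$ such that $\omega(x,\cdot)$ is a probability vector for each $x$; $P_{x,\omega}$ is the law of the Markov chain $(X_n)_{n\ge0}$ on $\mathbb Z^d$ with $X_0=x$ and jump probability $\omega(y,e)$ from $y$ to $y+e$; for a probability measure $\mathbb P$ on environments, $P_x(\cdot)=\int P_{x,\omega}(\cdot)\,\mathbb P(d\omega)$. For $l\in\mathbb S^{d-1}$ and $u\in\mathbb R$ put $T^l_u=\inf\{n\ge0:X_n\cdot l\ge u\}$ and $\tilde T^l_u=\inf\{n\ge 0:X_n\cdot l\le u\}$. Let $R$ be an orthogonal transformation of $\mathbb R^d$ with $R(e_1)=l$. For $L_0>1$ and $\tilde L_0>0$ consider the box $$B_0=R\big((-(L_0-1),\,L_0+1)\times(-\tilde L_0,\tilde L_0)^{d-1}\big)\cap\mathbb Z^d$$ with outer boundary $\partial B_0$ (the sites outside $B_0$ that have a nearest neighbour in $B_0$) and $$\partial_+B_0=\partial B_0\cap\{x: x\cdot l\ge L_0+1,\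 |x\cdot R(e_i)|<\tilde L_0\text{ for }2\le i\le d\}.$$ Let $T_{B_0}$ be the exit time from $B_0$ and set $q_0(\omega)=P_{0,\omega}(X_{T_{B_0}}\notin\partial_+B_0)$, $p_0=1-q_0$, $\rho_0=q_0/p_0$. **Proposition 2.2.** There exist constants $c_{14}\ge 3\sqrt d$ and $c_{15}>1$ that depend only on $d$ and have the following property. Suppose that under $\mathbb P$ the vectors $\omega(x,\cdot)$, $x\in\mathbb Z^d$, are i.i.d., and that for some $\kappa>0$ one has $\mathbb P$-a.s. $\omega(x,e)\ge\kappa$ for all $x\in\mathbb Z^d$, $e\in V$. If $L_0\ge c_{14}$, $3\sqrt d\le\tilde L_0\le L_0^3$ and $$c_{15}\Big(\log\frac1\kappa\Big)^{3(d-1)}\tilde L_0^{\,d-1}L_0^{\,3d-2}\inf_{a\in(0,1]}\mathbb E[\rho_0^a]<1,$$ then there exist $c>0$ and a function $n:[0,\infty)\to\mathbb N$ with $n(L)\to\infty$ as $L\to\infty$ such that, writing $\log_8^{(n)}$ for the $n$-fold composition of the base-8 logarithm, $\log_8^{(n(L))}L$ is defined for every $L\ge 0$ (with $\log_8^{(0)}L=L$)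 and $$\limsup_{L\to\infty}\ L^{-1}\exp\{c\,\log_8^{(n(L))}L\}\,\log P_0\big(\tilde T^l_{-L}<T^l_L\big)<0.$$ -/

import Mathlib

open MeasureTheory ProbabilityTheory Filter
open scoped ENNReal

noncomputable section

namespace RWRE

/-- The lattice `ℤ^d`. -/
abbrev Site (d : ℕ) : Type := Fin d → ℤ

/-- The index set of the `2d` canonical unit vectors `± e_i`. -/
abbrev Dir (d : ℕ) : Type := Fin d × ℤˣ

/-- The lattice vector `± e_i` that belongs to a direction. -/
def Dir.vec {d : ℕ} (e : Dir d) : Site d := Pi.single e.1 (e.2 : ℤ)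

/-- Environments: to each site a probability vector indexed by the `2d` canonical vectors.
It carries the product σ-algebra. -/
abbrev Env (d : ℕ) : Type := Site d → stdSimplex ℝ (Dir d)

/-- `ω(x, e)`, the probability of jumping from `x` to `x + e`. -/
def Env.prob {d : ℕ} (ω : Env d) (x : Site d) (e : Dir d) : ℝ := (ω x).1 e

/-- The one-step transition law from `x`: `∑_e ω(x, e) δ_{x + e}`. -/
def stepMeasure {d : ℕ} (ω : Env d) (x : Site d) : Measure (Site d) :=
  ∑ e : Dir d, ENNReal.ofReal (ω.prob x e) • Measure.dirac (x + e.vec)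

/-- The one-step transition kernel of the walk in the environment `ω`. -/
def stepKernel {d : ℕ} (ω : Env d) : Kernel (Site d) (Site d) :=
  Kernel.ofFunOfCountable (stepMeasure ω)

instance stepKernel.instIsMarkovKernel {d : ℕ} (ω : Env d) : IsMarkovKernel (stepKernel ω) := by
  refine ⟨fun x => ⟨?_⟩⟩
  change stepMeasure ω x Set.univ = 1
  simp only [stepMeasure, Measure.coe_finsetSum, Finset.sum_apply, Measure.smul_apply,
    measure_univ, smul_eq_mul, mul_one]
  unfold Env.prob
  rw [← ENNReal.ofReal_sum_of_nonneg (fun e _ => (ω x).2.1 e)]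
  simp [(ω x).2.2]

/-- The transition kernel at time `n`, seen as a function of the path up to time `n`: it depends
on the current position only. -/
def pathKernel {d : ℕ} (ω : Env d) (n : ℕ) :
    Kernel (∀ _ : Finset.Iic n, Site d) (Site d) :=
  (stepKernel ω).comap (fun h => h ⟨n, Finset.mem_Iic.2 le_rfl⟩) (measurable_pi_apply _)

instance pathKernel.instIsMarkovKernel {d : ℕ} (ω : Env d) (n : ℕ) :
    IsMarkovKernel (pathKernel ω n) := by
  unfold pathKernel; infer_instance

/-- The quenched law `P_{x,ω}`: the law on path space of the Markov chain started at `x` with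
transition probabilities `ω`. -/
def quenchedLaw {d : ℕ} (ω : Env d) (x : Site d) : Measure (ℕ → Site d) :=
  Kernel.trajMeasure (X := fun _ => Site d) (Measure.dirac x) (pathKernel ω)

/-- The annealed probability `P_x(A) = ∫ P_{x,ω}(A) Q(dω)` of an event `A` of path space. -/
def annealedProb {d : ℕ} (Q : Measure (Env d)) (x : Site d) (A : Set (ℕ → Site d)) : ℝ≥0∞ :=
  ∫⁻ ω, quenchedLaw ω x A ∂Q

/-- The coordinates of the environment are i.i.d. -/
def IsIIDEnv {d : ℕ} (Q : Measure (Env d)) : Prop :=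
  iIndepFun (fun (x : Site d) (ω : Env d) => ω x) Q ∧
    ∀ x : Site d, IdentDistrib (fun ω : Env d => ω x) (fun ω : Env d => ω 0) Q Q

/-- Uniform ellipticity with constant `κ`. -/
def IsUniformlyElliptic {d : ℕ} (Q : Measure (Env d)) (κ : ℝ) : Prop :=
  0 < κ ∧ ∀ᵐ ω ∂Q, ∀ (x : Site d) (e : Dir d), κ ≤ ω.prob x e

/-- The exit time `T_A = inf {n ≥ 0 : X_n ∉ A}`, equal to `⊤` if the path never leaves `A`. -/
def exitTime {d : ℕ} (A : Set (Site d)) (X : ℕ → Site d) : ℕ∞ :=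
  ⨅ (n : ℕ) (_ : X n ∉ A), (n : ℕ∞)

/-- The embedding of `ℤ^d` in the Euclidean space `ℝ^d`. -/
def toEuclid {d : ℕ} (x : Site d) : EuclideanSpace ℝ (Fin d) :=
  WithLp.toLp 2 (fun i => (x i : ℝ))

/-- The scalar product `x · v` of a lattice site and a vector. -/
def dot {d : ℕ} (x : Site d) (v : EuclideanSpace ℝ (Fin d)) : ℝ := inner ℝ (toEuclid x) v

/-- `T_u^l = T_{ {x : x · l < u} }`. -/
def hitAbove {d : ℕ} (l : EuclideanSpace ℝ (Fin d)) (u : ℝ) (X : ℕ → Site d) : ℕ∞ :=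
  exitTime {x | dot x l < u} X

/-- `T̃_u^l = T_{ {x : x · l > u} }`. -/
def hitBelow {d : ℕ} (l : EuclideanSpace ℝ (Fin d)) (u : ℝ) (X : ℕ → Site d) : ℕ∞ :=
  exitTime {x | u < dot x l} X

/-- The outer boundary of a set of sites: the sites outside `A` with a nearest neighbour
in `A`. -/
def boundary {d : ℕ} (A : Set (Site d)) : Set (Site d) :=
  {x | x ∉ A ∧ ∃ e : Dir d, x + e.vec ∈ A}

/-- A box specification `(R, L, L', L̃)`; `R` is an orthogonal transformation. -/
structure BoxSpec (d : ℕ) where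
  R : EuclideanSpace ℝ (Fin d) ≃ₗᵢ[ℝ] EuclideanSpace ℝ (Fin d)
  L : ℝ
  L' : ℝ
  Lt : ℝ

/-- The canonical basis vector of `ℝ^d`; `basisVec 0` is the first one. -/
def basisVec {d : ℕ} (i : Fin d) : EuclideanSpace ℝ (Fin d) := EuclideanSpace.single i 1

/-- The box `R((-L, L') × (-L̃, L̃)^{d-1}) ∩ ℤ^d`. -/
def BoxSpec.box {d : ℕ} [NeZero d] (b : BoxSpec d) : Set (Site d) :=
  toEuclid ⁻¹' (b.R '' {y | y 0 ∈ Set.Ioo (-b.L) b.L' ∧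
    ∀ i : Fin d, i ≠ 0 → y i ∈ Set.Ioo (-b.Lt) b.Lt})

/-- The positive part `∂₊B` of the boundary of the box, where `l = R(e₁)`. -/
def BoxSpec.frontBoundary {d : ℕ} [NeZero d] (b : BoxSpec d) : Set (Site d) :=
  boundary b.box ∩ {x | b.L' ≤ dot x (b.R (basisVec 0)) ∧
    ∀ i : Fin d, i ≠ 0 → |dot x (b.R (basisVec i))| < b.Lt}

/-- The event `X_{T_B} ∈ ∂₊B` (in particular `T_B < ∞`). -/
def BoxSpec.exitsFront {d : ℕ} [NeZero d] (b : BoxSpec d) : Set (ℕ → Site d) :=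
  {X | ∃ n : ℕ, exitTime b.box X = n ∧ X n ∈ b.frontBoundary}

/-- `q_B(ω) = P_{0,ω}(X_{T_B} ∉ ∂₊B)`. -/
def BoxSpec.q {d : ℕ} [NeZero d] (b : BoxSpec d) (ω : Env d) : ℝ≥0∞ :=
  quenchedLaw ω 0 b.exitsFrontᶜ

/-- `p_B(ω) = 1 - q_B(ω)`. -/
def BoxSpec.p {d : ℕ} [NeZero d] (b : BoxSpec d) (ω : Env d) : ℝ≥0∞ := 1 - b.q ω

/-- `ρ_B(ω) = q_B(ω) / p_B(ω)`, with value in `[0, ∞]`. -/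
def BoxSpec.rho {d : ℕ} [NeZero d] (b : BoxSpec d) (ω : Env d) : ℝ≥0∞ := b.q ω / b.p ω

/-- The base-8 logarithm iterated `n` times. It is the honest iterate when `IterLogDefined n x`
holds. -/
def iterLog (n : ℕ) (x : ℝ) : ℝ := (Real.logb 8)^[n] x

/-- `x` is in the domain of the `n`-fold iterate of the base-8 logarithm. -/
def IterLogDefined (n : ℕ) (x : ℝ) : Prop := ∀ j < n, 0 < iterLog j x

end RWRE

end

open MeasureTheory ProbabilityTheory Filter
open scoped ENNReal

set_option linter.unusedSectionVars false

/-! ### Exit probabilities of the quenched walk as a series over exit times -/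

noncomputable section

namespace RWRE

variable {d : ℕ}

/-! The proof is a multiscale renormalization of the ratio ρ = q/p of a box. Fix an environment, a
small box of size (L₀, L̃₀) and a large one of size (L₁, L̃₁), and observe the walk at its
successive exits from translates of the small box centred at its current position. Call an exit
through the front a success.

Cut the large box into slabs of thickness L₀ + 1. A success climbs at least one slab and a failure
descends at most one. The height is therefore controlled by a birth-death chain whose down/up ratio
in slab k is the supremum of ρ₀ over that slab, and the gambler's ruin formula bounds the backward
exit (`back_exit_le`). A lateral exit must cross J disjoint strips, and crossing a strip requires a
failure inside it, because an unbroken run of successes leaves the box before drifting that far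
(`side_exit_le`). Ellipticity gives a crude lower bound on the front exit (`exp_le_hit_front`),
which turns these estimates into a bound on ρ₁ (`quenched_renormalization`, `rho_le`). No
stopping-time argument is needed: all comparisons go through a maximum principle for finite sets
(`max_principle`, `coarse_comparison`).

Under the annealed measure, the suprema cost a factor equal to the number of sites. Slabs at index
distance at least 3 see disjoint parts of the environment, so Hölder over residue classes mod 3
followed by independence bounds the moment of order a/3 of ρ₁ by the moment of order a of ρ₀
(`annealed_renormalization`). The ellipticity error is exponential in log(1/κ) L₁; taking J of order
d log(1/κ) L₁ beats it, and this dictates the lateral size `nextWidth`.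

If E[ρ^a] ≤ exp(-A) at a good scale of length L, one step allows any length N L with 4 ≤ N ≤
exp(A/(8d)) and yields the rate A N/24 (`GoodScale.step`). The order a shrinks threefold each time,
which is harmless because q ≤ ρ^a for every a in (0,1]. The effective criterion provides the first
good scale (`goodScale_init`). After k steps the rate per unit length has dropped only by 24^k,
while the lengths grow like a tower of exponentials. Hence k is dominated by an iterated logarithm
of the length, and exp(c log_8^{(n)} L) with n about k/2 absorbs the loss (`exists_iterLog_limsup`).
-/

lemma lintegral_stepMeasure (ω : Env d) (x : Site d) (f : Site d → ℝ≥0∞) :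
    ∫⁻ y, f y ∂(stepMeasure ω x) = ∑ e : Dir d, ENNReal.ofReal (ω.prob x e) * f (x + e.vec) := by
  simp [stepMeasure, lintegral_finsetSum_measure, lintegral_smul_measure]

instance (ω : Env d) (x : Site d) : IsProbabilityMeasure (quenchedLaw ω x) := by
  unfold quenchedLaw; infer_instance

/-- The walk killed outside `A`: one step of its transition operator. -/
def stepOp (ω : Env d) (A : Set (Site d)) (f : Site d → ℝ≥0∞) : Site d → ℝ≥0∞ :=
  A.indicator fun x => ∑ e : Dir d, ENNReal.ofReal (ω.prob x e) * f (x + e.vec)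

lemma lintegral_quenchedLaw_zero (ω : Env d) (x : Site d) (f : Site d → ℝ≥0∞) :
    ∫⁻ X, f (X 0) ∂(quenchedLaw ω x) = f x := by
  unfold quenchedLaw Kernel.trajMeasure
  have hf : Measurable fun X : ℕ → Site d => f (X 0) :=
    (measurable_of_countable f).comp (measurable_pi_apply 0)
  rw [Measure.lintegral_bind (Kernel.aemeasurable _) hf.aemeasurable,
    lintegral_map (measurable_of_countable _) (by fun_prop), lintegral_dirac]
  rw [Kernel.lintegral_traj _ hf]
  simp [Function.updateFinset]

/-- The Markov property at time n, read off from the disintegration of the trajectory measure over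
its first n + 1 coordinates. -/
lemma lintegral_quenchedLaw_succ (ω : Env d) (x : Site d) (n : ℕ)
    (g : (∀ _ : Finset.Iic n, Site d) → ℝ≥0∞) (f : Site d → ℝ≥0∞) :
    ∫⁻ X, g (Preorder.frestrictLe n X) * f (X (n + 1)) ∂(quenchedLaw ω x) =
      ∫⁻ X, g (Preorder.frestrictLe n X) *
        (∑ e : Dir d, ENNReal.ofReal (ω.prob (X n) e) * f (X n + e.vec)) ∂(quenchedLaw ω x) := by
  have key := Kernel.map_frestrictLe_trajMeasure_compProd_eq_map_trajMeasure
    (X := fun _ => Site d) (μ₀ := Measure.dirac x) (κ := pathKernel ω) (a := n)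
  have h1 : ∫⁻ p, g p.1 * f p.2 ∂((Kernel.trajMeasure (X := fun _ => Site d) (Measure.dirac x)
      (pathKernel ω)).map (fun x => (Preorder.frestrictLe n x, x (n + 1)))) =
      ∫⁻ X, g (Preorder.frestrictLe n X) * f (X (n + 1)) ∂(quenchedLaw ω x) := by
    rw [lintegral_map (measurable_of_countable _) (by fun_prop)]
    rfl
  rw [← h1, ← key, Measure.lintegral_compProd (measurable_of_countable _),
    lintegral_map (measurable_of_countable _) (by fun_prop)]
  refine lintegral_congr fun X => ?_
  have h2 : ∫⁻ y, g (Preorder.frestrictLe n X) * f y ∂(stepMeasure ω (X n)) =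
      g (Preorder.frestrictLe n X) *
        ∑ e : Dir d, ENNReal.ofReal (ω.prob (X n) e) * f (X n + e.vec) := by
    rw [lintegral_const_mul _ (measurable_of_countable f), lintegral_stepMeasure]
  exact h2

lemma lintegral_prod_indicator (ω : Env d) (x : Site d) (A : Set (Site d)) (n : ℕ)
    (f : Site d → ℝ≥0∞) :
    ∫⁻ X, (∏ i ∈ Finset.range n, A.indicator (fun _ => (1 : ℝ≥0∞)) (X i)) * f (X n)
      ∂(quenchedLaw ω x) = (stepOp ω A)^[n] f x := by
  induction n generalizing f with
  | zero => simpa using lintegral_quenchedLaw_zero ω x f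
  | succ n ih =>
    rw [Function.iterate_succ, Function.comp_apply, ← ih]
    have := lintegral_quenchedLaw_succ ω x n
      (fun h => ∏ i : Fin (n + 1), A.indicator (fun _ => (1 : ℝ≥0∞))
        (h ⟨i, Finset.mem_Iic.2 (Nat.lt_succ_iff.1 i.2)⟩)) f
    simp only [Preorder.frestrictLe_apply] at this
    simp only [Finset.prod_range]
    rw [this]
    refine lintegral_congr fun X => ?_
    rw [Fin.prod_univ_castSucc, mul_assoc]
    congr 1
    unfold stepOp
    by_cases h : X n ∈ A <;> simp [h]

lemma exitTime_eq_coe_iff (A : Set (Site d)) (X : ℕ → Site d) (n : ℕ) :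
    exitTime A X = n ↔ X n ∉ A ∧ ∀ i < n, X i ∈ A := by
  unfold exitTime
  constructor
  · intro h
    have hlt : ∀ i < n, X i ∈ A := by
      intro i hi
      by_contra hc
      have : (⨅ (n : ℕ) (_ : X n ∉ A), (n : ℕ∞)) ≤ i := iInf₂_le i hc
      rw [h] at this
      exact absurd (by exact_mod_cast this) (not_le.2 hi)
    refine ⟨fun hc => ?_, hlt⟩
    have : ((n + 1 : ℕ) : ℕ∞) ≤ ⨅ (n : ℕ) (_ : X n ∉ A), (n : ℕ∞) := by
      refine le_iInf₂ fun i hi => ?_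
      have : n < i := by
        rcases lt_trichotomy i n with h' | h' | h'
        · exact absurd (hlt i h') hi
        · exact absurd (h' ▸ hc) hi
        · exact h'
      exact_mod_cast this
    rw [h] at this
    exact absurd (by exact_mod_cast this) (Nat.not_succ_le_self n)
  · rintro ⟨h1, h2⟩
    refine le_antisymm (iInf₂_le n h1) (le_iInf₂ fun i hi => ?_)
    have : n ≤ i := by
      by_contra hc
      exact hi (h2 i (not_le.1 hc))
    exact_mod_cast this

/-- The probability that the walk started at `x` leaves `A` through a point of `F`. -/
def exitValue (ω : Env d) (A F : Set (Site d)) (x : Site d) : ℝ≥0∞ :=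
  ∑' n : ℕ, (stepOp ω A)^[n] ((Aᶜ ∩ F).indicator fun _ => 1) x

/-- The bridge from path space to functions on the lattice: split by the value of the exit time, and
recognize each term as an iterate of the killed transition operator. The box estimates then need
only the one-step equation of `exitValue`. -/
lemma quenchedLaw_exit (ω : Env d) (A F : Set (Site d)) (x : Site d) :
    quenchedLaw ω x {X | ∃ n : ℕ, exitTime A X = n ∧ X n ∈ F} = exitValue ω A F x := by
  have hset : {X : ℕ → Site d | ∃ n : ℕ, exitTime A X = n ∧ X n ∈ F} =
      ⋃ n : ℕ, {X | exitTime A X = n ∧ X n ∈ F} := by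
    ext X; simp
  have hind : ∀ n : ℕ, {X : ℕ → Site d | exitTime A X = n ∧ X n ∈ F}.indicator
      (fun _ => (1 : ℝ≥0∞)) = fun X =>
      (∏ i ∈ Finset.range n, A.indicator (fun _ => (1 : ℝ≥0∞)) (X i)) *
        (Aᶜ ∩ F).indicator (fun _ => 1) (X n) := by
    intro n
    ext X
    classical
    simp only [Set.indicator_apply, Set.mem_ofPred_eq, exitTime_eq_coe_iff]
    by_cases h1 : ∀ i < n, X i ∈ A
    · rw [Finset.prod_eq_one (fun i hi => if_pos (h1 i (Finset.mem_range.1 hi)))]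
      have h2 : (∀ i < n, X i ∈ A) ↔ True := iff_true_intro h1
      simp only [h2, and_true, one_mul, Set.mem_inter_iff, Set.mem_compl_iff]
    · obtain ⟨i, hi, hiA⟩ : ∃ i < n, X i ∉ A := by simpa using h1
      rw [Finset.prod_eq_zero (Finset.mem_range.2 hi) (if_neg hiA)]
      have h2 : (∀ i < n, X i ∈ A) ↔ False := iff_false_intro h1
      simp only [h2, and_false, false_and, if_false, zero_mul]
  have hmeas : ∀ n : ℕ, MeasurableSet {X : ℕ → Site d | exitTime A X = n ∧ X n ∈ F} := by
    intro n
    have : {X : ℕ → Site d | exitTime A X = n ∧ X n ∈ F} =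
        ((fun X => X n) ⁻¹' (Aᶜ ∩ F)) ∩ ⋂ i ∈ Finset.range n, (fun X => X i) ⁻¹' A := by
      ext X
      simp only [Set.mem_ofPred_eq, exitTime_eq_coe_iff, Set.mem_inter_iff, Set.mem_preimage,
        Set.mem_iInter, Finset.mem_range, Set.mem_compl_iff]
      tauto
    rw [this]
    refine MeasurableSet.inter (measurable_pi_apply n (Set.to_countable _).measurableSet) ?_
    exact Finset.measurableSet_biInter _ fun i _ =>
      measurable_pi_apply i (Set.to_countable _).measurableSet
  rw [hset, measure_iUnion ?_ hmeas]
  · unfold exitValue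
    refine tsum_congr fun n => ?_
    rw [← lintegral_indicator_one (hmeas n), ← lintegral_prod_indicator]
    have := hind n
    refine lintegral_congr fun X => ?_
    exact congrFun this X
  · intro m n hmn
    refine Set.disjoint_left.2 ?_
    rintro X ⟨hm, -⟩ ⟨hn, -⟩
    exact hmn (by exact_mod_cast hm.symm.trans hn)

lemma exitValue_of_notMem (ω : Env d) {A : Set (Site d)} (F : Set (Site d)) {x : Site d}
    (hx : x ∉ A) : exitValue ω A F x = F.indicator (fun _ => 1) x := by
  unfold exitValue
  rw [tsum_eq_single 0]
  · by_cases h : x ∈ F <;> simp [hx, h]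
  · intro n hn
    obtain ⟨m, rfl⟩ := Nat.exists_eq_succ_of_ne_zero hn
    rw [Function.iterate_succ', Function.comp_apply]
    exact Set.indicator_of_notMem hx _

lemma exitValue_of_mem (ω : Env d) {A : Set (Site d)} (F : Set (Site d)) {x : Site d}
    (hx : x ∈ A) : exitValue ω A F x =
      ∑ e : Dir d, ENNReal.ofReal (ω.prob x e) * exitValue ω A F (x + e.vec) := by
  unfold exitValue
  rw [tsum_eq_zero_add' ENNReal.summable]
  simp only [Function.iterate_zero, id_eq, Function.iterate_succ', Function.comp_apply]
  rw [Set.indicator_of_notMem (by simp [hx]), zero_add]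
  simp only [← ENNReal.tsum_mul_left]
  rw [← Summable.tsum_finsetSum fun _ _ => ENNReal.summable]
  refine tsum_congr fun n => ?_
  exact Set.indicator_of_mem hx _

lemma exitValue_le_one (ω : Env d) (A F : Set (Site d)) (x : Site d) :
    exitValue ω A F x ≤ 1 := by
  rw [← quenchedLaw_exit]; exact prob_le_one

lemma measurable_prob (x : Site d) (e : Dir d) : Measurable fun ω : Env d => ω.prob x e := by
  unfold Env.prob
  exact (measurable_pi_apply e).comp (measurable_subtype_coe.comp (measurable_pi_apply x))

/-- Each term of the series is a polynomial in finitely many transition probabilities. -/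
lemma measurable_exitValue (A F : Set (Site d)) (x : Site d) :
    Measurable fun ω : Env d => exitValue ω A F x := by
  unfold exitValue
  refine Measurable.tsum fun n => ?_
  induction n generalizing x with
  | zero => simp
  | succ n ih =>
    simp only [Function.iterate_succ', Function.comp_apply]
    by_cases hx : x ∈ A
    · simp only [stepOp, Set.indicator_of_mem hx]
      exact Finset.measurable_sum _ fun e _ =>
        ((measurable_prob x e).ennreal_ofReal).mul (ih _)
    · simp only [stepOp, Set.indicator_of_notMem hx]
      exact measurable_const

lemma exitValue_congr {ω ω' : Env d} {A : Set (Site d)} (h : ∀ x ∈ A, ω x = ω' x)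
    (F : Set (Site d)) (x : Site d) : exitValue ω A F x = exitValue ω' A F x := by
  have : stepOp ω A = stepOp ω' A := by
    funext f x
    by_cases hx : x ∈ A
    · simp only [stepOp, Set.indicator_of_mem hx, Env.prob, h x hx]
    · simp only [stepOp, Set.indicator_of_notMem hx]
  unfold exitValue
  rw [this]

section Box

variable [NeZero d] (b : BoxSpec d)

lemma BoxSpec.measurableSet_exitsFront : MeasurableSet b.exitsFront := by
  have : b.exitsFront = ⋃ n : ℕ, {X | exitTime b.box X = n ∧ X n ∈ b.frontBoundary} := by
    ext X; simp [BoxSpec.exitsFront]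
  rw [this]
  refine MeasurableSet.iUnion fun n => ?_
  have : {X : ℕ → Site d | exitTime b.box X = n ∧ X n ∈ b.frontBoundary} =
      ((fun X => X n) ⁻¹' (b.boxᶜ ∩ b.frontBoundary)) ∩
        ⋂ i ∈ Finset.range n, (fun X => X i) ⁻¹' b.box := by
    ext X
    simp only [Set.mem_ofPred_eq, exitTime_eq_coe_iff, Set.mem_inter_iff, Set.mem_preimage,
      Set.mem_iInter, Finset.mem_range, Set.mem_compl_iff]
    tauto
  rw [this]
  refine MeasurableSet.inter (measurable_pi_apply n (Set.to_countable _).measurableSet) ?_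
  exact Finset.measurableSet_biInter _ fun i _ =>
    measurable_pi_apply i (Set.to_countable _).measurableSet

lemma BoxSpec.q_eq (ω : Env d) : b.q ω = 1 - exitValue ω b.box b.frontBoundary 0 := by
  rw [← quenchedLaw_exit]
  unfold BoxSpec.q
  rw [prob_compl_eq_one_sub b.measurableSet_exitsFront]
  rfl

lemma BoxSpec.p_eq (ω : Env d) : b.p ω = exitValue ω b.box b.frontBoundary 0 := by
  unfold BoxSpec.p
  rw [b.q_eq, ENNReal.sub_sub_cancel ENNReal.one_ne_top (exitValue_le_one _ _ _ _)]

lemma BoxSpec.measurable_q : Measurable b.q := by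
  have : b.q = fun ω => 1 - exitValue ω b.box b.frontBoundary 0 := funext b.q_eq
  rw [this]
  exact (measurable_exitValue _ _ _).const_sub _

lemma BoxSpec.measurable_rho : Measurable b.rho := by
  have : b.p = fun ω => exitValue ω b.box b.frontBoundary 0 := funext b.p_eq
  have hp : Measurable b.p := by rw [this]; exact measurable_exitValue _ _ _
  exact b.measurable_q.div hp

lemma BoxSpec.q_congr {ω ω' : Env d} (h : ∀ x ∈ b.box, ω x = ω' x) : b.q ω = b.q ω' := by
  rw [b.q_eq, b.q_eq, exitValue_congr h]

lemma BoxSpec.rho_congr {ω ω' : Env d} (h : ∀ x ∈ b.box, ω x = ω' x) : b.rho ω = b.rho ω' := by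
  unfold BoxSpec.rho BoxSpec.p
  rw [b.q_congr h]

end Box

end RWRE

end

/-! ### Maximum principle and comparison for the coarse-grained walk -/

noncomputable section

namespace RWRE

variable {d : ℕ}

lemma Env.prob_nonneg (ω : Env d) (x : Site d) (e : Dir d) : 0 ≤ ω.prob x e := (ω x).2.1 e

lemma Env.sum_prob (ω : Env d) (x : Site d) : ∑ e, ω.prob x e = 1 := (ω x).2.2

/-- One step of the transition operator of the walk. -/
def avg (ω : Env d) (f : Site d → ℝ) (x : Site d) : ℝ := ∑ e, ω.prob x e * f (x + e.vec)

lemma avg_sub (ω : Env d) (f g : Site d → ℝ) (x : Site d) :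
    avg ω (fun y => f y - g y) x = avg ω f x - avg ω g x := by
  simp [avg, mul_sub, Finset.sum_sub_distrib]

lemma avg_const (ω : Env d) (c : ℝ) (x : Site d) : avg ω (fun _ => c) x = c := by
  simp [avg, ← Finset.sum_mul, ω.sum_prob]

lemma avg_const_mul (ω : Env d) (c : ℝ) (f : Site d → ℝ) (x : Site d) :
    avg ω (fun y => c * f y) x = c * avg ω f x := by
  simp only [avg, Finset.mul_sum]
  exact Finset.sum_congr rfl fun e _ => by ring

lemma avg_sum {ι : Type*} (s : Finset ι) (ω : Env d) (f : ι → Site d → ℝ) (x : Site d) :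
    avg ω (fun y => ∑ i ∈ s, f i y) x = ∑ i ∈ s, avg ω (f i) x := by
  simp only [avg, Finset.mul_sum]
  exact Finset.sum_comm

lemma avg_nonneg (ω : Env d) {f : Site d → ℝ} (hf : ∀ x, 0 ≤ f x) (x : Site d) :
    0 ≤ avg ω f x :=
  Finset.sum_nonneg fun e _ => mul_nonneg (ω.prob_nonneg x e) (hf _)

/-- Uniform ellipticity of a given environment. -/
def Env.Elliptic (ω : Env d) (κ : ℝ) : Prop := 0 < κ ∧ ∀ x e, κ ≤ ω.prob x e

/-- The translated environment. -/
def Env.shift (ω : Env d) (x : Site d) : Env d := fun y => ω (x + y)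

lemma Env.Elliptic.shift {ω : Env d} {κ : ℝ} (h : ω.Elliptic κ) (x : Site d) :
    (ω.shift x).Elliptic κ := ⟨h.1, fun _ e => h.2 _ e⟩

lemma avg_shift (ω : Env d) (x : Site d) (f : Site d → ℝ) (y : Site d) :
    avg (ω.shift x) (fun z => f (x + z)) y = avg ω f (x + y) := by
  simp only [avg, Env.shift, Env.prob, add_assoc]

/-- Among the points where a positive maximum is attained, take one with the largest first
coordinate. Its neighbour in direction +e₁ has a strictly smaller value and, by ellipticity,
positive weight, which contradicts subharmonicity. Thus neither recurrence nor finiteness of exit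
times has to be discussed. -/
theorem max_principle [NeZero d] {ω : Env d} {κ : ℝ} (hω : ω.Elliptic κ) {D : Set (Site d)}
    (hD : D.Finite) {f : Site d → ℝ} (hsub : ∀ x ∈ D, f x ≤ avg ω f x)
    (hout : ∀ x ∈ D, ∀ e : Dir d, x + e.vec ∉ D → f (x + e.vec) ≤ 0) :
    ∀ x ∈ D, f x ≤ 0 := by
  by_contra! hcon
  obtain ⟨x₀, hx₀, hpos⟩ := hcon
  obtain ⟨x₁, hx₁, hmax⟩ := Set.exists_max_image D f hD ⟨x₀, hx₀⟩
  have hM : 0 < f x₁ := hpos.trans_le (hmax _ hx₀)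
  obtain ⟨x₂, ⟨hx₂, hfx₂⟩, hmax₂⟩ := Set.exists_max_image {x | x ∈ D ∧ f x = f x₁}
    (fun x => x 0) (hD.subset fun x hx => hx.1) ⟨x₁, hx₁, rfl⟩
  have hle : ∀ e : Dir d, f (x₂ + e.vec) ≤ f x₁ := fun e => by
    by_cases h : x₂ + e.vec ∈ D
    · exact hmax _ h
    · exact (hout _ hx₂ e h).trans hM.le
  set e₀ : Dir d := (0, 1) with he₀
  have hlt : f (x₂ + e₀.vec) < f x₁ := by
    refine lt_of_le_of_ne (hle _) fun heq => ?_
    have hmem : x₂ + e₀.vec ∈ D := by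
      by_contra h
      exact absurd (hout _ hx₂ e₀ h) (by rw [heq]; exact not_le.2 hM)
    have := hmax₂ _ ⟨hmem, heq⟩
    simp [Dir.vec, he₀] at this
  have hs := hsub _ hx₂
  have h0 : avg ω (fun y => f x₁ - f y) x₂ ≤ 0 := by
    rw [avg_sub, avg_const]; linarith
  have h1 : ω.prob x₂ e₀ * (f x₁ - f (x₂ + e₀.vec)) ≤ avg ω (fun y => f x₁ - f y) x₂ :=
    Finset.single_le_sum (f := fun e => ω.prob x₂ e * (f x₁ - f (x₂ + Dir.vec e)))
      (fun e _ => mul_nonneg (ω.prob_nonneg _ _) (sub_nonneg.2 (hle e))) (Finset.mem_univ e₀)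
  have h2 : 0 < ω.prob x₂ e₀ * (f x₁ - f (x₂ + e₀.vec)) :=
    mul_pos (hω.1.trans_le (hω.2 _ _)) (sub_pos.2 hlt)
  linarith

/-- Real-valued version of `exitValue`. -/
def hit (ω : Env d) (A F : Set (Site d)) (x : Site d) : ℝ := (exitValue ω A F x).toReal

lemma hit_nonneg (ω : Env d) (A F : Set (Site d)) (x : Site d) : 0 ≤ hit ω A F x :=
  ENNReal.toReal_nonneg

lemma hit_le_one (ω : Env d) (A F : Set (Site d)) (x : Site d) : hit ω A F x ≤ 1 :=
  ENNReal.toReal_le_of_le_ofReal zero_le_one (by simpa using exitValue_le_one ω A F x)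

lemma exitValue_ne_top (ω : Env d) (A F : Set (Site d)) (x : Site d) :
    exitValue ω A F x ≠ ⊤ := ((exitValue_le_one ω A F x).trans_lt ENNReal.one_lt_top).ne

lemma ofReal_hit (ω : Env d) (A F : Set (Site d)) (x : Site d) :
    ENNReal.ofReal (hit ω A F x) = exitValue ω A F x :=
  ENNReal.ofReal_toReal (exitValue_ne_top ω A F x)

lemma hit_of_mem (ω : Env d) {A : Set (Site d)} (F : Set (Site d)) {x : Site d} (hx : x ∈ A) :
    hit ω A F x = avg ω (hit ω A F) x := by
  unfold hit avg
  rw [exitValue_of_mem ω F hx, ENNReal.toReal_sum]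
  · refine Finset.sum_congr rfl fun e _ => ?_
    rw [ENNReal.toReal_mul, ENNReal.toReal_ofReal (ω.prob_nonneg x e)]
  · exact fun e _ => ENNReal.mul_ne_top ENNReal.ofReal_ne_top (exitValue_ne_top _ _ _ _)

lemma hit_of_notMem_of_mem (ω : Env d) {A F : Set (Site d)} {x : Site d} (hx : x ∉ A)
    (hF : x ∈ F) : hit ω A F x = 1 := by
  unfold hit; rw [exitValue_of_notMem ω F hx]; simp [hF]

lemma hit_of_notMem_of_notMem (ω : Env d) {A F : Set (Site d)} {x : Site d} (hx : x ∉ A)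
    (hF : x ∉ F) : hit ω A F x = 0 := by
  unfold hit; rw [exitValue_of_notMem ω F hx]; simp [hF]

/-- The exit probability through `F` is subharmonic outside of `F`. -/
lemma hit_le_avg (ω : Env d) {A F : Set (Site d)} {x : Site d} (hx : x ∈ A ∨ x ∉ F) :
    hit ω A F x ≤ avg ω (hit ω A F) x := by
  by_cases hA : x ∈ A
  · exact (hit_of_mem ω F hA).le
  · rw [hit_of_notMem_of_notMem ω hA (hx.resolve_left hA)]
    exact avg_nonneg ω (hit_nonneg ω A F) x

lemma Dir.vec_neg (e : Dir d) : ∃ e' : Dir d, e'.vec = -e.vec :=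
  ⟨(e.1, -e.2), by simp [Dir.vec, Pi.single_neg]⟩

lemma boundary_finite {A : Set (Site d)} (hA : A.Finite) : (boundary A).Finite := by
  have : boundary A ⊆ ⋃ e : Dir d, (fun y => y - e.vec) '' A := by
    rintro x ⟨-, e, he⟩
    exact Set.mem_iUnion.2 ⟨e, x + e.vec, he, by simp⟩
  exact (Set.finite_iUnion fun e => hA.image _).subset this

lemma add_vec_mem_boundary {A : Set (Site d)} {x : Site d} (hx : x ∈ A) (e : Dir d)
    (h : x + e.vec ∉ A) : x + e.vec ∈ boundary A := by
  obtain ⟨e', he'⟩ := Dir.vec_neg e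
  exact ⟨h, e', by simpa [he'] using hx⟩

variable [NeZero d] {ω : Env d} {κ : ℝ}

/-- A function which is subharmonic on `x + A` is bounded by the mean of its bounds on the two
parts of the boundary, weighted with the exit probabilities. -/
theorem subharmonic_le_exit (hω : ω.Elliptic κ) {A F : Set (Site d)} (hA : A.Finite)
    (x : Site d) {w : Site d → ℝ} (hsub : ∀ y ∈ A, w (x + y) ≤ avg ω w (x + y)) {α β : ℝ}
    (hα : ∀ y ∈ boundary A, y ∈ F → w (x + y) ≤ α)
    (hβ : ∀ y ∈ boundary A, y ∉ F → w (x + y) ≤ β) {y : Site d} (hy : y ∈ A) :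
    w (x + y) ≤ hit (ω.shift x) A F y * α + (1 - hit (ω.shift x) A F y) * β := by
  set u := hit (ω.shift x) A F with hu
  have key := max_principle (hω.shift x) hA
    (f := fun y => w (x + y) - ((α - β) * u y - (-β))) ?_ ?_ y hy
  · linarith
  · intro z hz
    rw [avg_sub, avg_sub, avg_const_mul, avg_const, avg_shift, ← hit_of_mem _ F hz]
    have := hsub z hz
    linarith
  · intro z hz e he
    have hb := add_vec_mem_boundary hz e he
    by_cases hF : z + e.vec ∈ F
    · have := hα _ hb hF
      simp only [hu, hit_of_notMem_of_mem _ he hF]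
      linarith
    · have := hβ _ hb hF
      simp only [hu, hit_of_notMem_of_notMem _ he hF]
      linarith

/-- Comparison of a subharmonic function with a function which is superharmonic for the walk
observed at the successive exits from translates of `A`. -/
theorem coarse_comparison (hω : ω.Elliptic κ) {A F : Set (Site d)} (hA : A.Finite)
    (h0 : (0 : Site d) ∈ A) {D : Set (Site d)} (hD : D.Finite) (t w g : Site d → ℝ)
    (ht : ∀ x ∈ D, ∀ y ∈ boundary A, y ∈ F → t x < t (x + y))
    (hsub : ∀ x ∈ D, ∀ y ∈ A, w (x + y) ≤ avg ω w (x + y))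
    (hp : ∀ x ∈ D, 0 < hit (ω.shift x) A F 0)
    (hg : ∀ x ∈ D, ∃ α β : ℝ, (∀ y ∈ boundary A, y ∈ F → g (x + y) ≤ α) ∧
      (∀ y ∈ boundary A, y ∉ F → g (x + y) ≤ β) ∧
      hit (ω.shift x) A F 0 * α + (1 - hit (ω.shift x) A F 0) * β ≤ g x)
    (hout : ∀ x ∈ D, ∀ y ∈ boundary A, x + y ∉ D → w (x + y) ≤ g (x + y)) :
    ∀ x ∈ D, w x ≤ g x := by
  by_contra! hcon
  obtain ⟨x₀, hx₀, hpos⟩ := hcon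
  obtain ⟨x₁, hx₁, hmax⟩ := Set.exists_max_image D (fun x => w x - g x) hD ⟨x₀, hx₀⟩
  have hM : 0 < w x₁ - g x₁ := (sub_pos.2 hpos).trans_le (hmax _ hx₀)
  set M := w x₁ - g x₁ with hMdef
  -- The function `t` plays the role of the first coordinate in `max_principle`: exits through `F`
  -- increase it, so from a maximizer with `t` largest they must strictly lower `w - g`.
  obtain ⟨x₂, ⟨hx₂, hfx₂⟩, hmax₂⟩ := Set.exists_max_image {x | x ∈ D ∧ w x - g x = M}
    t (hD.subset fun x hx => hx.1) ⟨x₁, hx₁, rfl⟩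
  have hle : ∀ y ∈ boundary A, w (x₂ + y) - g (x₂ + y) ≤ M := fun y hy => by
    by_cases h : x₂ + y ∈ D
    · exact hmax _ h
    · linarith [hout _ hx₂ y hy h]
  have hlt : ∀ y ∈ boundary A, y ∈ F → w (x₂ + y) - g (x₂ + y) < M := fun y hy hF => by
    refine lt_of_le_of_ne (hle y hy) fun heq => ?_
    have hmem : x₂ + y ∈ D := by
      by_contra h
      linarith [hout _ hx₂ y hy h]
    exact absurd (hmax₂ _ ⟨hmem, heq⟩) (not_le.2 (ht _ hx₂ y hy hF))
  -- The boundary is finite, so the strict inequalities have a uniform gap, which the positive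
  -- probability of `F` turns into a contradiction.
  obtain ⟨M', hM', hle'⟩ : ∃ M' < M, ∀ y ∈ boundary A, y ∈ F →
      w (x₂ + y) - g (x₂ + y) ≤ M' := by
    rcases (boundary A ∩ F).eq_empty_or_nonempty with h | h
    · refine ⟨M - 1, by linarith, fun y hy hF => ?_⟩
      exact absurd (show y ∈ boundary A ∩ F from ⟨hy, hF⟩) (by simp [h])
    · obtain ⟨y, hy, hym⟩ := Set.exists_max_image (boundary A ∩ F)
        (fun y => w (x₂ + y) - g (x₂ + y)) ((boundary_finite hA).subset Set.inter_subset_left) h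
      exact ⟨_, hlt y hy.1 hy.2, fun z hz hF => hym z ⟨hz, hF⟩⟩
  obtain ⟨α, β, hα, hβ, hgx⟩ := hg _ hx₂
  have h1 := subharmonic_le_exit hω (F := F) hA x₂ (hsub _ hx₂) (α := α + M') (β := β + M)
    (fun y hy hF => by linarith [hα y hy hF, hle' y hy hF])
    (fun y hy hF => by linarith [hβ y hy hF, hle y hy]) h0
  rw [add_zero] at h1
  have h2 : hit (ω.shift x₂) A F 0 * M' < hit (ω.shift x₂) A F 0 * M :=
    mul_lt_mul_of_pos_left hM' (hp _ hx₂)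
  linarith

end RWRE

end

/-! ### Boxes in rotated coordinates -/

noncomputable section

namespace RWRE

variable {d : ℕ}

/-- The `i`-th coordinate of a site in the rotated basis. -/
def coord (R : EuclideanSpace ℝ (Fin d) ≃ₗᵢ[ℝ] EuclideanSpace ℝ (Fin d)) (i : Fin d)
    (x : Site d) : ℝ := dot x (R (basisVec i))

variable (R : EuclideanSpace ℝ (Fin d) ≃ₗᵢ[ℝ] EuclideanSpace ℝ (Fin d))

lemma toEuclid_add (x y : Site d) : toEuclid (x + y) = toEuclid x + toEuclid y := by
  ext i; simp [toEuclid]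

lemma coord_add (i : Fin d) (x y : Site d) :
    coord R i (x + y) = coord R i x + coord R i y := by
  simp [coord, dot, toEuclid_add, inner_add_left]

lemma coord_zero (i : Fin d) : coord R i 0 = 0 := by
  have := coord_add R i 0 0
  rw [add_zero] at this
  linarith

lemma coord_eq (i : Fin d) (x : Site d) : coord R i x = (R.symm (toEuclid x)) i := by
  have h : inner ℝ (toEuclid x) (R (basisVec i)) = inner ℝ (R.symm (toEuclid x)) (basisVec i) := by
    rw [← R.inner_map_map (R.symm (toEuclid x)), R.apply_symm_apply]
  unfold coord dot
  rw [h, basisVec, EuclideanSpace.inner_single_right]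
  simp

lemma norm_apply_basisVec (i : Fin d) : ‖R (basisVec i)‖ = 1 := by
  simp [basisVec]

lemma abs_inner_basisVec_le (v : EuclideanSpace ℝ (Fin d)) (i : Fin d) :
    |inner ℝ v (R (basisVec i))| ≤ ‖v‖ := by
  have := abs_real_inner_le_norm v (R (basisVec i))
  rwa [norm_apply_basisVec, mul_one] at this

lemma abs_coord_vec_le (i : Fin d) (e : Dir d) : |coord R i e.vec| ≤ 1 := by
  refine (abs_inner_basisVec_le R _ i).trans ?_
  have : toEuclid e.vec = EuclideanSpace.single e.1 ((e.2 : ℤ) : ℝ) := by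
    ext j
    by_cases h : j = e.1
    · subst h; simp [toEuclid, Dir.vec]
    · simp [toEuclid, Dir.vec, h]
  rw [this, PiLp.norm_single]
  rcases Int.units_eq_one_or e.2 with h | h <;> simp [h]

lemma abs_apply_le_sum_coord (x : Site d) (j : Fin d) :
    |(x j : ℝ)| ≤ ∑ i, |coord R i x| := by
  have h1 : |(x j : ℝ)| ≤ ‖toEuclid x‖ := by
    have := PiLp.norm_apply_le (toEuclid x) j
    simpa [toEuclid] using this
  have h2 : ‖toEuclid x‖ = ‖R.symm (toEuclid x)‖ := by simp
  have h3 : ∀ v : EuclideanSpace ℝ (Fin d), ‖v‖ ≤ ∑ i, |v i| := by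
    intro v
    have hv : v = ∑ i, EuclideanSpace.single i (v i) := by
      ext k; simp [Finset.sum_apply]
    conv_lhs => rw [hv]
    refine (norm_sum_le _ _).trans (Finset.sum_le_sum fun i _ => ?_)
    simp
  rw [h2] at h1
  refine h1.trans ((h3 _).trans (Finset.sum_le_sum fun i _ => ?_))
  rw [coord_eq]

variable [NeZero d]

/-- The box `(-(L-1), L+1) × (-L̃, L̃)^{d-1}` in the rotated basis. -/
def stdBox (L Lt : ℝ) : BoxSpec d := BoxSpec.mk R (L - 1) (L + 1) Lt

variable {R} {L Lt : ℝ}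

lemma mem_stdBox {x : Site d} : x ∈ (stdBox R L Lt).box ↔
    (-(L - 1) < coord R 0 x ∧ coord R 0 x < L + 1) ∧ ∀ i : Fin d, i ≠ 0 → |coord R i x| < Lt := by
  have h : x ∈ (stdBox R L Lt).box ↔ R.symm (toEuclid x) ∈
      {y : EuclideanSpace ℝ (Fin d) | y 0 ∈ Set.Ioo (-(L - 1)) (L + 1) ∧
        ∀ i : Fin d, i ≠ 0 → y i ∈ Set.Ioo (-Lt) Lt} := by
    constructor
    · rintro ⟨y, hy, hxy⟩
      rw [← hxy]
      simpa [stdBox] using hy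
    · intro h
      exact ⟨_, h, by simp [stdBox]⟩
  rw [h]
  simp only [coord_eq, Set.mem_ofPred_eq, Set.mem_Ioo, abs_lt]

lemma mem_front {x : Site d} : x ∈ (stdBox R L Lt).frontBoundary ↔
    x ∈ boundary (stdBox R L Lt).box ∧ L + 1 ≤ coord R 0 x ∧
      ∀ i : Fin d, i ≠ 0 → |coord R i x| < Lt := Iff.rfl

lemma stdBox_finite : (stdBox R L Lt).box.Finite := by
  set C : ℝ := ∑ i : Fin d, (|L| + 1 + |Lt|) with hC
  obtain ⟨N, hN⟩ := exists_nat_ge C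
  refine (Set.finite_Icc (fun _ : Fin d => -(N : ℤ)) (fun _ => (N : ℤ))).subset fun x hx => ?_
  rw [mem_stdBox] at hx
  have : ∀ j, |(x j : ℝ)| ≤ N := fun j => by
    refine (abs_apply_le_sum_coord R x j).trans (le_trans (Finset.sum_le_sum fun i _ => ?_) hN)
    by_cases hi : i = 0
    · subst hi
      rw [abs_le]
      constructor <;> linarith [hx.1.1, hx.1.2, le_abs_self L, neg_abs_le L, abs_nonneg Lt]
    · linarith [hx.2 i hi, le_abs_self Lt, abs_nonneg L]
  constructor <;> intro j
  · have := (abs_le.1 (this j)).1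
    exact_mod_cast this
  · have := (abs_le.1 (this j)).2
    exact_mod_cast this

lemma boundary_coord_zero {y : Site d} (hy : y ∈ boundary (stdBox R L Lt).box) :
    -L < coord R 0 y := by
  obtain ⟨-, e, he⟩ := hy
  rw [mem_stdBox, coord_add] at he
  have := abs_le.1 (abs_coord_vec_le R 0 e)
  linarith [he.1.1]

lemma boundary_coord {y : Site d} (hy : y ∈ boundary (stdBox R L Lt).box) {i : Fin d}
    (hi : i ≠ 0) : |coord R i y| < Lt + 1 := by
  obtain ⟨-, e, he⟩ := hy
  rw [mem_stdBox] at he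
  have h1 := he.2 i hi
  rw [coord_add, abs_lt] at h1
  have := abs_le.1 (abs_coord_vec_le R i e)
  rw [abs_lt]
  constructor <;> linarith

lemma zero_mem_stdBox (hL : 1 < L) (hLt : 0 < Lt) : (0 : Site d) ∈ (stdBox R L Lt).box := by
  rw [mem_stdBox]
  simp only [coord_zero, abs_zero]
  exact ⟨⟨by linarith, by linarith⟩, fun _ _ => hLt⟩

/-- Following a given path inside a tube costs at most one factor `κ` per step. -/
lemma pow_le_hit_of_chain {ω : Env d} {κ : ℝ} (hω : ω.Elliptic κ) (z : ℕ → Site d)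
    (h0 : z 0 ∈ (stdBox R L Lt).box)
    (hstep : ∀ m, z (m + 1) = z m ∨ ∃ e : Dir d, z (m + 1) = z m + e.vec)
    (hback : ∀ m, -(L - 1) < coord R 0 (z m))
    (hlat : ∀ m, ∀ i : Fin d, i ≠ 0 → |coord R i (z m)| < Lt)
    {M : ℕ} (hM : L + 1 ≤ coord R 0 (z M)) :
    κ ^ M ≤ hit ω (stdBox R L Lt).box (stdBox R L Lt).frontBoundary (z 0) := by
  set B := (stdBox R L Lt).box with hB
  set F := (stdBox R L Lt).frontBoundary with hF
  have hκ1 : κ ≤ 1 := by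
    have := Finset.single_le_sum (f := fun e => ω.prob 0 e) (fun e _ => ω.prob_nonneg 0 e)
      (Finset.mem_univ ((0, 1) : Dir d))
    rw [ω.sum_prob] at this
    exact (hω.2 0 (0, 1)).trans this
  have hmem : ∀ m, z m ∈ B ↔ coord R 0 (z m) < L + 1 := fun m => by
    rw [hB, mem_stdBox]
    exact ⟨fun h => h.1.2, fun h => ⟨⟨hback m, h⟩, hlat m⟩⟩
  have hex : ∃ m, z m ∉ B := ⟨M, fun h => absurd ((hmem M).1 h) (not_lt.2 hM)⟩
  classical
  -- The prescribed path may cross the front before time M. It is stopped at its first exit, which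
  -- must be through the front, and the bound is propagated backwards from there.
  set k := Nat.find hex with hk
  have hkspec : z k ∉ B := Nat.find_spec hex
  have hkmin : ∀ m < k, z m ∈ B := fun m hm => by
    have := Nat.find_min hex hm
    simpa using this
  have hkM : k ≤ M := Nat.find_min' hex fun h => absurd ((hmem M).1 h) (not_lt.2 hM)
  have hkpos : k ≠ 0 := fun h => hkspec (by rw [h]; exact h0)
  obtain ⟨j, hj⟩ := Nat.exists_eq_succ_of_ne_zero hkpos
  have hone : hit ω B F (z k) = 1 := by
    refine hit_of_notMem_of_mem ω hkspec ?_
    rw [hF, mem_front]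
    refine ⟨?_, not_lt.1 fun h => hkspec ((hmem k).2 h), hlat k⟩
    have hjB := hkmin j (by omega)
    rcases hstep j with h | ⟨e, h⟩
    · rw [hj] at hkspec; exact absurd (h ▸ hjB) hkspec
    · rw [hj, Nat.succ_eq_add_one, h] at hkspec ⊢
      exact add_vec_mem_boundary hjB e hkspec
  have hind : ∀ i ≤ k, κ ^ i ≤ hit ω B F (z (k - i)) := by
    intro i
    induction i with
    | zero => intro _; simp [hone]
    | succ i ih =>
      intro hi
      have hB' := hkmin (k - (i + 1)) (by omega)
      have hs := hstep (k - (i + 1))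
      rw [show k - (i + 1) + 1 = k - i by omega] at hs
      have ih' := ih (by omega)
      rcases hs with h | ⟨e, h⟩
      · rw [← h]
        exact (pow_le_pow_of_le_one hω.1.le hκ1 (Nat.le_succ i)).trans ih'
      · rw [hit_of_mem ω F hB', pow_succ']
        have := Finset.single_le_sum
          (f := fun e => ω.prob (z (k - (i + 1))) e * hit ω B F (z (k - (i + 1)) + Dir.vec e))
          (fun e _ => mul_nonneg (ω.prob_nonneg _ e) (hit_nonneg ω B F _)) (Finset.mem_univ e)
        refine le_trans ?_ this
        rw [← h]
        exact mul_le_mul (hω.2 _ _) ih' (pow_nonneg hω.1.le _) (ω.prob_nonneg _ _)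
  have := hind k le_rfl
  rw [Nat.sub_self] at this
  exact (pow_le_pow_of_le_one hω.1.le hκ1 hkM).trans this

end RWRE

end

/-! ### Lower bound on the front exit probability from ellipticity -/

noncomputable section

namespace RWRE

variable {d : ℕ}

/-- The integer part of `k l`, rounded towards zero. -/
def truncMul (l : ℝ) (k : ℕ) : ℤ := if 0 ≤ l then ⌊k * l⌋ else -⌊k * (-l)⌋

lemma truncMul_zero (l : ℝ) : truncMul l 0 = 0 := by simp [truncMul]

lemma abs_truncMul_sub_le (l : ℝ) (k : ℕ) : |(truncMul l k : ℝ) - k * l| ≤ 1 := by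
  unfold truncMul
  split_ifs
  · rw [abs_le]
    constructor <;> linarith [Int.floor_le (k * l), Int.lt_floor_add_one (k * l)]
  · rw [abs_le]
    push_cast
    constructor <;> linarith [Int.floor_le (k * (-l)), Int.lt_floor_add_one (k * (-l))]

lemma floor_succ_mul {l : ℝ} (h0 : 0 ≤ l) (h1 : l ≤ 1) (k : ℕ) :
    ⌊((k + 1 : ℕ) : ℝ) * l⌋ = ⌊k * l⌋ ∨ ⌊((k + 1 : ℕ) : ℝ) * l⌋ = ⌊k * l⌋ + 1 := by
  have h2 : ⌊k * l⌋ ≤ ⌊((k + 1 : ℕ) : ℝ) * l⌋ := by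
    apply Int.floor_le_floor
    push_cast; linarith
  have h3 : ⌊((k + 1 : ℕ) : ℝ) * l⌋ < ⌊k * l⌋ + 2 := by
    rw [Int.floor_lt]
    push_cast
    linarith [Int.lt_floor_add_one (k * l)]
  omega

lemma truncMul_succ {l : ℝ} (hl : |l| ≤ 1) (k : ℕ) :
    truncMul l (k + 1) = truncMul l k ∨
      ∃ u : ℤˣ, truncMul l (k + 1) = truncMul l k + (u : ℤ) := by
  obtain ⟨h1, h2⟩ := abs_le.1 hl
  unfold truncMul
  split_ifs with h
  · rcases floor_succ_mul h h2 k with h | h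
    · exact Or.inl h
    · exact Or.inr ⟨1, by simpa using h⟩
  · rcases floor_succ_mul (l := -l) (by linarith) (by linarith) k with h | h
    · exact Or.inl (by rw [h])
    · exact Or.inr ⟨-1, by rw [h]; simp; ring⟩

/-- A nearest neighbour path (with pauses) that follows the half-line `ℝ₊ l`, updating the
coordinates cyclically. -/
def linePath (l : EuclideanSpace ℝ (Fin d)) (m : ℕ) : Site d :=
  fun i => truncMul (l i) ((m + (d - 1 - i)) / d)

lemma linePath_zero (l : EuclideanSpace ℝ (Fin d)) : linePath l 0 = 0 := by
  funext i
  have : (0 + (d - 1 - (i : ℕ))) / d = 0 := Nat.div_eq_of_lt (by have := i.2; omega)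
  simp only [linePath, this, truncMul_zero, Pi.zero_apply]

/-- From m to m + 1 only the coordinate of index m mod d advances its clock, by one unit; as its
slope is at most 1 in absolute value, its rounded value changes by at most 1. -/
lemma linePath_succ {l : EuclideanSpace ℝ (Fin d)} (hl : ∀ i, |l i| ≤ 1) [NeZero d] (m : ℕ) :
    linePath l (m + 1) = linePath l m ∨ ∃ e : Dir d, linePath l (m + 1) = linePath l m + e.vec := by
  have hd : 0 < d := Nat.pos_of_ne_zero (NeZero.ne d)
  set i₀ : Fin d := ⟨m % d, Nat.mod_lt m hd⟩ with hi₀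
  have hdm := Nat.div_add_mod m d
  have hmod := Nat.mod_lt m hd
  set q := m / d
  set r := m % d
  have hk : ∀ i : Fin d, i ≠ i₀ → (m + 1 + (d - 1 - (i : ℕ))) / d = (m + (d - 1 - (i : ℕ))) / d := by
    intro i hi
    have hi' : (i : ℕ) ≠ r := fun h => hi (Fin.ext h)
    have := i.2
    rcases lt_or_gt_of_ne hi' with h | h
    · have e1 : m + 1 + (d - 1 - (i : ℕ)) = d * (q + 1) + (r - i) := by
        rw [← hdm, Nat.mul_add]; omega
      have e2 : m + (d - 1 - (i : ℕ)) = d * (q + 1) + (r - i - 1) := by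
        rw [← hdm, Nat.mul_add]; omega
      rw [e1, e2, Nat.mul_add_div hd, Nat.mul_add_div hd, Nat.div_eq_of_lt (by omega),
        Nat.div_eq_of_lt (by omega)]
    · have e1 : m + 1 + (d - 1 - (i : ℕ)) = d * q + (d + r - i) := by
        rw [← hdm]; omega
      have e2 : m + (d - 1 - (i : ℕ)) = d * q + (d + r - i - 1) := by
        rw [← hdm]; omega
      rw [e1, e2, Nat.mul_add_div hd, Nat.mul_add_div hd, Nat.div_eq_of_lt (by omega),
        Nat.div_eq_of_lt (by omega)]
  have hk₀ : (m + 1 + (d - 1 - (i₀ : ℕ))) / d = (m + (d - 1 - (i₀ : ℕ))) / d + 1 := by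
    have e1 : m + 1 + (d - 1 - r) = d * (q + 1) + 0 := by
      rw [← hdm, Nat.mul_add]; omega
    have e2 : m + (d - 1 - r) = d * q + (d - 1) := by
      rw [← hdm]; omega
    change (m + 1 + (d - 1 - r)) / d = (m + (d - 1 - r)) / d + 1
    rw [e1, e2, Nat.mul_add_div hd, Nat.mul_add_div hd, Nat.div_eq_of_lt hd,
      Nat.div_eq_of_lt (by omega)]
  rcases truncMul_succ (hl i₀) ((m + (d - 1 - (i₀ : ℕ))) / d) with h | ⟨u, h⟩
  · left
    funext i
    by_cases hi : i = i₀
    · rw [hi]; simp only [linePath]; rw [hk₀, h]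
    · simp only [linePath]; rw [hk i hi]
  · right
    refine ⟨(i₀, u), ?_⟩
    funext i
    by_cases hi : i = i₀
    · rw [hi]; simp only [linePath, Pi.add_apply, Dir.vec, Pi.single_eq_same]; rw [hk₀, h]
    · simp only [linePath, Pi.add_apply, Dir.vec, Pi.single_eq_of_ne hi, add_zero]
      rw [hk i hi]

/-- Each coordinate is off by at most 1 from rounding and at most 1 from the lag of its clock. -/
lemma norm_linePath_sub_le {l : EuclideanSpace ℝ (Fin d)} (hl : ∀ i, |l i| ≤ 1) [NeZero d]
    (m : ℕ) : ‖toEuclid (linePath l m) - ((m : ℝ) / d) • l‖ ≤ 2 * √(d : ℝ) := by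
  have hd : 0 < d := Nat.pos_of_ne_zero (NeZero.ne d)
  have hdR : (0 : ℝ) < d := by exact_mod_cast hd
  have hcoord : ∀ i, |(toEuclid (linePath l m) - ((m : ℝ) / d) • l) i| ≤ 2 := by
    intro i
    set k := (m + (d - 1 - (i : ℕ))) / d with hk
    have hk1 : |(k : ℝ) - m / d| ≤ 1 := by
      have h1 : k * d ≤ m + (d - 1 - (i : ℕ)) := Nat.div_mul_le_self _ _
      have h2 : m + (d - 1 - (i : ℕ)) < (k + 1) * d := by
        have := Nat.lt_mul_div_succ (m + (d - 1 - (i : ℕ))) hd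
        rw [mul_comm]; exact this
      have h3 : k * d ≤ m + d := by omega
      have h4 : m < (k + 1) * d := by omega
      have h3' : (k : ℝ) * d ≤ m + d := by exact_mod_cast h3
      have h4' : (m : ℝ) < (k + 1) * d := by exact_mod_cast h4
      rw [abs_le]
      constructor
      · have : (m : ℝ) / d < k + 1 := by rw [div_lt_iff₀ hdR]; exact h4'
        linarith
      · have : (k : ℝ) - 1 ≤ m / d := by rw [le_div_iff₀ hdR]; linarith
        linarith
    have e : (toEuclid (linePath l m) - ((m : ℝ) / d) • l) i =
        ((truncMul (l i) k : ℝ) - k * l i) + ((k : ℝ) - m / d) * l i := by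
      simp [toEuclid, linePath, hk]; ring
    rw [e]
    refine (abs_add_le _ _).trans ?_
    have h5 : |((k : ℝ) - m / d) * l i| ≤ 1 := by
      rw [abs_mul]
      exact mul_le_one₀ hk1 (abs_nonneg _) (hl i)
    linarith [abs_truncMul_sub_le (l i) k]
  rw [EuclideanSpace.norm_eq, show (2 : ℝ) * √(d : ℝ) = √(4 * d) by
    rw [Real.sqrt_mul (by norm_num), show (4 : ℝ) = 2 ^ 2 by norm_num, Real.sqrt_sq (by norm_num)]]
  apply Real.sqrt_le_sqrt
  calc ∑ i, ‖(toEuclid (linePath l m) - ((m : ℝ) / d) • l) i‖ ^ 2 ≤ ∑ i : Fin d, (4 : ℝ) := by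
        refine Finset.sum_le_sum fun i _ => ?_
        rw [Real.norm_eq_abs]
        have := hcoord i
        have h0 := abs_nonneg ((toEuclid (linePath l m) - ((m : ℝ) / d) • l) i)
        nlinarith
    _ = 4 * d := by simp [mul_comm]

variable (R : EuclideanSpace ℝ (Fin d) ≃ₗᵢ[ℝ] EuclideanSpace ℝ (Fin d))

lemma inner_basisVec (i j : Fin d) :
    inner ℝ (R (basisVec i)) (R (basisVec j)) = if i = j then (1 : ℝ) else 0 := by
  rw [R.inner_map_map]
  unfold basisVec
  rw [EuclideanSpace.inner_single_right]
  simp [eq_comm]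

variable [NeZero d]

lemma abs_coord_linePath_sub_le (i : Fin d) (m : ℕ) :
    |coord R i (linePath (R (basisVec 0)) m) - (m : ℝ) / d * (if (0 : Fin d) = i then 1 else 0)|
      ≤ 2 * √(d : ℝ) := by
  set l := R (basisVec 0) with hl
  have hl1 : ∀ i, |l i| ≤ 1 := fun i => by
    have := PiLp.norm_apply_le l i
    rwa [hl, norm_apply_basisVec, Real.norm_eq_abs] at this
  have h1 := abs_inner_basisVec_le R (toEuclid (linePath l m) - ((m : ℝ) / d) • l) i
  rw [inner_sub_left, inner_smul_left] at h1
  rw [hl, inner_basisVec] at h1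
  exact h1.trans (norm_linePath_sub_le hl1 m)

variable {R} {L Lt : ℝ}

/-- The discretized ray stays within 2√d of the axis, hence inside the tube as the sizes are at
least 3√d. It reaches the front in at most 3dL steps, each costing at most a factor κ. -/
theorem exp_le_hit_front (hd : 2 ≤ d) {ω : Env d} {κ : ℝ} (hω : ω.Elliptic κ)
    (hL : 3 * √(d : ℝ) ≤ L) (hLt : 3 * √(d : ℝ) ≤ Lt) :
    Real.exp (-(3 * d * L * Real.log (1 / κ))) ≤
      hit ω (stdBox R L Lt).box (stdBox R L Lt).frontBoundary 0 := by
  have hd2 : (2 : ℝ) ≤ d := by exact_mod_cast hd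
  have hs : (1.4 : ℝ) ≤ √(d : ℝ) := by
    apply Real.le_sqrt_of_sq_le; norm_num; linarith
  have hκ1 : κ ≤ 1 := by
    have := Finset.single_le_sum (f := fun e => ω.prob 0 e) (fun e _ => ω.prob_nonneg 0 e)
      (Finset.mem_univ ((0, 1) : Dir d))
    rw [ω.sum_prob] at this
    exact (hω.2 0 (0, 1)).trans this
  set l := R (basisVec 0) with hl
  set M : ℕ := ⌈d * (L + 1 + 2 * √(d : ℝ))⌉₊ with hM
  have hMle : (M : ℝ) ≤ 3 * d * L := by
    have h1 : (M : ℝ) < d * (L + 1 + 2 * √(d : ℝ)) + 1 := Nat.ceil_lt_add_one (by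
      have : 0 ≤ L := by linarith
      positivity)
    nlinarith
  have hMge : d * (L + 1 + 2 * √(d : ℝ)) ≤ M := Nat.le_ceil _
  have hc0 : ∀ m : ℕ, (m : ℝ) / d - 2 * √(d : ℝ) ≤ coord R 0 (linePath l m) := fun m => by
    have := (abs_le.1 (abs_coord_linePath_sub_le R 0 m)).1
    simp only [if_true, mul_one] at this
    linarith
  have hmain := pow_le_hit_of_chain (R := R) (L := L) (Lt := Lt) hω (linePath l) ?_ ?_ ?_ ?_
    (M := M) ?_
  · rw [linePath_zero] at hmain
    refine le_trans ?_ hmain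
    rw [show κ ^ M = Real.exp (-(M * Real.log (1 / κ))) by
      rw [one_div, Real.log_inv, mul_neg, neg_neg, mul_comm, Real.exp_mul, Real.exp_log hω.1,
        Real.rpow_natCast]]
    apply Real.exp_le_exp.2
    have : 0 ≤ Real.log (1 / κ) := Real.log_nonneg (by rw [le_div_iff₀ hω.1]; linarith)
    nlinarith
  · rw [linePath_zero]
    exact zero_mem_stdBox (by linarith) (by linarith)
  · refine linePath_succ fun i => ?_
    have := PiLp.norm_apply_le l i
    rwa [hl, norm_apply_basisVec, Real.norm_eq_abs] at this
  · intro m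
    have : (0 : ℝ) ≤ (m : ℝ) / d := by positivity
    linarith [hc0 m]
  · intro m i hi
    have := abs_coord_linePath_sub_le R i m
    rw [if_neg (Ne.symm hi), mul_zero, sub_zero] at this
    linarith
  · refine le_trans ?_ (hc0 M)
    have : L + 1 + 2 * √(d : ℝ) ≤ M / d := by
      rw [le_div_iff₀ (by linarith), mul_comm]; exact hMge
    linarith

end RWRE

end

/-! ### Number of sites in a box -/

noncomputable section

namespace RWRE

variable {d : ℕ}

/-- The unit cube attached to a lattice site. -/
def unitCube (x : Site d) : Set (Fin d → ℝ) :=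
  Set.univ.pi fun i => Set.Ico (x i : ℝ) (x i + 1)

lemma volume_unitCube (x : Site d) : volume (unitCube x) = 1 := by
  simp [unitCube, Real.volume_pi_Ico]

lemma measurableSet_unitCube (x : Site d) : MeasurableSet (unitCube x) :=
  MeasurableSet.univ_pi fun _ => measurableSet_Ico

lemma disjoint_unitCube {x y : Site d} (h : x ≠ y) : Disjoint (unitCube x) (unitCube y) := by
  refine Set.disjoint_left.2 fun v hx hy => h (funext fun i => ?_)
  have h1 := hx i (Set.mem_univ i)
  have h2 := hy i (Set.mem_univ i)
  have e1 : ⌊v i⌋ = x i := Int.floor_eq_iff.2 ⟨h1.1, h1.2⟩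
  have e2 : ⌊v i⌋ = y i := Int.floor_eq_iff.2 ⟨h2.1, h2.2⟩
  exact e1.symm.trans e2

lemma norm_toLp_sub_le {x : Site d} {v : Fin d → ℝ} (hv : v ∈ unitCube x) :
    ‖WithLp.toLp 2 v - toEuclid x‖ ≤ √(d : ℝ) := by
  rw [EuclideanSpace.norm_eq]
  apply Real.sqrt_le_sqrt
  calc ∑ i, ‖(WithLp.toLp 2 v - toEuclid x) i‖ ^ 2 ≤ ∑ i : Fin d, (1 : ℝ) := by
        refine Finset.sum_le_sum fun i _ => ?_
        have := hv i (Set.mem_univ i)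
        simp only [PiLp.sub_apply, toEuclid, Real.norm_eq_abs, sq_abs]
        have h0 : 0 ≤ v i - x i := by linarith [this.1]
        have h1 : v i - x i ≤ 1 := by linarith [this.2]
        nlinarith
    _ = d := by simp

variable (R : EuclideanSpace ℝ (Fin d) ≃ₗᵢ[ℝ] EuclideanSpace ℝ (Fin d))

lemma measurePreserving_rotate :
    MeasurePreserving (fun v : Fin d → ℝ => WithLp.ofLp (R.symm (WithLp.toLp 2 v))) :=
  (PiLp.volume_preserving_ofLp (Fin d)).comp
    (R.symm.measurePreserving.comp (PiLp.volume_preserving_toLp (Fin d)))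

variable [NeZero d]

/-- The number of sites of a box is at most a constant times its volume. -/
theorem card_stdBox_le {L Lt : ℝ} (hL : √(d : ℝ) ≤ L) (hLt : √(d : ℝ) ≤ Lt) :
    ((stdBox_finite (R := R) (L := L) (Lt := Lt)).toFinset.card : ℝ) ≤
      4 ^ d * (L * Lt ^ (d - 1)) := by
  set S := (stdBox_finite (R := R) (L := L) (Lt := Lt)).toFinset with hS
  have hd0 : 0 ≤ √(d : ℝ) := Real.sqrt_nonneg _
  set a : Fin d → ℝ := fun i => if i = 0 then -(L - 1) - √(d : ℝ) else -Lt - √(d : ℝ) with ha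
  set b : Fin d → ℝ := fun i => if i = 0 then L + 1 + √(d : ℝ) else Lt + √(d : ℝ) with hb
  set Q : Set (Fin d → ℝ) := Set.univ.pi fun i => Set.Icc (a i) (b i) with hQ
  -- Disjoint unit cubes replace counting by volume. They have diameter √d, so they fit in the
  -- rotated box enlarged by √d, and rotation preserves volume.
  have hsub : (⋃ x ∈ S, unitCube x) ⊆
      (fun v : Fin d → ℝ => WithLp.ofLp (R.symm (WithLp.toLp 2 v))) ⁻¹' Q := by
    intro v hv
    simp only [Set.mem_iUnion] at hv
    obtain ⟨x, hx, hvx⟩ := hv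
    rw [hS, Set.Finite.mem_toFinset, mem_stdBox] at hx
    intro i _
    have h1 : |(R.symm (WithLp.toLp 2 v)) i - coord R i x| ≤ √(d : ℝ) := by
      have h2 := PiLp.norm_apply_le (R.symm (WithLp.toLp 2 v - toEuclid x)) i
      rw [LinearIsometryEquiv.norm_map, Real.norm_eq_abs, map_sub, PiLp.sub_apply,
        ← coord_eq] at h2
      exact h2.trans (norm_toLp_sub_le hvx)
    rw [abs_le] at h1
    by_cases hi : i = 0
    · subst hi
      simp only [ha, hb, if_true]
      constructor <;> linarith [hx.1.1, hx.1.2, h1.1, h1.2]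
    · have h3 := abs_lt.1 (hx.2 i hi)
      simp only [ha, hb, if_neg hi]
      constructor <;> linarith [h1.1, h1.2, h3.1, h3.2]
  have hvol : volume (⋃ x ∈ S, unitCube x) = S.card := by
    rw [measure_biUnion_finset (fun x _ y _ h => disjoint_unitCube h)
      fun x _ => measurableSet_unitCube x]
    simp [volume_unitCube]
  have hle : (S.card : ℝ≥0∞) ≤ ENNReal.ofReal (4 ^ d * (L * Lt ^ (d - 1))) := by
    rw [← hvol]
    refine (measure_mono hsub).trans ?_
    rw [(measurePreserving_rotate R).measure_preimage
      (MeasurableSet.univ_pi fun _ => measurableSet_Icc).nullMeasurableSet, volume_pi_pi]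
    simp only [Real.volume_Icc]
    have hL0 : 0 ≤ L := hd0.trans hL
    have hLt0 : 0 ≤ Lt := hd0.trans hLt
    have h1d : 1 ≤ √(d : ℝ) := by
      rw [Real.one_le_sqrt]
      exact_mod_cast Nat.one_le_iff_ne_zero.2 (NeZero.ne d)
    calc ∏ i, ENNReal.ofReal (b i - a i)
        ≤ ∏ i : Fin d, ENNReal.ofReal (if i = 0 then 4 * L else 4 * Lt) := by
          refine Finset.prod_le_prod' fun i _ => ENNReal.ofReal_le_ofReal ?_
          simp only [ha, hb]
          split_ifs <;> linarith
      _ = ENNReal.ofReal (∏ i : Fin d, if i = 0 then 4 * L else 4 * Lt) := by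
          rw [ENNReal.ofReal_prod_of_nonneg]
          intro i _
          split_ifs <;> positivity
      _ = ENNReal.ofReal (4 ^ d * (L * Lt ^ (d - 1))) := by
          congr 1
          rw [← Finset.mul_prod_erase Finset.univ _ (Finset.mem_univ (0 : Fin d)), if_pos rfl,
            Finset.prod_congr rfl (g := fun _ => 4 * Lt)
              (fun i hi => if_neg (Finset.ne_of_mem_erase hi)), Finset.prod_const,
            Finset.card_erase_of_mem (Finset.mem_univ _), Finset.card_univ, Fintype.card_fin,
            mul_pow]
          obtain ⟨k, hk⟩ := Nat.exists_eq_succ_of_ne_zero (NeZero.ne d)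
          rw [show d - 1 = k by omega]
          conv_rhs => rw [hk, pow_succ]
          ring
  have := ENNReal.toReal_mono ENNReal.ofReal_ne_top hle
  rwa [ENNReal.toReal_natCast, ENNReal.toReal_ofReal] at this
  have : 0 ≤ L := hd0.trans hL
  have : 0 ≤ Lt := hd0.trans hLt
  positivity

end RWRE

end

/-! ### Slabs and the backward exit -/

noncomputable section

namespace RWRE

variable {d : ℕ} [NeZero d]

/-- The probability that the walk started at `x` leaves the box centred at `x` through the front. -/
def frontProb (b : BoxSpec d) (ω : Env d) (x : Site d) : ℝ :=
  hit (ω.shift x) b.box b.frontBoundary 0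

lemma frontProb_nonneg (b : BoxSpec d) (ω : Env d) (x : Site d) : 0 ≤ frontProb b ω x :=
  hit_nonneg _ _ _ _

lemma frontProb_le_one (b : BoxSpec d) (ω : Env d) (x : Site d) : frontProb b ω x ≤ 1 :=
  hit_le_one _ _ _ _

variable (R : EuclideanSpace ℝ (Fin d) ≃ₗᵢ[ℝ] EuclideanSpace ℝ (Fin d))

/-- The index of the slab of thickness `T` containing `x`, counted from level `-nT`. -/
def slab (T : ℝ) (n : ℕ) (x : Site d) : ℕ := ⌊(coord R 0 x + n * T) / T⌋₊

/-- Exit through the back of a box. -/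
def backSet (L : ℝ) : Set (Site d) := {y | coord R 0 y ≤ -(L - 1)}

/-- The signed coordinate attached to a direction. -/
def signCoord (e : Dir d) (x : Site d) : ℝ := ((e.2 : ℤ) : ℝ) * coord R e.1 x

/-- Exit through a lateral side of a box. -/
def sideSet (Lt : ℝ) (e : Dir d) : Set (Site d) := {y | Lt ≤ signCoord R e y}

variable {R}

lemma signCoord_add (e : Dir d) (x y : Site d) :
    signCoord R e (x + y) = signCoord R e x + signCoord R e y := by
  simp [signCoord, coord_add, mul_add]

lemma signCoord_zero (e : Dir d) : signCoord R e 0 = 0 := by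
  simp [signCoord, coord_zero]

lemma abs_signCoord (e : Dir d) (x : Site d) : |signCoord R e x| = |coord R e.1 x| := by
  unfold signCoord
  rcases Int.units_eq_one_or e.2 with h | h <;> simp [h]

lemma exists_signCoord_eq_abs (i : Fin d) (x : Site d) :
    ∃ u : ℤˣ, signCoord R (i, u) x = |coord R i x| := by
  rcases abs_cases (coord R i x) with h | h
  · exact ⟨1, by simp [signCoord, h.1]⟩
  · exact ⟨-1, by simp [signCoord, h.1]⟩

lemma slab_zero {T : ℝ} (hT : 0 < T) (n : ℕ) : slab R T n 0 = n := by
  simp [slab, coord_zero, hT.ne']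

lemma le_slab_iff {T : ℝ} (hT : 0 < T) {n : ℕ} {x : Site d} {k : ℕ} (hk : k ≠ 0) :
    k ≤ slab R T n x ↔ k * T ≤ coord R 0 x + n * T := by
  unfold slab
  rw [Nat.le_floor_iff' hk, le_div_iff₀ hT]

lemma slab_lt_iff {T : ℝ} (hT : 0 < T) {n : ℕ} {x : Site d} {k : ℕ} (hk : k ≠ 0) :
    slab R T n x < k ↔ coord R 0 x + n * T < k * T := by
  rw [← not_le, le_slab_iff hT hk, not_le]

lemma slab_front {L Lt : ℝ} (hL : 0 < L) {n : ℕ} {x y : Site d} (h1 : 1 ≤ slab R (L + 1) n x)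
    (hy : y ∈ (stdBox R L Lt).frontBoundary) :
    slab R (L + 1) n x + 1 ≤ slab R (L + 1) n (x + y) := by
  have hT : 0 < L + 1 := by linarith
  rw [le_slab_iff hT (by omega), coord_add]
  have := (le_slab_iff hT (n := n) (x := x) (R := R) (by omega : slab R (L + 1) n x ≠ 0)).1 le_rfl
  rw [mem_front] at hy
  push_cast
  linarith [hy.2.1]

/-- The floor in `ℕ` gives index 0 to every point below level -n(L+1), so climbing from index 0 to
index 1 needs the lower bound on the height of x. -/
lemma slab_front' {L Lt : ℝ} (hL : 0 < L) {n : ℕ} {x y : Site d}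
    (hx : -(n * (L + 1)) ≤ coord R 0 x)
    (hy : y ∈ (stdBox R L Lt).frontBoundary) :
    slab R (L + 1) n x + 1 ≤ slab R (L + 1) n (x + y) := by
  have hT : 0 < L + 1 := by linarith
  by_cases h1 : 1 ≤ slab R (L + 1) n x
  · exact slab_front hL h1 hy
  · rw [mem_front] at hy
    rw [show slab R (L + 1) n x = 0 by omega, le_slab_iff hT (by omega), coord_add]
    push_cast
    linarith [hy.2.1]

/-- The back face is at -(L-1) and one step overshoots by at most 1, so a descent is shorter than L,
less than a slab thickness. This is why the box is shorter behind than in front. -/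
lemma slab_boundary {L Lt : ℝ} (hL : 0 < L) {n : ℕ} {x y : Site d}
    (hy : y ∈ boundary (stdBox R L Lt).box) :
    slab R (L + 1) n x ≤ slab R (L + 1) n (x + y) + 1 := by
  have hT : 0 < L + 1 := by linarith
  by_contra! h
  have h1 := (le_slab_iff hT (n := n) (x := x) (R := R) (by omega : slab R (L + 1) n x ≠ 0)).1 le_rfl
  have h2 : slab R (L + 1) n (x + y) < slab R (L + 1) n x - 1 := by omega
  rw [slab_lt_iff hT (by omega), coord_add, Nat.cast_sub (by omega)] at h2
  push_cast at h2
  linarith [boundary_coord_zero hy]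

/-- Products of ratios along slabs. -/
def slabProd (r : ℕ → ℝ) (j : ℕ) : ℝ := ∏ k ∈ Finset.range j, r (k + 1)

/-- Sums of products of ratios. -/
def slabSum (r : ℕ → ℝ) (N m : ℕ) : ℝ := ∑ j ∈ Finset.Ico m N, slabProd r j

lemma slabProd_nonneg {r : ℕ → ℝ} (hr : ∀ k, 0 ≤ r k) (j : ℕ) : 0 ≤ slabProd r j :=
  Finset.prod_nonneg fun _ _ => hr _

lemma slabSum_nonneg {r : ℕ → ℝ} (hr : ∀ k, 0 ≤ r k) (N m : ℕ) : 0 ≤ slabSum r N m :=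
  Finset.sum_nonneg fun j _ => slabProd_nonneg hr j

lemma slabSum_anti {r : ℕ → ℝ} (hr : ∀ k, 0 ≤ r k) (N : ℕ) : Antitone (slabSum r N) := by
  intro m m' h
  exact Finset.sum_le_sum_of_subset_of_nonneg (Finset.Ico_subset_Ico_left h)
    fun j _ _ => slabProd_nonneg hr j

lemma slabSum_eq {r : ℕ → ℝ} {N m : ℕ} (h : m < N) :
    slabSum r N m = slabProd r m + slabSum r N (m + 1) :=
  Finset.sum_eq_sum_Ico_succ_bot h _

variable {L₀ Lt₀ L₁ Lt₁ κ : ℝ} {ω : Env d}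

/-- Gambler's ruin. The function G of the slab index is harmonic for the birth-death chain with
down/up ratios r, and it is decreasing, so larger climbs and smaller descents only help. The
starting point has index n, and the back of the large box has index 0. -/
theorem back_exit_le (hω : ω.Elliptic κ) (hL₀ : 1 < L₀) (hLt₀ : 0 < Lt₀) {n : ℕ} (hn : 1 ≤ n)
    (hn1 : n * (L₀ + 1) ≤ L₁ - 1) (hn2 : L₁ + 1 ≤ (n + 2) * (L₀ + 1))
    (hp : ∀ x, 0 < frontProb (stdBox R L₀ Lt₀) ω x) {r : ℕ → ℝ} (hr : ∀ k, 0 ≤ r k)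
    (hrp : ∀ x ∈ (stdBox R L₁ Lt₁).box, 1 - frontProb (stdBox R L₀ Lt₀) ω x ≤
      r (slab R (L₀ + 1) n x) * frontProb (stdBox R L₀ Lt₀) ω x) (hLt₁ : 0 < Lt₁) :
    slabSum r (2 * n + 2) 0 * hit ω (stdBox R L₁ Lt₁).box (backSet R L₁) 0 ≤
      slabSum r (2 * n + 2) n := by
  set B₁ := (stdBox R L₁ Lt₁).box with hB₁
  set w := hit ω B₁ (backSet R L₁) with hw
  set G := slabSum r (2 * n + 2) with hG
  have hT : 0 < L₀ + 1 := by linarith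
  have hG0 : 0 ≤ G 0 := slabSum_nonneg hr _ _
  have hn' : (1 : ℝ) ≤ n := by exact_mod_cast hn
  have hL₁ : 1 < L₁ := by nlinarith
  have hmem : ∀ x ∈ B₁, slab R (L₀ + 1) n x < 2 * n + 2 := fun x hx => by
    rw [hB₁, mem_stdBox] at hx
    rw [slab_lt_iff hT (by omega)]
    push_cast
    linarith [hx.1.2]
  have key := coarse_comparison hω (A := (stdBox R L₀ Lt₀).box)
    (F := (stdBox R L₀ Lt₀).frontBoundary) stdBox_finite (zero_mem_stdBox hL₀ hLt₀)
    (D := {x | x ∈ B₁ ∧ 1 ≤ slab R (L₀ + 1) n x}) (stdBox_finite.subset fun x hx => hx.1)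
    (coord R 0) (fun x => G 0 * w x) (fun x => G (slab R (L₀ + 1) n x)) ?_ ?_
    (fun x _ => hp x) ?_ ?_ 0 ⟨zero_mem_stdBox hL₁ hLt₁, by rwa [slab_zero hT]⟩
  · simpa only [slab_zero hT] using key
  · intro x _ y _ hy
    rw [mem_front] at hy
    rw [coord_add]
    linarith [hy.2.1]
  -- A small box may stick out of the large one, but from a slab of index at least 1 it cannot meet
  -- the back set, where `w` would fail to be subharmonic.
  · intro x hx y hy
    rw [avg_const_mul]
    refine mul_le_mul_of_nonneg_left (hit_le_avg ω (Or.inr ?_)) hG0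
    have h1 := (le_slab_iff hT one_ne_zero).1 hx.2
    rw [mem_stdBox] at hy
    simp only [backSet, Set.mem_ofPred_eq, not_le, coord_add]
    push_cast at h1
    linarith [hy.1.1]
  · rintro x ⟨hxB, hx1⟩
    obtain ⟨k, hk⟩ : ∃ k, slab R (L₀ + 1) n x = k + 1 :=
      ⟨slab R (L₀ + 1) n x - 1, by omega⟩
    have hk2 := hmem x hxB
    have hrx := hrp x hxB
    -- The bounds after a success and after a failure; the required inequality reduces to (1 - p) ≤
    -- r(k+1) p multiplied by the product of the first k ratios.
    refine ⟨G (k + 2), G k, fun y _ hy => ?_, fun y hy _ => ?_, ?_⟩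
    · have := slab_front (by linarith) hx1 hy
      exact slabSum_anti hr _ (by omega)
    · have := slab_boundary (by linarith) hy (n := n) (x := x)
      exact slabSum_anti hr _ (by omega)
    · rw [hk] at hk2 hrx ⊢
      change frontProb (stdBox R L₀ Lt₀) ω x * _ + (1 - frontProb (stdBox R L₀ Lt₀) ω x) * _ ≤ _
      have e1 : G k = slabProd r k + G (k + 1) := slabSum_eq (by omega)
      have e2 : G (k + 1) = slabProd r (k + 1) + G (k + 2) := slabSum_eq (by omega)
      have e3 : slabProd r (k + 1) = slabProd r k * r (k + 1) := Finset.prod_range_succ _ _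
      have h0 := slabProd_nonneg hr k
      have := mul_le_mul_of_nonneg_left hrx h0
      rw [e1, show G (k + 2) = G (k + 1) - slabProd r (k + 1) by linarith, e3]
      linarith
  · intro x hx y hy hxy
    by_cases hB : x + y ∈ B₁
    · have h0 : slab R (L₀ + 1) n (x + y) = 0 := by
        by_contra h
        exact hxy ⟨hB, by omega⟩
      rw [h0]
      exact mul_le_of_le_one_right hG0 (hit_le_one _ _ _ _)
    · by_cases hF : x + y ∈ backSet R L₁
      · have h0 : slab R (L₀ + 1) n (x + y) = 0 := by
          have : slab R (L₀ + 1) n (x + y) < 1 := by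
            rw [slab_lt_iff hT one_ne_zero]
            have : coord R 0 (x + y) ≤ -(L₁ - 1) := hF
            push_cast
            linarith
          omega
        rw [h0]
        exact mul_le_of_le_one_right hG0 (hit_le_one _ _ _ _)
      · rw [hw, hit_of_notMem_of_notMem ω hB hF, mul_zero]
        exact slabSum_nonneg hr _ _

end RWRE

end

/-! ### Lateral exits: a failure in every strip -/

noncomputable section

namespace RWRE

variable {d : ℕ} [NeZero d]
  {R : EuclideanSpace ℝ (Fin d) ≃ₗᵢ[ℝ] EuclideanSpace ℝ (Fin d)}
  {L₀ Lt₀ L₁ Lt₁ κ : ℝ} {ω : Env d}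

/-- Crossing half of a strip sideways requires a failure of one of the boxes in the strip. -/
lemma strip_centre_le (hω : ω.Elliptic κ) (hL₀ : 1 < L₀) (hLt₀ : 1 ≤ Lt₀) {n : ℕ}
    (hn1 : L₁ - 1 ≤ n * (L₀ + 1)) {e : Dir d} (he : e.1 ≠ 0)
    (hp : ∀ x, 0 < frontProb (stdBox R L₀ Lt₀) ω x) {c η M : ℝ} (hη : 0 ≤ η) (hM : 0 ≤ M)
    (hc : c + Lt₀ * (2 * n + 1) + Lt₀ + 1 ≤ Lt₁)
    (hq : ∀ x ∈ (stdBox R L₁ Lt₁).box, |signCoord R e x - c| < Lt₀ * (2 * n + 1) →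
      1 - frontProb (stdBox R L₀ Lt₀) ω x ≤ η)
    (hw : ∀ x ∈ (stdBox R L₁ Lt₁).box, signCoord R e x < c + Lt₀ * (2 * n + 1) + Lt₀ + 1 →
      hit ω (stdBox R L₁ Lt₁).box (sideSet R Lt₁ e) x ≤ M)
    {x : Site d} (hx : x ∈ (stdBox R L₁ Lt₁).box) (hxc : |signCoord R e x - c| < 1) :
    hit ω (stdBox R L₁ Lt₁).box (sideSet R Lt₁ e) x ≤ (2 * n + 1) * η * M := by
  set B₁ := (stdBox R L₁ Lt₁).box with hB₁
  set w := hit ω B₁ (sideSet R Lt₁ e) with hwdef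
  have hT : 0 < L₀ + 1 := by linarith
  set W := Lt₀ * (2 * n + 1) with hW
  have hn0 : (0 : ℝ) ≤ n := Nat.cast_nonneg n
  have hW1 : 1 ≤ W := by nlinarith
  set m := slab R (L₀ + 1) n with hm
  have hmem : ∀ x ∈ B₁, m x < 2 * n + 1 := fun x hx => by
    rw [hB₁, mem_stdBox] at hx
    rw [hm, slab_lt_iff hT (by omega)]
    push_cast
    linarith [hx.1.2]
  have hlow : ∀ x ∈ B₁, -(n * (L₀ + 1)) ≤ coord R 0 x := fun x hx => by
    rw [hB₁, mem_stdBox] at hx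
    linarith [hx.1.1]
  classical
  -- The barrier pays η for each slab still to be climbed, plus a full unit once the lateral
  -- displacement exceeds L̃₀ per climbed slab. A success climbs a slab and drifts by less than L̃₀,
  -- so without a failure the indicator never switches on.
  set g : Site d → ℝ := fun x => M * min 1 (η * ((2 * n + 1 - m x : ℕ) : ℝ) +
    if Lt₀ ≤ |signCoord R e x - c| - Lt₀ * m x then 1 else 0) with hg
  have hg0 : ∀ x, 0 ≤ g x := fun x => by
    refine mul_nonneg hM (le_min zero_le_one ?_)
    split_ifs <;> positivity
  have hgM : ∀ x, g x ≤ M := fun x => mul_le_of_le_one_right hM (min_le_left _ _)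
  have hside : ∀ x ∈ {x | x ∈ B₁ ∧ |signCoord R e x - c| < W},
      ∀ y ∈ boundary (stdBox R L₀ Lt₀).box, signCoord R e (x + y) < c + W + Lt₀ + 1 := by
    intro x hx y hy
    rw [signCoord_add]
    have h1 := boundary_coord hy he
    rw [← abs_signCoord] at h1
    linarith [(abs_lt.1 hx.2).2, (abs_lt.1 h1).2]
  have key := coarse_comparison hω (A := (stdBox R L₀ Lt₀).box)
    (F := (stdBox R L₀ Lt₀).frontBoundary) stdBox_finite (zero_mem_stdBox hL₀ (by linarith))
    (D := {x | x ∈ B₁ ∧ |signCoord R e x - c| < W}) (stdBox_finite.subset fun x hx => hx.1)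
    (coord R 0) w g ?_ ?_ (fun x _ => hp x) ?_ ?_ x ⟨hx, hxc.trans_le hW1⟩
  · refine key.trans ?_
    have h1 : ¬ (Lt₀ ≤ |signCoord R e x - c| - Lt₀ * m x) := by
      have : 0 ≤ Lt₀ * m x := by positivity
      linarith
    simp only [hg, if_neg h1, add_zero]
    rw [mul_comm _ M]
    refine mul_le_mul_of_nonneg_left ((min_le_right _ _).trans ?_) hM
    rw [mul_comm]
    refine mul_le_mul_of_nonneg_right ?_ hη
    have : 2 * n + 1 - m x ≤ 2 * n + 1 := Nat.sub_le _ _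
    exact_mod_cast this
  · intro x _ y _ hy
    rw [mem_front] at hy
    rw [coord_add]
    linarith [hy.2.1]
  · intro x hx y hy
    refine hit_le_avg ω (Or.inr ?_)
    rw [mem_stdBox] at hy
    have h1 := hy.2 e.1 he
    rw [← abs_signCoord] at h1
    simp only [sideSet, Set.mem_ofPred_eq, not_le, signCoord_add]
    linarith [(abs_lt.1 hx.2).2, (abs_lt.1 h1).2]
  · rintro x ⟨hxB, hxW⟩
    have hqx := hq x hxB hxW
    change ∃ α β : ℝ, _ ∧ _ ∧ frontProb (stdBox R L₀ Lt₀) ω x * α +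
      (1 - frontProb (stdBox R L₀ Lt₀) ω x) * β ≤ g x
    set p := frontProb (stdBox R L₀ Lt₀) ω x
    have hp0 : 0 < p := hp x
    have hp1 : p ≤ 1 := frontProb_le_one _ _ _
    by_cases h1 : 1 ≤ η * ((2 * n + 1 - m x : ℕ) : ℝ) +
        if Lt₀ ≤ |signCoord R e x - c| - Lt₀ * m x then 1 else 0
    · refine ⟨M, M, fun y _ _ => hgM _, fun y _ _ => hgM _, ?_⟩
      simp only [hg, min_eq_left h1]
      linarith
    · have h2 : ¬ (Lt₀ ≤ |signCoord R e x - c| - Lt₀ * m x) := by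
        intro h
        rw [if_pos h] at h1
        exact h1 (by linarith [show 0 ≤ η * ((2 * n + 1 - m x : ℕ) : ℝ) by positivity])
      rw [if_neg h2, add_zero] at h1
      have hk := hmem x hxB
      obtain ⟨k, hk'⟩ : ∃ k, 2 * n + 1 - m x = k + 1 := ⟨2 * n - m x, by omega⟩
      have hgx : g x = M * (η * (k + 1)) := by
        simp only [hg, if_neg h2, add_zero]
        rw [min_eq_right (not_le.1 h1).le, hk']
        push_cast; ring
      rw [hk'] at h1
      push_cast at h1
      refine ⟨M * (η * k), M, fun y _ hy => ?_, fun y _ _ => hgM _, ?_⟩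
      · have h3 := slab_front' (by linarith) (hlow x hxB) hy
        change m x + 1 ≤ m (x + y) at h3
        rw [mem_front] at hy
        have h4 := hy.2.2 e.1 he
        rw [← abs_signCoord] at h4
        have h5 : ¬ (Lt₀ ≤ |signCoord R e (x + y) - c| - Lt₀ * m (x + y)) := by
          have h6 : |signCoord R e (x + y) - c| ≤ |signCoord R e x - c| + |signCoord R e y| := by
            rw [signCoord_add, show signCoord R e x + signCoord R e y - c =
              (signCoord R e x - c) + signCoord R e y by ring]
            exact abs_add_le _ _
          have h7 : Lt₀ * (m x + 1) ≤ Lt₀ * m (x + y) :=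
            mul_le_mul_of_nonneg_left (by exact_mod_cast h3) (by linarith)
          linarith
        simp only [hg, if_neg h5, add_zero]
        refine mul_le_mul_of_nonneg_left ((min_le_right _ _).trans ?_) hM
        refine mul_le_mul_of_nonneg_left ?_ hη
        have : 2 * n + 1 - m (x + y) ≤ k := by omega
        exact_mod_cast this
      · rw [hgx]
        have hk0 : (0 : ℝ) ≤ k := Nat.cast_nonneg k
        have h8 : p * (η * k) + (1 - p) ≤ η * (k + 1) := by
          set a := η * ((k : ℝ) + 1) with ha
          have e1 : η * k = a - η := by rw [ha]; ring
          have e2 : η ≤ a := by rw [ha]; nlinarith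
          rw [e1]
          nlinarith [mul_nonneg (sub_nonneg.2 hp1) hη]
        have := mul_le_mul_of_nonneg_left h8 hM
        linarith
  · intro x hx y hy hxy
    have hs := hside x hx y hy
    -- Leaving the strip while still in the large box switches the indicator on, since the slab
    -- index is at most 2n and the half-width is L̃₀(2n+1). Leaving the large box this early cannot
    -- be through the chosen side, so there `w` vanishes.
    by_cases hB : x + y ∈ B₁
    · have h1 : W ≤ |signCoord R e (x + y) - c| := by
        by_contra h
        exact hxy ⟨hB, not_le.1 h⟩
      have h2 : m (x + y) < 2 * n + 1 := hmem _ hB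
      have h3 : (m (x + y) : ℝ) ≤ 2 * n := by
        have : m (x + y) ≤ 2 * n := by omega
        exact_mod_cast this
      have h4 : Lt₀ ≤ |signCoord R e (x + y) - c| - Lt₀ * m (x + y) := by
        have := mul_le_mul_of_nonneg_left h3 (by linarith : 0 ≤ Lt₀)
        linarith
      have h5 : g (x + y) = M := by
        simp only [hg, if_pos h4]
        rw [min_eq_left (by linarith [show 0 ≤ η * ((2 * n + 1 - m (x + y) : ℕ) : ℝ) by positivity]),
          mul_one]
      rw [h5]
      exact hw _ hB hs
    · rw [hwdef, hit_of_notMem_of_notMem ω hB (by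
        simp only [sideSet, Set.mem_ofPred_eq, not_le]; linarith)]
      exact hg0 _

/-- A nearest-neighbour path moves by at most 1 in the lateral coordinate, so from below c it must
visit the central layer of width 1 before reaching the side; the maximum principle carries the bound
there to all points below. -/
lemma strip_step (hω : ω.Elliptic κ) (hL₀ : 1 < L₀) (hLt₀ : 1 ≤ Lt₀) {n : ℕ}
    (hn1 : L₁ - 1 ≤ n * (L₀ + 1)) {e : Dir d} (he : e.1 ≠ 0)
    (hp : ∀ x, 0 < frontProb (stdBox R L₀ Lt₀) ω x) {c η M : ℝ} (hη : 0 ≤ η) (hM : 0 ≤ M)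
    (hc : c + Lt₀ * (2 * n + 1) + Lt₀ + 1 ≤ Lt₁)
    (hq : ∀ x ∈ (stdBox R L₁ Lt₁).box, |signCoord R e x - c| < Lt₀ * (2 * n + 1) →
      1 - frontProb (stdBox R L₀ Lt₀) ω x ≤ η)
    (hw : ∀ x ∈ (stdBox R L₁ Lt₁).box, signCoord R e x < c + Lt₀ * (2 * n + 1) + Lt₀ + 1 →
      hit ω (stdBox R L₁ Lt₁).box (sideSet R Lt₁ e) x ≤ M)
    {x : Site d} (hx : x ∈ (stdBox R L₁ Lt₁).box) (hxc : signCoord R e x < c + 1) :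
    hit ω (stdBox R L₁ Lt₁).box (sideSet R Lt₁ e) x ≤ (2 * n + 1) * η * M := by
  have hcentre := fun (x : Site d) (hx : x ∈ (stdBox R L₁ Lt₁).box)
    (hxc : |signCoord R e x - c| < 1) =>
    strip_centre_le hω hL₀ hLt₀ hn1 he hp hη hM hc hq hw hx hxc
  set B₁ := (stdBox R L₁ Lt₁).box with hB₁
  set w := hit ω B₁ (sideSet R Lt₁ e) with hwdef
  have hn0 : (0 : ℝ) ≤ n := Nat.cast_nonneg n
  by_cases hxc' : c ≤ signCoord R e x
  · exact hcentre x hx (by rw [abs_lt]; constructor <;> linarith)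
  · have key := max_principle hω (D := {x | x ∈ B₁ ∧ signCoord R e x < c})
      (stdBox_finite.subset fun x hx => hx.1) (f := fun x => w x - (2 * n + 1) * η * M) ?_ ?_ x
      ⟨hx, not_le.1 hxc'⟩
    · linarith
    · rintro y ⟨hy, -⟩
      rw [avg_sub, avg_const, ← hit_of_mem ω _ hy]
    · rintro y ⟨hy, hyc⟩ e' he'
      have h1 : signCoord R e (y + e'.vec) < c + 1 := by
        have := abs_coord_vec_le R e.1 e'
        rw [← abs_signCoord] at this
        rw [signCoord_add]
        linarith [(abs_le.1 this).2]
      by_cases hB : y + e'.vec ∈ B₁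
      · have h2 : c ≤ signCoord R e (y + e'.vec) := by
          by_contra h
          exact he' ⟨hB, not_le.1 h⟩
        have := hcentre _ hB (by rw [abs_lt]; constructor <;> linarith)
        linarith
      · rw [hwdef, hit_of_notMem_of_notMem ω hB (by
          simp only [sideSet, Set.mem_ofPred_eq, not_le]
          nlinarith)]
        have : 0 ≤ (2 * n + 1) * η * M := by positivity
        linarith

/-- Descending induction from the outermost strip inwards: the bound valid below the centre of one
strip serves as M for the preceding one. The spacing of the centres leaves room for the half-width
and one overshoot of a small box. -/
theorem side_exit_le (hω : ω.Elliptic κ) (hL₀ : 1 < L₀) (hLt₀ : 1 ≤ Lt₀) {n : ℕ}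
    (hn1 : L₁ - 1 ≤ n * (L₀ + 1)) {e : Dir d} (he : e.1 ≠ 0)
    (hp : ∀ x, 0 < frontProb (stdBox R L₀ Lt₀) ω x) {J : ℕ} {η : ℕ → ℝ} (hη : ∀ j, 0 ≤ η j)
    (hJ : J * (2 * Lt₀ * (2 * n + 2)) ≤ Lt₁) (hL₁ : 1 < L₁) (hLt₁ : 0 < Lt₁)
    (hq : ∀ j < J, ∀ x ∈ (stdBox R L₁ Lt₁).box,
      |signCoord R e x - j * (2 * Lt₀ * (2 * n + 2))| < Lt₀ * (2 * n + 1) →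
      1 - frontProb (stdBox R L₀ Lt₀) ω x ≤ η j) :
    hit ω (stdBox R L₁ Lt₁).box (sideSet R Lt₁ e) 0 ≤
      ∏ j ∈ Finset.range J, ((2 * n + 1) * η j) := by
  have hn0 : (0 : ℝ) ≤ n := Nat.cast_nonneg n
  have hind : ∀ i ≤ J, ∀ x ∈ (stdBox R L₁ Lt₁).box,
      signCoord R e x < ((J - i : ℕ) : ℝ) * (2 * Lt₀ * (2 * n + 2)) + 1 →
      hit ω (stdBox R L₁ Lt₁).box (sideSet R Lt₁ e) x ≤
        ∏ j ∈ Finset.Ico (J - i) J, ((2 * n + 1) * η j) := by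
    intro i
    induction i with
    | zero => intro _ x _ _; simpa using hit_le_one _ _ _ _
    | succ i ih =>
      intro hi x hx hxs
      have hJi : J - i = J - (i + 1) + 1 := by omega
      have hlt : J - (i + 1) < J := by omega
      rw [Finset.prod_eq_prod_Ico_succ_bot hlt, ← hJi]
      have hcast : ((J - i : ℕ) : ℝ) = ((J - (i + 1) : ℕ) : ℝ) + 1 := by rw [hJi]; push_cast; ring
      have hcast2 : ((J - (i + 1) : ℕ) : ℝ) + 1 ≤ J := by
        have : J - (i + 1) + 1 ≤ J := by omega
        exact_mod_cast this
      refine strip_step hω hL₀ hLt₀ hn1 he hp (hη _)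
        (Finset.prod_nonneg fun j _ => mul_nonneg (by positivity) (hη j)) ?_
        (hq _ hlt) ?_ hx hxs
      · have h1 : (((J - (i + 1) : ℕ) : ℝ) + 1) * (2 * Lt₀ * (2 * n + 2)) ≤
            J * (2 * Lt₀ * (2 * n + 2)) := mul_le_mul_of_nonneg_right hcast2 (by positivity)
        nlinarith
      · intro y hy hys
        refine ih (by omega) y hy ?_
        rw [hcast]
        nlinarith
  have := hind J le_rfl 0 (zero_mem_stdBox hL₁ hLt₁) (by rw [signCoord_zero, Nat.sub_self]; simp)
  rwa [Nat.sub_self, ← Finset.range_eq_Ico] at this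

end RWRE

end

/-! ### Quenched renormalization inequality -/

noncomputable section

namespace RWRE

variable {d : ℕ} [NeZero d]
  {R : EuclideanSpace ℝ (Fin d) ≃ₗᵢ[ℝ] EuclideanSpace ℝ (Fin d)}
  {L₀ Lt₀ L₁ Lt₁ κ : ℝ} {ω : Env d}

/-- The directions orthogonal to the first coordinate axis. -/
def sideDirs (d : ℕ) [NeZero d] : Finset (Dir d) := Finset.univ.filter fun e => e.1 ≠ 0

lemma mem_sideDirs {e : Dir d} : e ∈ sideDirs d ↔ e.1 ≠ 0 := by simp [sideDirs]

lemma card_sideDirs_le : (sideDirs d).card ≤ 2 * d := by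
  refine (Finset.card_filter_le _ _).trans ?_
  simp [mul_comm]

/-- A boundary point off the front lies in the back set or in some side set, so this is a union
bound, proved by comparing boundary values. -/
theorem one_sub_hit_front_le (hω : ω.Elliptic κ) (hL₁ : 1 < L₁) (hLt₁ : 0 < Lt₁) :
    1 - hit ω (stdBox R L₁ Lt₁).box (stdBox R L₁ Lt₁).frontBoundary 0 ≤
      hit ω (stdBox R L₁ Lt₁).box (backSet R L₁) 0 +
        ∑ e ∈ sideDirs d, hit ω (stdBox R L₁ Lt₁).box (sideSet R Lt₁ e) 0 := by
  set B₁ := (stdBox R L₁ Lt₁).box with hB₁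
  set F := (stdBox R L₁ Lt₁).frontBoundary with hF
  have key := max_principle hω (D := B₁) stdBox_finite (f := fun x => (1 - hit ω B₁ F x) -
    (hit ω B₁ (backSet R L₁) x - (-1) * ∑ e ∈ sideDirs d, hit ω B₁ (sideSet R Lt₁ e) x)) ?_ ?_ 0
    (zero_mem_stdBox hL₁ hLt₁)
  · linarith
  · intro x hx
    rw [avg_sub, avg_sub, avg_sub, avg_const, avg_const_mul, avg_sum, ← hit_of_mem ω F hx,
      ← hit_of_mem ω _ hx, Finset.sum_congr rfl fun e _ => hit_of_mem ω (sideSet R Lt₁ e) hx]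
  · intro x hx e he
    have h1 := hit_nonneg ω B₁ F (x + e.vec)
    have h2 := hit_nonneg ω B₁ (backSet R L₁) (x + e.vec)
    have h3 : 0 ≤ ∑ e' ∈ sideDirs d, hit ω B₁ (sideSet R Lt₁ e') (x + e.vec) :=
      Finset.sum_nonneg fun _ _ => hit_nonneg _ _ _ _
    have hb := add_vec_mem_boundary hx e he
    by_cases hlat : ∀ i : Fin d, i ≠ 0 → |coord R i (x + e.vec)| < Lt₁
    · by_cases hback : coord R 0 (x + e.vec) ≤ -(L₁ - 1)
      · rw [hit_of_notMem_of_mem ω he (F := backSet R L₁) hback]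
        linarith
      · have hfront : x + e.vec ∈ F := by
          rw [hF, mem_front]
          refine ⟨hb, ?_, hlat⟩
          by_contra h
          exact he (mem_stdBox.2 ⟨⟨not_le.1 hback, not_le.1 h⟩, hlat⟩)
        rw [hit_of_notMem_of_mem ω he hfront]
        linarith
    · push Not at hlat
      obtain ⟨i, hi, hiL⟩ := hlat
      obtain ⟨u, hu⟩ := exists_signCoord_eq_abs (R := R) i (x + e.vec)
      have h4 : 1 ≤ ∑ e' ∈ sideDirs d, hit ω B₁ (sideSet R Lt₁ e') (x + e.vec) := by
        have h5 := Finset.single_le_sum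
          (f := fun e' => hit ω B₁ (sideSet R Lt₁ e') (x + e.vec))
          (fun _ _ => hit_nonneg _ _ _ _) (mem_sideDirs.2 hi : ((i, u) : Dir d) ∈ sideDirs d)
        rw [← hit_of_notMem_of_mem ω he (F := sideSet R Lt₁ (i, u))
          (show Lt₁ ≤ _ by rw [hu]; exact hiL)]
        exact h5
      linarith

/-- Quenched renormalization inequality. -/
theorem quenched_renormalization (hω : ω.Elliptic κ) (hL₀ : 1 < L₀) (hLt₀ : 1 ≤ Lt₀) {n : ℕ}
    (hn : 1 ≤ n) (hn1 : n * (L₀ + 1) ≤ L₁ - 1) (hn2 : L₁ - 1 ≤ (n + 1) * (L₀ + 1))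
    (hn3 : L₁ + 1 ≤ (n + 2) * (L₀ + 1))
    (hp : ∀ x, 0 < frontProb (stdBox R L₀ Lt₀) ω x) {r : ℕ → ℝ} (hr : ∀ k, 0 ≤ r k)
    (hrp : ∀ x ∈ (stdBox R L₁ Lt₁).box, 1 - frontProb (stdBox R L₀ Lt₀) ω x ≤
      r (slab R (L₀ + 1) n x) * frontProb (stdBox R L₀ Lt₀) ω x)
    {J : ℕ} {η : Dir d → ℕ → ℝ} (hη : ∀ e j, 0 ≤ η e j)
    (hJ : J * (2 * Lt₀ * (2 * n + 4)) ≤ Lt₁) (hLt₁ : 0 < Lt₁)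
    (hq : ∀ e ∈ sideDirs d, ∀ j < J, ∀ x ∈ (stdBox R L₁ Lt₁).box,
      |signCoord R e x - j * (2 * Lt₀ * (2 * n + 4))| < Lt₀ * (2 * n + 3) →
      1 - frontProb (stdBox R L₀ Lt₀) ω x ≤ η e j)
    {Γ : ℝ} (hΓ1 : 1 ≤ Γ) (hΓ : slabSum r (2 * n + 2) 0 ≤ Γ)
    (hpΓ : 1 ≤ Γ * hit ω (stdBox R L₁ Lt₁).box (stdBox R L₁ Lt₁).frontBoundary 0) :
    1 - hit ω (stdBox R L₁ Lt₁).box (stdBox R L₁ Lt₁).frontBoundary 0 ≤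
      (2 * slabSum r (2 * n + 2) n +
        2 * Γ ^ 2 * ∑ e ∈ sideDirs d, ∏ j ∈ Finset.range J, ((2 * n + 3) * η e j)) *
      hit ω (stdBox R L₁ Lt₁).box (stdBox R L₁ Lt₁).frontBoundary 0 := by
  have hn' : (1 : ℝ) ≤ n := by exact_mod_cast hn
  have hL₁ : 1 < L₁ := by nlinarith
  have hback := back_exit_le hω hL₀ (by linarith : 0 < Lt₀) hn hn1 hn3 hp hr hrp hLt₁
  have hq1 := one_sub_hit_front_le (R := R) hω hL₁ hLt₁
  have hside : ∀ e ∈ sideDirs d, hit ω (stdBox R L₁ Lt₁).box (sideSet R Lt₁ e) 0 ≤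
      ∏ j ∈ Finset.range J, ((2 * n + 3) * η e j) := by
    intro e he
    -- The side estimate needs slabs that cover the depth of the box, the back estimate needs them
    -- to fit inside it; hence n + 1 here and the constants 2n + 3 and 2n + 4.
    have := side_exit_le (n := n + 1) hω hL₀ hLt₀ (by push_cast; linarith)
      (mem_sideDirs.1 he) hp (hη e) (J := J)
      (by push_cast; convert hJ using 3; ring) hL₁ hLt₁ (fun j hj x hx h => ?_)
    · refine this.trans_eq (Finset.prod_congr rfl fun j _ => ?_)
      push_cast; ring
    · refine hq e he j hj x hx ?_
      push_cast at h
      convert h using 1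
      · congr 2; ring
      · ring
  set p := hit ω (stdBox R L₁ Lt₁).box (stdBox R L₁ Lt₁).frontBoundary 0 with hpdef
  set wb := hit ω (stdBox R L₁ Lt₁).box (backSet R L₁) 0
  set V := ∑ e ∈ sideDirs d, ∏ j ∈ Finset.range J, ((2 * n + 3) * η e j) with hV
  set G := slabSum r (2 * n + 2) with hG
  have hv := Finset.sum_le_sum hside
  have hV0 : 0 ≤ V := Finset.sum_nonneg fun e _ =>
    Finset.prod_nonneg fun j _ => mul_nonneg (by positivity) (hη e j)
  have hGn0 : 0 ≤ G n := slabSum_nonneg hr _ _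
  have hG0n : 1 + G n ≤ G 0 := by
    have h1 : G 0 = slabProd r 0 + G 1 := slabSum_eq (by omega)
    have h2 : G n ≤ G 1 := slabSum_anti hr _ hn
    have h3 : slabProd r 0 = 1 := by simp [slabProd]
    linarith
  have hp0 : 0 ≤ p := hit_nonneg _ _ _ _
  -- If the lateral term V is small, then G 0 times p is at least 1/2, and dividing by it costs a
  -- factor 2. Otherwise the right-hand side already exceeds 1, because Γ also dominates 1/p.
  by_cases hcase : 2 * Γ * V ≤ 1
  · have hGpos : 0 < G 0 := by linarith
    have h1 : G 0 * (1 - p) ≤ G n + G 0 * V := by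
      have := mul_le_mul_of_nonneg_left (hq1.trans (add_le_add_right hv wb)) hGpos.le
      linarith
    have h2 : G 0 * V ≤ Γ * V := mul_le_mul_of_nonneg_right hΓ hV0
    have h3 : 1 / 2 ≤ G 0 * p := by linarith
    have h4 : G n + G 0 * V ≤ (2 * G n + 2 * Γ ^ 2 * V) * (G 0 * p) := by
      have h5 : Γ * V ≤ Γ ^ 2 * V := mul_le_mul_of_nonneg_right (by nlinarith) hV0
      have h6 : 0 ≤ 2 * G n + 2 * Γ ^ 2 * V := by positivity
      have := mul_le_mul_of_nonneg_left h3 h6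
      linarith
    have h7 : G 0 * (1 - p) ≤ G 0 * ((2 * G n + 2 * Γ ^ 2 * V) * p) := by linarith
    exact le_of_mul_le_mul_left h7 hGpos
  · have h1 : 1 ≤ 2 * Γ * V := (not_le.1 hcase).le
    have h2 : 1 ≤ (2 * Γ * V) * (Γ * p) := one_le_mul_of_one_le_of_one_le h1 hpΓ
    have h3 : 0 ≤ 2 * G n * p := by positivity
    have h4 : (2 * G n + 2 * Γ ^ 2 * V) * p = 2 * G n * p + (2 * Γ * V) * (Γ * p) := by ring
    rw [h4]
    linarith

end RWRE

end

/-! ### Independence, Hölder and stationarity of the environment -/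

noncomputable section

namespace RWRE

variable {d : ℕ}

/-- A function of the environment depends only on the environment in `S`. -/
def IsLocal (f : Env d → ℝ≥0∞) (S : Set (Site d)) : Prop :=
  ∀ ω ω' : Env d, (∀ x ∈ S, ω x = ω' x) → f ω = f ω'

lemma IsLocal.mono {f : Env d → ℝ≥0∞} {S S' : Set (Site d)} (h : IsLocal f S) (hS : S ⊆ S') :
    IsLocal f S' := fun ω ω' h' => h ω ω' fun x hx => h' x (hS hx)

/-- Freezing the environment to ω₀ outside S exhibits a measurable factorization through the
coordinates in S. -/
lemma IsLocal.exists_eq_comp {f : Env d → ℝ≥0∞} {S : Finset (Site d)} (h : IsLocal f S)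
    (hf : Measurable f) (ω₀ : Env d) :
    ∃ g : (S → stdSimplex ℝ (Dir d)) → ℝ≥0∞, Measurable g ∧
      f = g ∘ fun ω (x : S) => ω x := by
  classical
  refine ⟨fun η => f fun x => if hx : x ∈ S then η ⟨x, hx⟩ else ω₀ x, hf.comp ?_, ?_⟩
  · refine measurable_pi_lambda _ fun x => ?_
    by_cases hx : x ∈ S
    · simp only [hx, dif_pos]; exact measurable_pi_apply _
    · simp only [hx]; exact measurable_const
  · funext ω
    refine h _ _ fun x hx => ?_
    simp [Finset.mem_coe.1 hx]

lemma lintegral_prod_of_isLocal {Q : Measure (Env d)} [IsProbabilityMeasure Q] (hQ : IsIIDEnv Q)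
    {ι : Type*} (I : Finset ι) (f : ι → Env d → ℝ≥0∞) (S : ι → Set (Site d))
    (hfin : ∀ i, (S i).Finite) (hf : ∀ i, Measurable (f i)) (hloc : ∀ i, IsLocal (f i) (S i))
    (hdisj : ∀ i ∈ I, ∀ j ∈ I, i ≠ j → Disjoint (S i) (S j)) :
    ∫⁻ ω, ∏ i ∈ I, f i ω ∂Q = ∏ i ∈ I, ∫⁻ ω, f i ω ∂Q := by
  classical
  obtain ⟨ω₀⟩ : Nonempty (Env d) := nonempty_of_isProbabilityMeasure Q
  induction I using Finset.induction_on with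
  | empty => simp
  | insert a I ha ih =>
    have ih' := ih fun i hi j hj => hdisj i (Finset.mem_insert_of_mem hi) j
      (Finset.mem_insert_of_mem hj)
    simp only [Finset.prod_insert ha]
    rw [← ih']
    set A := (hfin a).toFinset
    set B := I.biUnion fun i => (hfin i).toFinset
    have hAB : Disjoint A B := by
      rw [Finset.disjoint_biUnion_right]
      intro i hi
      rw [Set.Finite.disjoint_toFinset]
      exact hdisj a (Finset.mem_insert_self _ _) i (Finset.mem_insert_of_mem hi)
        fun h => ha (h ▸ hi)
    have hind := hQ.1.indepFun_finset A B hAB fun x => measurable_pi_apply x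
    have hA : IsLocal (f a) A := (hloc a).mono (by simp [A])
    have hB : IsLocal (fun ω => ∏ i ∈ I, f i ω) B := by
      intro ω ω' h
      refine Finset.prod_congr rfl fun i hi => hloc i ω ω' fun x hx => h x ?_
      simp only [B, Finset.coe_biUnion, Set.mem_iUnion]
      exact ⟨i, hi, by simpa using hx⟩
    have hmB : Measurable fun ω => ∏ i ∈ I, f i ω := Finset.measurable_prod _ fun i _ => hf i
    obtain ⟨g, hg, hga⟩ := hA.exists_eq_comp (hf a) ω₀
    obtain ⟨g', hg', hgb⟩ := hB.exists_eq_comp hmB ω₀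
    have hind' : IndepFun (f a) (fun ω => ∏ i ∈ I, f i ω) Q := by
      rw [hga, hgb]
      exact hind.comp hg hg'
    exact lintegral_mul_eq_lintegral_mul_lintegral_of_indepFun (hf a) hmB hind'

/-- Hölder's inequality for products of local functions whose supports are disjoint along each
residue class modulo `3`. -/
lemma lintegral_prod_rpow_le {Q : Measure (Env d)} [IsProbabilityMeasure Q] (hQ : IsIIDEnv Q)
    (J : ℕ) (f : ℕ → Env d → ℝ≥0∞) (S : ℕ → Set (Site d))
    (hfin : ∀ i, (S i).Finite) (hf : ∀ i, Measurable (f i)) (hloc : ∀ i, IsLocal (f i) (S i))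
    (hdisj : ∀ i j, i + 3 ≤ j → Disjoint (S i) (S j)) {ε : ℝ≥0∞}
    (hε : ∀ i < J, ∫⁻ ω, f i ω ∂Q ≤ ε) :
    ∫⁻ ω, ∏ i ∈ Finset.range J, f i ω ^ (1 / 3 : ℝ) ∂Q ≤ (ε ^ (1 / 3 : ℝ)) ^ J := by
  have hsplit : ∀ g : ℕ → ℝ≥0∞, ∏ i ∈ Finset.range J, g i =
      ∏ c ∈ Finset.range 3, ∏ i ∈ (Finset.range J).filter (fun i => i % 3 = c), g i := by
    intro g
    rw [Finset.prod_fiberwise_of_maps_to]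
    intro i _
    exact Finset.mem_range.2 (Nat.mod_lt _ (by norm_num))
  have hpow : ∀ (I : Finset ℕ) (g : ℕ → ℝ≥0∞),
      ∏ i ∈ I, g i ^ (1 / 3 : ℝ) = (∏ i ∈ I, g i) ^ (1 / 3 : ℝ) := fun I g =>
    ENNReal.prod_rpow_of_nonneg (by norm_num)
  calc ∫⁻ ω, ∏ i ∈ Finset.range J, f i ω ^ (1 / 3 : ℝ) ∂Q
      = ∫⁻ ω, ∏ c ∈ Finset.range 3,
          (∏ i ∈ (Finset.range J).filter (fun i => i % 3 = c), f i ω) ^ (1 / 3 : ℝ) ∂Q := by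
        refine lintegral_congr fun ω => ?_
        rw [hsplit]
        exact Finset.prod_congr rfl fun c _ => hpow _ _
    _ ≤ ∏ c ∈ Finset.range 3,
          (∫⁻ ω, ∏ i ∈ (Finset.range J).filter (fun i => i % 3 = c), f i ω ∂Q) ^ (1 / 3 : ℝ) := by
        -- Hölder with three exponents 1/3 separates the residue classes; inside a class the
        -- supports are disjoint and the expectation factorizes.
        refine ENNReal.lintegral_prod_norm_pow_le _ (fun c _ => ?_) ?_ fun _ _ => by norm_num
        · exact (Finset.measurable_prod _ fun i _ => hf i).aemeasurable
        · norm_num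
    _ = ∏ c ∈ Finset.range 3, ∏ i ∈ (Finset.range J).filter (fun i => i % 3 = c),
          (∫⁻ ω, f i ω ∂Q) ^ (1 / 3 : ℝ) := by
        refine Finset.prod_congr rfl fun c _ => ?_
        rw [lintegral_prod_of_isLocal hQ _ f S hfin hf hloc, hpow]
        intro i hi j hj hij
        have h1 := (Finset.mem_filter.1 hi).2
        have h2 := (Finset.mem_filter.1 hj).2
        rcases lt_or_gt_of_ne hij with h | h
        · exact hdisj i j (by omega)
        · exact (hdisj j i (by omega)).symm
    _ = ∏ i ∈ Finset.range J, (∫⁻ ω, f i ω ∂Q) ^ (1 / 3 : ℝ) := (hsplit _).symm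
    _ ≤ ∏ i ∈ Finset.range J, ε ^ (1 / 3 : ℝ) := by
        refine Finset.prod_le_prod' fun i hi => ?_
        exact ENNReal.rpow_le_rpow (hε i (Finset.mem_range.1 hi)) (by norm_num)
    _ = (ε ^ (1 / 3 : ℝ)) ^ J := by simp

lemma measurable_shift (x : Site d) : Measurable fun ω : Env d => ω.shift x :=
  measurable_pi_lambda _ fun _ => measurable_pi_apply _

/-- An i.i.d. family has a product law with equal factors, and a translation only relabels them. -/
lemma measurePreserving_shift {Q : Measure (Env d)} [IsProbabilityMeasure Q] (hQ : IsIIDEnv Q)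
    (x : Site d) : MeasurePreserving (fun ω : Env d => ω.shift x) Q Q := by
  refine ⟨measurable_shift x, ?_⟩
  have h1 := hQ.1.map_fun_eq_infinitePi_map (fun y => measurable_pi_apply y)
  have h2 := (hQ.1.precomp (g := fun y : Site d => x + y)
    (add_right_injective x)).map_fun_eq_infinitePi_map (fun y => measurable_pi_apply (x + y))
  have h3 : ∀ y : Site d, Q.map (fun ω : Env d => ω y) = Q.map fun ω : Env d => ω 0 :=
    fun y => (hQ.2 y).map_eq
  have h4 : Q.map (fun ω : Env d => fun y => ω y) = Q := Measure.map_id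
  have h5 : Q.map (fun ω : Env d => ω.shift x) =
      Measure.infinitePi fun y : Site d => Q.map (fun ω : Env d => ω (x + y)) := h2
  rw [h5]
  simp only [h3] at h1 ⊢
  rw [← h1, h4]

lemma lintegral_shift {Q : Measure (Env d)} [IsProbabilityMeasure Q] (hQ : IsIIDEnv Q)
    (x : Site d) {f : Env d → ℝ≥0∞} (hf : Measurable f) :
    ∫⁻ ω, f (ω.shift x) ∂Q = ∫⁻ ω, f ω ∂Q :=
  (measurePreserving_shift hQ x).lintegral_comp hf

lemma rpow_sum_le {ι : Type*} (s : Finset ι) (f : ι → ℝ≥0∞) {p : ℝ} (hp : 0 < p) (hp1 : p ≤ 1) :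
    (∑ i ∈ s, f i) ^ p ≤ ∑ i ∈ s, f i ^ p := by
  classical
  induction s using Finset.induction_on with
  | empty => simp [hp]
  | insert a s ha ih =>
    rw [Finset.sum_insert ha, Finset.sum_insert ha]
    exact (ENNReal.rpow_add_le_add_rpow _ _ hp.le hp1).trans (add_le_add_right ih _)

lemma sup_rpow_le_sum {ι : Type*} (s : Finset ι) (f : ι → ℝ≥0∞) {p : ℝ} (hp : 0 < p) :
    (s.sup f) ^ p ≤ ∑ i ∈ s, f i ^ p := by
  classical
  induction s using Finset.induction_on with
  | empty => simp [hp]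
  | insert a s ha ih =>
    rw [Finset.sup_insert, Finset.sum_insert ha]
    rcases le_total (f a) (s.sup f) with h | h
    · rw [sup_eq_right.2 h]; exact ih.trans le_add_self
    · rw [sup_eq_left.2 h]; exact le_self_add

end RWRE

end

/-! ### Suprema over slabs and strips -/

noncomputable section

namespace RWRE

variable {d : ℕ}

/-- The supremum of `f` over the environments seen from the sites of `s`. -/
def supShift (f : Env d → ℝ≥0∞) (s : Finset (Site d)) (ω : Env d) : ℝ≥0∞ :=
  s.sup fun x => f (ω.shift x)

lemma measurable_supShift {f : Env d → ℝ≥0∞} (hf : Measurable f) (s : Finset (Site d)) :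
    Measurable (supShift f s) := by
  classical
  unfold supShift
  induction s using Finset.induction_on with
  | empty => simp
  | insert a s _ ih =>
    simp only [Finset.sup_insert]
    exact (hf.comp (measurable_shift a)).sup ih

lemma le_supShift (f : Env d → ℝ≥0∞) {s : Finset (Site d)} {x : Site d} (hx : x ∈ s) (ω : Env d) :
    f (ω.shift x) ≤ supShift f s ω := Finset.le_sup (f := fun x => f (ω.shift x)) hx

/-- The sites that are seen from some point of `s` through the window `B`. -/
def window (s : Finset (Site d)) (B : Set (Site d)) : Set (Site d) :=
  ⋃ x ∈ s, (fun y => x + y) '' B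

lemma window_finite (s : Finset (Site d)) {B : Set (Site d)} (hB : B.Finite) :
    (window s B).Finite := s.finite_toSet.biUnion fun _ _ => hB.image _

lemma isLocal_supShift {f : Env d → ℝ≥0∞} {B : Set (Site d)} (hf : IsLocal f B)
    (s : Finset (Site d)) : IsLocal (supShift f s) (window s B) := by
  intro ω ω' h
  refine Finset.sup_congr rfl fun x hx => hf _ _ fun y hy => h _ ?_
  simp only [window, Set.mem_iUnion]
  exact ⟨x, hx, y, hy, rfl⟩

lemma disjoint_window {s s' : Finset (Site d)} {B : Set (Site d)}
    (h : ∀ x ∈ s, ∀ x' ∈ s', ∀ y ∈ B, ∀ y' ∈ B, x + y ≠ x' + y') :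
    Disjoint (window s B) (window s' B) := by
  refine Set.disjoint_left.2 fun z hz hz' => ?_
  simp only [window, Set.mem_iUnion] at hz hz'
  obtain ⟨x, hx, y, hy, rfl⟩ := hz
  obtain ⟨x', hx', y', hy', heq⟩ := hz'
  exact h x hx x' hx' y hy y' hy' heq.symm

/-- Bound the supremum by the sum and use stationarity. -/
lemma lintegral_supShift_rpow_le {Q : Measure (Env d)} [IsProbabilityMeasure Q]
    (hQ : IsIIDEnv Q) {f : Env d → ℝ≥0∞} (hf : Measurable f) (s : Finset (Site d)) {a : ℝ}
    (ha : 0 < a) : ∫⁻ ω, supShift f s ω ^ a ∂Q ≤ s.card * ∫⁻ ω, f ω ^ a ∂Q := by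
  calc ∫⁻ ω, supShift f s ω ^ a ∂Q ≤ ∫⁻ ω, ∑ x ∈ s, f (ω.shift x) ^ a ∂Q :=
        lintegral_mono fun ω => sup_rpow_le_sum s _ ha
    _ = ∑ x ∈ s, ∫⁻ ω, f (ω.shift x) ^ a ∂Q :=
        lintegral_finsetSum _ fun x _ => (hf.comp (measurable_shift x)).pow_const a
    _ = s.card * ∫⁻ ω, f ω ^ a ∂Q := by
        rw [Finset.sum_congr rfl fun x _ => lintegral_shift hQ x (hf.pow_const a)]
        simp

variable [NeZero d]

lemma BoxSpec.p_shift (b : BoxSpec d) (ω : Env d) (x : Site d) :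
    b.p (ω.shift x) = ENNReal.ofReal (frontProb b ω x) := by
  rw [b.p_eq, frontProb, ofReal_hit]

lemma BoxSpec.q_shift (b : BoxSpec d) (ω : Env d) (x : Site d) :
    b.q (ω.shift x) = ENNReal.ofReal (1 - frontProb b ω x) := by
  rw [b.q_eq, ENNReal.ofReal_sub _ (frontProb_nonneg b ω x), ENNReal.ofReal_one, frontProb,
    ofReal_hit]

lemma BoxSpec.rho_shift (b : BoxSpec d) (ω : Env d) (x : Site d) (h : 0 < frontProb b ω x) :
    b.rho (ω.shift x) = ENNReal.ofReal ((1 - frontProb b ω x) / frontProb b ω x) := by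
  unfold BoxSpec.rho
  rw [b.q_shift, b.p_shift, ENNReal.ofReal_div_of_pos h]

lemma Env.shift_zero (ω : Env d) : ω.shift 0 = ω := by
  funext y; simp [Env.shift]

lemma BoxSpec.q_le_rho (b : BoxSpec d) (ω : Env d) : b.q ω ≤ b.rho ω := by
  have hp : b.p ω ≤ 1 := tsub_le_self
  unfold BoxSpec.rho
  rw [div_eq_mul_inv]
  exact le_mul_of_one_le_right zero_le (ENNReal.one_le_inv.2 hp)

variable (R : EuclideanSpace ℝ (Fin d) ≃ₗᵢ[ℝ] EuclideanSpace ℝ (Fin d))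

/-- The sites of a box, as a finite set. -/
def boxSites (L Lt : ℝ) : Finset (Site d) := (stdBox_finite (R := R) (L := L) (Lt := Lt)).toFinset

lemma mem_boxSites {L Lt : ℝ} {x : Site d} : x ∈ boxSites R L Lt ↔ x ∈ (stdBox R L Lt).box := by
  simp [boxSites]

open Classical in
/-- The sites of a box in the `k`-th slab. -/
def slabSites (L Lt T : ℝ) (n k : ℕ) : Finset (Site d) :=
  (boxSites R L Lt).filter fun x => slab R T n x = k

open Classical in
/-- The sites of a box in a strip of half-width `W` around `c`. -/
def stripSites (L Lt : ℝ) (e : Dir d) (c W : ℝ) : Finset (Site d) :=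
  (boxSites R L Lt).filter fun x => |signCoord R e x - c| < W

lemma card_slabSites_le {L Lt : ℝ} (hL : √(d : ℝ) ≤ L) (hLt : √(d : ℝ) ≤ Lt) (T : ℝ) (n k : ℕ) :
    ((slabSites R L Lt T n k).card : ℝ≥0∞) ≤ ENNReal.ofReal (4 ^ d * (L * Lt ^ (d - 1))) := by
  rw [← ENNReal.ofReal_natCast]
  refine ENNReal.ofReal_le_ofReal (le_trans ?_ (card_stdBox_le R hL hLt))
  exact_mod_cast Finset.card_filter_le _ _

lemma card_stripSites_le {L Lt : ℝ} (hL : √(d : ℝ) ≤ L) (hLt : √(d : ℝ) ≤ Lt) (e : Dir d)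
    (c W : ℝ) :
    ((stripSites R L Lt e c W).card : ℝ≥0∞) ≤ ENNReal.ofReal (4 ^ d * (L * Lt ^ (d - 1))) := by
  rw [← ENNReal.ofReal_natCast]
  refine ENNReal.ofReal_le_ofReal (le_trans ?_ (card_stdBox_le R hL hLt))
  exact_mod_cast Finset.card_filter_le _ _

variable {R} {L₀ Lt₀ L₁ Lt₁ κ : ℝ} {ω : Env d}

lemma slabSum_le {r : ℕ → ℝ} {ρ : ℝ} (hr : ∀ k, 0 ≤ r k) (hρ : ∀ k, r k ≤ ρ) (h1 : 1 ≤ ρ) (N : ℕ) :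
    slabSum r (N + 1) 0 ≤ (N + 1) * ρ ^ N := by
  have h2 : ∀ j ∈ Finset.Ico 0 (N + 1), slabProd r j ≤ ρ ^ N := by
    intro j hj
    calc slabProd r j ≤ ∏ k ∈ Finset.range j, ρ :=
          Finset.prod_le_prod (fun _ _ => hr _) fun _ _ => hρ _
      _ = ρ ^ j := by simp
      _ ≤ ρ ^ N := pow_le_pow_right₀ h1 (by have := (Finset.mem_Ico.1 hj).2; omega)
  refine (Finset.sum_le_card_nsmul _ _ _ h2).trans_eq ?_
  simp

/-- The quenched inequality with r and η taken as suprema of ρ₀ and q₀ over slabs and strips, so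
that the right-hand side is a sum of products of local functions of the environment. -/
theorem rho_le (hd : 2 ≤ d) (hω : ω.Elliptic κ) (hκ : 1 ≤ Real.log (1 / κ))
    (hL₀ : 3 * √(d : ℝ) ≤ L₀) (hLt₀ : 3 * √(d : ℝ) ≤ Lt₀) {n : ℕ}
    (hn : 1 ≤ n) (hn1 : n * (L₀ + 1) ≤ L₁ - 1) (hn2 : L₁ - 1 ≤ (n + 1) * (L₀ + 1))
    (hn3 : L₁ + 1 ≤ (n + 2) * (L₀ + 1)) {J : ℕ}
    (hJ : J * (2 * Lt₀ * (2 * n + 4)) ≤ Lt₁) (hLt₁ : 3 * √(d : ℝ) ≤ Lt₁) :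
    (stdBox R L₁ Lt₁).rho ω ≤
      2 * ∑ j ∈ Finset.Ico n (2 * n + 2), ∏ k ∈ Finset.range j,
        supShift (stdBox R L₀ Lt₀).rho (slabSites R L₁ Lt₁ (L₀ + 1) n (k + 1)) ω +
      ENNReal.ofReal (2 * Real.exp (24 * d * Real.log (1 / κ) * L₁)) *
        ∑ e ∈ sideDirs d, ∏ j ∈ Finset.range J, ((2 * n + 3 : ℕ) : ℝ≥0∞) *
          supShift (stdBox R L₀ Lt₀).q (stripSites R L₁ Lt₁ e (j * (2 * Lt₀ * (2 * n + 4)))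
            (Lt₀ * (2 * n + 3))) ω := by
  have hd2 : (2 : ℝ) ≤ d := by exact_mod_cast hd
  have hs : (1 : ℝ) ≤ √(d : ℝ) := by
    rw [Real.one_le_sqrt]; linarith
  have hn' : (1 : ℝ) ≤ n := by exact_mod_cast hn
  have hL₁ : L₀ ≤ L₁ := by nlinarith
  have hL₀0 : 0 ≤ L₀ := by linarith
  have hL₁0 : 0 ≤ L₁ := by linarith
  set Λ := Real.log (1 / κ) with hΛ
  have hΛ0 : 0 ≤ Λ := by linarith
  set rr : ℕ → ℝ≥0∞ := fun k =>
    supShift (stdBox R L₀ Lt₀).rho (slabSites R L₁ Lt₁ (L₀ + 1) n k) ω with hrr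
  set qq : Dir d → ℕ → ℝ≥0∞ := fun e j => supShift (stdBox R L₀ Lt₀).q
    (stripSites R L₁ Lt₁ e (j * (2 * Lt₀ * (2 * n + 4))) (Lt₀ * (2 * n + 3))) ω with hqq
  have hfp : ∀ x, Real.exp (-(3 * d * L₀ * Λ)) ≤ frontProb (stdBox R L₀ Lt₀) ω x := fun x =>
    exp_le_hit_front hd (hω.shift x) hL₀ hLt₀
  have hp : ∀ x, 0 < frontProb (stdBox R L₀ Lt₀) ω x := fun x => (Real.exp_pos _).trans_le (hfp x)
  set ρm := Real.exp (3 * d * L₀ * Λ) with hρm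
  have hρm1 : 1 ≤ ρm := Real.one_le_exp (by positivity)
  have hrho : ∀ x, (stdBox R L₀ Lt₀).rho (ω.shift x) ≤ ENNReal.ofReal ρm := fun x => by
    rw [BoxSpec.rho_shift _ _ _ (hp x)]
    refine ENNReal.ofReal_le_ofReal ?_
    rw [div_le_iff₀ (hp x)]
    have h1 : 1 ≤ ρm * frontProb (stdBox R L₀ Lt₀) ω x := by
      calc 1 = ρm * Real.exp (-(3 * d * L₀ * Λ)) := by rw [hρm, ← Real.exp_add]; simp
        _ ≤ _ := mul_le_mul_of_nonneg_left (hfp x) (by positivity)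
    linarith [hp x]
  have hrr_le : ∀ k, rr k ≤ ENNReal.ofReal ρm := fun k => Finset.sup_le fun x _ => hrho x
  have hqq_le : ∀ e j, qq e j ≤ 1 := fun e j => Finset.sup_le fun x _ => by
    rw [BoxSpec.q_shift]
    exact ENNReal.ofReal_le_one.2 (by linarith [hp x])
  have hrr_ne : ∀ k, rr k ≠ ⊤ := fun k => ((hrr_le k).trans_lt ENNReal.ofReal_lt_top).ne
  have hqq_ne : ∀ e j, qq e j ≠ ⊤ := fun e j => ((hqq_le e j).trans_lt ENNReal.one_lt_top).ne
  -- Ellipticity bounds the slab sum by (2n+2) exp((2n+1) 3dL₀Λ), and (2n+1)L₀ ≤ 3L₁ gives 9dΛL₁ in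
  -- the exponent; the remaining 3dΛL₁ absorbs the polynomial factor. The same Γ dominates 1/p at
  -- the large scale.
  set Γ := Real.exp (12 * d * Λ * L₁) with hΓ
  have hΓ2 : 2 * Γ ^ 2 = 2 * Real.exp (24 * d * Λ * L₁) := by
    rw [hΓ, ← Real.exp_nat_mul]; congr 2; push_cast; ring
  have key := quenched_renormalization (R := R) (L₁ := L₁) (Lt₁ := Lt₁) hω (by linarith : 1 < L₀)
    (by linarith : 1 ≤ Lt₀) hn hn1 hn2 hn3 hp
    (r := fun k => (rr k).toReal) (fun _ => ENNReal.toReal_nonneg) ?_ (J := J)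
    (η := fun e j => (qq e j).toReal) (fun _ _ => ENNReal.toReal_nonneg) hJ (by linarith) ?_
    (Γ := Γ) (Real.one_le_exp (by positivity)) ?_ ?_
  · rw [hΓ2] at key
    have hp1 : 0 < hit ω (stdBox R L₁ Lt₁).box (stdBox R L₁ Lt₁).frontBoundary 0 :=
      (Real.exp_pos _).trans_le (exp_le_hit_front hd hω (by linarith) hLt₁)
    have h0 := BoxSpec.rho_shift (stdBox R L₁ Lt₁) ω 0 (by
      unfold frontProb; rw [Env.shift_zero]; exact hp1)
    unfold frontProb at h0
    rw [Env.shift_zero] at h0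
    rw [h0]
    refine (ENNReal.ofReal_le_ofReal ((div_le_iff₀ hp1).2 key)).trans ?_
    refine ENNReal.ofReal_add_le.trans (add_le_add ?_ ?_)
    · rw [ENNReal.ofReal_mul (by norm_num), ENNReal.ofReal_ofNat]
      refine mul_le_mul_right ?_ _
      unfold slabSum slabProd
      rw [ENNReal.ofReal_sum_of_nonneg
        fun _ _ => Finset.prod_nonneg fun _ _ => ENNReal.toReal_nonneg]
      refine Finset.sum_le_sum fun j _ => ?_
      rw [ENNReal.ofReal_prod_of_nonneg fun _ _ => ENNReal.toReal_nonneg]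
      exact Finset.prod_le_prod' fun k _ => ENNReal.ofReal_toReal_le
    · rw [ENNReal.ofReal_mul (by positivity)]
      refine mul_le_mul_right ?_ _
      rw [ENNReal.ofReal_sum_of_nonneg fun _ _ => Finset.prod_nonneg fun _ _ =>
        mul_nonneg (by positivity) ENNReal.toReal_nonneg]
      refine Finset.sum_le_sum fun e _ => ?_
      rw [ENNReal.ofReal_prod_of_nonneg fun _ _ =>
        mul_nonneg (by positivity) ENNReal.toReal_nonneg]
      refine Finset.prod_le_prod' fun j _ => ?_
      rw [ENNReal.ofReal_mul (by positivity)]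
      refine mul_le_mul' (le_of_eq ?_) ENNReal.ofReal_toReal_le
      rw [← ENNReal.ofReal_natCast]
      push_cast; rfl
  · intro x hx
    have h1 : (stdBox R L₀ Lt₀).rho (ω.shift x) ≤ rr (slab R (L₀ + 1) n x) :=
      le_supShift _ (by simp [slabSites, mem_boxSites, hx]) ω
    rw [BoxSpec.rho_shift _ _ _ (hp x)] at h1
    have h2 := (ENNReal.ofReal_le_iff_le_toReal (hrr_ne _)).1 h1
    exact (div_le_iff₀ (hp x)).1 h2
  · intro e _ j _ x hx hxs
    have h1 : (stdBox R L₀ Lt₀).q (ω.shift x) ≤ qq e j :=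
      le_supShift _ (by simp [stripSites, mem_boxSites, hx, hxs]) ω
    rw [BoxSpec.q_shift] at h1
    exact (ENNReal.ofReal_le_iff_le_toReal (hqq_ne _ _)).1 h1
  · have h1 := slabSum_le (r := fun k => (rr k).toReal) (ρ := ρm)
      (fun _ => ENNReal.toReal_nonneg)
      (fun k => ENNReal.toReal_le_of_le_ofReal (by positivity) (hrr_le k)) hρm1 (2 * n + 1)
    refine h1.trans ?_
    have h2 : (((2 * n + 1 : ℕ) : ℝ) + 1) ≤ Real.exp (((2 * n + 1 : ℕ) : ℝ)) :=
      Real.add_one_le_exp _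
    have h3 : ρm ^ (2 * n + 1) = Real.exp (((2 * n + 1 : ℕ) : ℝ) * (3 * d * L₀ * Λ)) := by
      rw [hρm, ← Real.exp_nat_mul]
    calc (((2 * n + 1 : ℕ) : ℝ) + 1) * ρm ^ (2 * n + 1)
        ≤ Real.exp (((2 * n + 1 : ℕ) : ℝ)) * Real.exp (((2 * n + 1 : ℕ) : ℝ) * (3 * d * L₀ * Λ)) := by
          rw [h3]
          exact mul_le_mul_of_nonneg_right h2 (Real.exp_pos _).le
      _ ≤ Γ := by
          rw [hΓ, ← Real.exp_add]
          apply Real.exp_le_exp.2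
          push_cast
          have h4 : (2 * (n : ℝ) + 1) * L₀ ≤ 3 * L₁ := by nlinarith
          have h5 : 2 * (n : ℝ) + 1 ≤ 3 * L₁ := by nlinarith
          have h6 : 1 ≤ d * Λ := by nlinarith
          have h7 := mul_le_mul_of_nonneg_left h4 (by positivity : 0 ≤ 3 * (d * Λ))
          have h8 : 3 * L₁ ≤ 3 * L₁ * (d * Λ) := le_mul_of_one_le_right (by positivity) h6
          linarith
  · have h1 := exp_le_hit_front (R := R) hd hω (L := L₁) (by linarith) hLt₁
    calc (1 : ℝ) ≤ Γ * Real.exp (-(3 * d * L₁ * Λ)) := by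
          rw [hΓ, ← Real.exp_add]
          refine Real.one_le_exp ?_
          have : 0 ≤ d * L₁ * Λ := by positivity
          linarith
      _ ≤ _ := mul_le_mul_of_nonneg_left h1 (Real.exp_pos _).le

end RWRE

end

/-! ### Annealed renormalization inequality -/

noncomputable section

namespace RWRE

variable {d : ℕ} [NeZero d]
  {R : EuclideanSpace ℝ (Fin d) ≃ₗᵢ[ℝ] EuclideanSpace ℝ (Fin d)}
  {L₀ Lt₀ L₁ Lt₁ κ : ℝ}

lemma ENNReal_rpow_le_self {x : ℝ≥0∞} (hx : 1 ≤ x) {p : ℝ} (hp : p ≤ 1) : x ^ p ≤ x := by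
  conv_rhs => rw [← ENNReal.rpow_one x]
  exact ENNReal.rpow_le_rpow_of_exponent_le hx hp

lemma ofReal_exp_rpow_third (E : ℝ) :
    ENNReal.ofReal (Real.exp (-(3 * E))) ^ (1 / 3 : ℝ) = ENNReal.ofReal (Real.exp (-E)) := by
  rw [ENNReal.ofReal_rpow_of_pos (Real.exp_pos _), ← Real.exp_mul]
  congr 2; ring

/-- Windows of small boxes from slabs i and j with j ≥ i + 3 are disjoint: the lower ones extend
forward by less than one thickness, the upper ones backward by less than one. A distance of 2 would
not be enough. -/
lemma lintegral_prod_supShift_rho_le {Q : Measure (Env d)} [IsProbabilityMeasure Q]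
    (hQ : IsIIDEnv Q) (hL₀ : 1 < L₀) {n : ℕ}
    (hL₁ : √(d : ℝ) ≤ L₁) (hLt₁ : √(d : ℝ) ≤ Lt₁) {a : ℝ} (ha : 0 < a) {E : ℝ}
    (hE : ENNReal.ofReal (4 ^ d * (L₁ * Lt₁ ^ (d - 1))) * ∫⁻ ω, (stdBox R L₀ Lt₀).rho ω ^ a ∂Q ≤
      ENNReal.ofReal (Real.exp (-(3 * E)))) (j : ℕ) :
    ∫⁻ ω, ∏ k ∈ Finset.range j, supShift (stdBox R L₀ Lt₀).rho
        (slabSites R L₁ Lt₁ (L₀ + 1) n (k + 1)) ω ^ (a / 3) ∂Q ≤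
      ENNReal.ofReal (Real.exp (-E)) ^ j := by
  set b := stdBox R L₀ Lt₀ with hb
  have hT : 0 < L₀ + 1 := by linarith
  have h := lintegral_prod_rpow_le hQ j
    (fun k ω => supShift b.rho (slabSites R L₁ Lt₁ (L₀ + 1) n (k + 1)) ω ^ a)
    (fun k => window (slabSites R L₁ Lt₁ (L₀ + 1) n (k + 1)) b.box)
    (fun k => window_finite _ stdBox_finite)
    (fun k => (measurable_supShift b.measurable_rho _).pow_const a)
    (fun k ω ω' hω => by
      simp only [isLocal_supShift (f := b.rho) (B := b.box) (fun _ _ h => b.rho_congr h) _ ω ω' hω])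
    ?_ (ε := ENNReal.ofReal (Real.exp (-(3 * E)))) ?_
  · rw [ofReal_exp_rpow_third] at h
    refine le_trans (le_of_eq ?_) h
    refine lintegral_congr fun ω => Finset.prod_congr rfl fun k _ => ?_
    rw [← ENNReal.rpow_mul]
    congr 1; ring
  · intro i j hij
    refine disjoint_window fun x hx x' hx' y hy y' hy' heq => ?_
    have hx2 : slab R (L₀ + 1) n x < i + 2 := by
      rw [(Finset.mem_filter.1 hx).2]; omega
    have hx2' : j + 1 ≤ slab R (L₀ + 1) n x' := (Finset.mem_filter.1 hx').2.ge
    rw [slab_lt_iff hT (by omega)] at hx2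
    rw [le_slab_iff hT (by omega)] at hx2'
    have hc := congrArg (coord R 0) heq
    rw [coord_add, coord_add] at hc
    rw [hb, mem_stdBox] at hy hy'
    have hij' : (i : ℝ) + 3 ≤ j := by exact_mod_cast hij
    push_cast at hx2 hx2'
    have := mul_le_mul_of_nonneg_right hij' hT.le
    linarith [hy.1.2, hy'.1.1]
  · intro k _
    refine (lintegral_supShift_rpow_le hQ b.measurable_rho _ ha).trans (le_trans ?_ hE)
    exact mul_le_mul_left (card_slabSites_le R hL₁ hLt₁ _ _ _) _

/-- Even neighbouring strips have disjoint windows, since the half-width plus L̃₀ is half the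
spacing; the mod 3 argument is reused only for uniformity with the slabs. Replacing q by the larger
ρ reduces both estimates to the same moment. -/
lemma lintegral_prod_supShift_q_le {Q : Measure (Env d)} [IsProbabilityMeasure Q]
    (hQ : IsIIDEnv Q) (hLt₀ : 0 < Lt₀) {n : ℕ}
    (hL₁ : √(d : ℝ) ≤ L₁) (hLt₁ : √(d : ℝ) ≤ Lt₁) {a : ℝ} (ha : 0 < a) (ha1 : a ≤ 1) {E : ℝ}
    (hE : ENNReal.ofReal ((2 * n + 3) * (4 ^ d * (L₁ * Lt₁ ^ (d - 1)))) *
      ∫⁻ ω, (stdBox R L₀ Lt₀).rho ω ^ a ∂Q ≤ ENNReal.ofReal (Real.exp (-(3 * E)))) {e : Dir d}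
    (he : e.1 ≠ 0) (J : ℕ) :
    ∫⁻ ω, ∏ j ∈ Finset.range J, (((2 * n + 3 : ℕ) : ℝ≥0∞) *
          supShift (stdBox R L₀ Lt₀).q (stripSites R L₁ Lt₁ e (j * (2 * Lt₀ * (2 * n + 4)))
            (Lt₀ * (2 * n + 3))) ω) ^ (a / 3) ∂Q ≤
      ENNReal.ofReal (Real.exp (-E)) ^ J := by
  set b := stdBox R L₀ Lt₀ with hb
  set S : ℕ → Finset (Site d) := fun j =>
    stripSites R L₁ Lt₁ e (j * (2 * Lt₀ * (2 * n + 4))) (Lt₀ * (2 * n + 3)) with hS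
  have hn0 : (0 : ℝ) ≤ n := Nat.cast_nonneg n
  have h := lintegral_prod_rpow_le hQ J
    (fun j ω => (((2 * n + 3 : ℕ) : ℝ≥0∞) * supShift b.q (S j) ω) ^ a)
    (fun j => window (S j) b.box)
    (fun k => window_finite _ stdBox_finite)
    (fun k => ((measurable_supShift b.measurable_q _).const_mul _).pow_const a)
    (fun k ω ω' hω => by
      simp only [isLocal_supShift (f := b.q) (B := b.box) (fun _ _ h => b.q_congr h) _ ω ω' hω])
    ?_ (ε := ENNReal.ofReal (Real.exp (-(3 * E)))) ?_
  · rw [ofReal_exp_rpow_third] at h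
    refine le_trans (le_of_eq ?_) h
    refine lintegral_congr fun ω => Finset.prod_congr rfl fun k _ => ?_
    rw [← ENNReal.rpow_mul]
    congr 1; ring
  · intro i j hij
    refine disjoint_window fun x hx x' hx' y hy y' hy' heq => ?_
    have hx2 := abs_lt.1 (Finset.mem_filter.1 hx).2
    have hx2' := abs_lt.1 (Finset.mem_filter.1 hx').2
    have hc := congrArg (signCoord R e) heq
    rw [signCoord_add, signCoord_add] at hc
    rw [hb, mem_stdBox] at hy hy'
    have h1 := hy.2 e.1 he
    have h2 := hy'.2 e.1 he
    rw [← abs_signCoord, abs_lt] at h1 h2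
    have hij' : (i : ℝ) + 3 ≤ j := by exact_mod_cast hij
    have := mul_le_mul_of_nonneg_right hij' (by positivity : 0 ≤ 2 * Lt₀ * (2 * n + 4))
    nlinarith [h1.2, h2.1, hx2.2, hx2'.1]
  · intro k _
    have h1 : (1 : ℝ≥0∞) ≤ ((2 * n + 3 : ℕ) : ℝ≥0∞) := by exact_mod_cast (by omega)
    have h2 : ((2 * n + 3 : ℕ) : ℝ≥0∞) = ENNReal.ofReal (2 * n + 3) := by
      rw [← ENNReal.ofReal_natCast]; push_cast; rfl
    calc ∫⁻ ω, (((2 * n + 3 : ℕ) : ℝ≥0∞) * supShift b.q (S k) ω) ^ a ∂Q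
        ≤ ∫⁻ ω, ((2 * n + 3 : ℕ) : ℝ≥0∞) * supShift b.rho (S k) ω ^ a ∂Q := by
          refine lintegral_mono fun ω => ?_
          rw [ENNReal.mul_rpow_of_nonneg _ _ ha.le]
          refine mul_le_mul' (ENNReal_rpow_le_self h1 ha1) (ENNReal.rpow_le_rpow ?_ ha.le)
          exact Finset.sup_mono_fun fun x _ => b.q_le_rho _
      _ = ((2 * n + 3 : ℕ) : ℝ≥0∞) * ∫⁻ ω, supShift b.rho (S k) ω ^ a ∂Q :=
          lintegral_const_mul _ ((measurable_supShift b.measurable_rho _).pow_const a)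
      _ ≤ ((2 * n + 3 : ℕ) : ℝ≥0∞) * (ENNReal.ofReal (4 ^ d * (L₁ * Lt₁ ^ (d - 1))) *
            ∫⁻ ω, b.rho ω ^ a ∂Q) := by
          refine mul_le_mul_right ?_ _
          refine (lintegral_supShift_rpow_le hQ b.measurable_rho _ ha).trans ?_
          exact mul_le_mul_left (card_stripSites_le R hL₁ hLt₁ _ _ _) _
      _ ≤ _ := by
          rw [← mul_assoc, h2, ← ENNReal.ofReal_mul (by positivity)]
          exact hE

/-- Annealed renormalization inequality. -/
theorem annealed_renormalization (hd : 2 ≤ d) {Q : Measure (Env d)} [IsProbabilityMeasure Q]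
    (hQ : IsIIDEnv Q) (hell : ∀ᵐ ω ∂Q, ω.Elliptic κ) (hκ : 1 ≤ Real.log (1 / κ))
    (hL₀ : 3 * √(d : ℝ) ≤ L₀) (hLt₀ : 3 * √(d : ℝ) ≤ Lt₀) {n : ℕ}
    (hn : 1 ≤ n) (hn1 : n * (L₀ + 1) ≤ L₁ - 1) (hn2 : L₁ - 1 ≤ (n + 1) * (L₀ + 1))
    (hn3 : L₁ + 1 ≤ (n + 2) * (L₀ + 1)) {J : ℕ}
    (hJ : J * (2 * Lt₀ * (2 * n + 4)) ≤ Lt₁) (hLt₁ : 3 * √(d : ℝ) ≤ Lt₁)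
    {a : ℝ} (ha : 0 < a) (ha1 : a ≤ 1) {E : ℝ} (hE0 : 0 ≤ E)
    (hE : ENNReal.ofReal ((2 * n + 3) * (4 ^ d * (L₁ * Lt₁ ^ (d - 1)))) *
      ∫⁻ ω, (stdBox R L₀ Lt₀).rho ω ^ a ∂Q ≤ ENNReal.ofReal (Real.exp (-(3 * E)))) :
    ∫⁻ ω, (stdBox R L₁ Lt₁).rho ω ^ (a / 3) ∂Q ≤
      ENNReal.ofReal (2 * (n + 2) * Real.exp (-(E * n)) +
        4 * d * Real.exp (24 * d * Real.log (1 / κ) * L₁ - E * J)) := by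
  have hd2 : (2 : ℝ) ≤ d := by exact_mod_cast hd
  have hs : (1 : ℝ) ≤ √(d : ℝ) := by
    rw [Real.one_le_sqrt]; linarith
  have hn' : (1 : ℝ) ≤ n := by exact_mod_cast hn
  have hL₁ : L₀ ≤ L₁ := by nlinarith
  have hβ : 0 < a / 3 := by positivity
  have hβ1 : a / 3 ≤ 1 := by linarith
  have hLt₁0 : 0 ≤ Lt₁ := by linarith
  have hL₁0 : 0 ≤ L₁ := by linarith
  set x := ENNReal.ofReal (Real.exp (-E)) with hx
  have hx1 : x ≤ 1 := ENNReal.ofReal_le_one.2 (Real.exp_le_one_iff.2 (by linarith))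
  set C := ENNReal.ofReal (2 * Real.exp (24 * d * Real.log (1 / κ) * L₁)) with hC
  have hC1 : 1 ≤ C := by
    rw [hC, ENNReal.one_le_ofReal]
    have : 1 ≤ Real.exp (24 * d * Real.log (1 / κ) * L₁) := Real.one_le_exp (by positivity)
    linarith
  set rr : ℕ → Env d → ℝ≥0∞ := fun k =>
    supShift (stdBox R L₀ Lt₀).rho (slabSites R L₁ Lt₁ (L₀ + 1) n (k + 1)) with hrr
  set qq : Dir d → ℕ → Env d → ℝ≥0∞ := fun e j ω => ((2 * n + 3 : ℕ) : ℝ≥0∞) *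
    supShift (stdBox R L₀ Lt₀).q
    (stripSites R L₁ Lt₁ e (j * (2 * Lt₀ * (2 * n + 4))) (Lt₀ * (2 * n + 3))) ω with hqq
  have hmr : ∀ j : ℕ, Measurable fun ω => ∏ k ∈ Finset.range j, rr k ω ^ (a / 3) := fun j =>
    Finset.measurable_prod _ fun k _ =>
      (measurable_supShift (stdBox R L₀ Lt₀).measurable_rho _).pow_const _
  have hmq : ∀ e, Measurable fun ω => ∏ j ∈ Finset.range J, qq e j ω ^ (a / 3) := fun e =>
    Finset.measurable_prod _ fun k _ =>
      ((measurable_supShift (stdBox R L₀ Lt₀).measurable_q _).const_mul _).pow_const _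
  have hE' : ENNReal.ofReal (4 ^ d * (L₁ * Lt₁ ^ (d - 1))) *
      ∫⁻ ω, (stdBox R L₀ Lt₀).rho ω ^ a ∂Q ≤ ENNReal.ofReal (Real.exp (-(3 * E))) := by
    refine le_trans (mul_le_mul_left (ENNReal.ofReal_le_ofReal ?_) _) hE
    exact le_mul_of_one_le_left (by positivity) (by linarith)
  calc ∫⁻ ω, (stdBox R L₁ Lt₁).rho ω ^ (a / 3) ∂Q
      ≤ ∫⁻ ω, (2 * ∑ j ∈ Finset.Ico n (2 * n + 2), ∏ k ∈ Finset.range j, rr k ω ^ (a / 3) +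
          C * ∑ e ∈ sideDirs d, ∏ j ∈ Finset.range J, qq e j ω ^ (a / 3)) ∂Q := by
        refine lintegral_mono_ae (hell.mono fun ω hω => ?_)
        refine (ENNReal.rpow_le_rpow
          (rho_le hd hω hκ hL₀ hLt₀ hn hn1 hn2 hn3 hJ hLt₁) hβ.le).trans ?_
        refine (ENNReal.rpow_add_le_add_rpow _ _ hβ.le hβ1).trans ?_
        rw [ENNReal.mul_rpow_of_nonneg _ _ hβ.le, ENNReal.mul_rpow_of_nonneg _ _ hβ.le]
        refine add_le_add (mul_le_mul' (ENNReal_rpow_le_self one_le_two hβ1) ?_)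
          (mul_le_mul' (ENNReal_rpow_le_self hC1 hβ1) ?_)
        · refine (rpow_sum_le _ _ hβ hβ1).trans_eq (Finset.sum_congr rfl fun j _ => ?_)
          rw [ENNReal.prod_rpow_of_nonneg hβ.le]
        · refine (rpow_sum_le _ _ hβ hβ1).trans_eq (Finset.sum_congr rfl fun j _ => ?_)
          rw [ENNReal.prod_rpow_of_nonneg hβ.le]
    _ = 2 * ∑ j ∈ Finset.Ico n (2 * n + 2), ∫⁻ ω, ∏ k ∈ Finset.range j, rr k ω ^ (a / 3) ∂Q +
          C * ∑ e ∈ sideDirs d, ∫⁻ ω, ∏ j ∈ Finset.range J, qq e j ω ^ (a / 3) ∂Q := by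
        rw [lintegral_add_left ((Finset.measurable_sum _ fun j _ => hmr j).const_mul _),
          lintegral_const_mul _ (Finset.measurable_sum _ fun j _ => hmr j),
          lintegral_const_mul _ (Finset.measurable_sum _ fun e _ => hmq e),
          lintegral_finsetSum _ fun j _ => hmr j, lintegral_finsetSum _ fun e _ => hmq e]
    _ ≤ 2 * ((n + 2 : ℕ) * x ^ n) + C * ((2 * d : ℕ) * x ^ J) := by
        refine add_le_add (mul_le_mul_right ?_ _) (mul_le_mul_right ?_ _)
        · refine (Finset.sum_le_card_nsmul _ _ (x ^ n) fun j hj => ?_).trans_eq ?_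
          · refine (lintegral_prod_supShift_rho_le hQ (by linarith) (by linarith) (by linarith)
              ha hE' j).trans ?_
            exact pow_le_pow_right_of_le_one' hx1 (Finset.mem_Ico.1 hj).1
          · rw [Nat.card_Ico, nsmul_eq_mul]
            congr 2; omega
        · refine (Finset.sum_le_card_nsmul _ _ (x ^ J) fun e he => ?_).trans ?_
          · exact lintegral_prod_supShift_q_le hQ (by linarith) (by linarith) (by linarith)
              ha ha1 hE (mem_sideDirs.1 he) J
          · rw [nsmul_eq_mul]
            exact mul_le_mul_left (by exact_mod_cast card_sideDirs_le) _
    _ = _ := by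
        rw [ENNReal.ofReal_add (by positivity) (by positivity)]
        congr 1
        · rw [hx, ← ENNReal.ofReal_pow (Real.exp_pos _).le, ← ENNReal.ofReal_natCast,
            ← ENNReal.ofReal_mul (by positivity), ← ENNReal.ofReal_ofNat,
            ← ENNReal.ofReal_mul (by positivity), ← Real.exp_nat_mul]
          congr 1
          push_cast
          rw [show (n : ℝ) * -E = -(E * n) by ring]
          ring
        · rw [hx, ← ENNReal.ofReal_pow (Real.exp_pos _).le, ← ENNReal.ofReal_natCast, hC,
            ← ENNReal.ofReal_mul (by positivity), ← ENNReal.ofReal_mul (by positivity),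
            ← Real.exp_nat_mul]
          congr 1
          rw [sub_eq_add_neg, Real.exp_add, show (J : ℝ) * -E = -(E * J) by ring]
          push_cast
          ring

end RWRE

end

/-! ### One renormalization step and good scales -/

noncomputable section

namespace RWRE

variable {d : ℕ} [NeZero d]
  (R : EuclideanSpace ℝ (Fin d) ≃ₗᵢ[ℝ] EuclideanSpace ℝ (Fin d)) (Q : Measure (Env d))

/-- The moment of order `a` of the ratio `ρ` of a box. -/
def rhoMoment (L Lt a : ℝ) : ℝ≥0∞ := ∫⁻ ω, (stdBox R L Lt).rho ω ^ a ∂Q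

/-- The lateral size of the box at the next scale. -/
def nextWidth (d : ℕ) (Λ L Lt L₁ : ℝ) : ℝ := 372 * d * Λ * Lt * (L₁ ^ 2 / L)

variable {R Q} {L Lt L₁ κ a E A : ℝ}

lemma renormalization_bound {d Λ L L₁ E n J : ℝ} (hd2 : 2 ≤ d) (hκ : 1 ≤ Λ)
    (hL₁16 : 16 ≤ L₁) (hE8 : 8 ≤ E) (hEL : E ≤ Λ * L) (hnR : 1 ≤ n) (hnle : n * L ≤ L₁)
    (hnge' : L₁ / L ≤ 2 * n) (hJge : 30 * (d * Λ * L₁) ≤ J) :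
    2 * (n + 2) * Real.exp (-(E * n)) + 4 * d * Real.exp (24 * d * Λ * L₁ - E * J) ≤
      Real.exp (-(E * (L₁ / L) / 4)) := by
  have hΛ0 : 0 < Λ := by linarith
  have hdΛ : 1 ≤ d * Λ := one_le_mul_of_one_le_of_one_le (by linarith) hκ
  have hd0 : 0 < d := by linarith
  have hL₁0 : 0 < L₁ := by linarith
  have h1 : 2 * (n + 2) * Real.exp (-(E * n)) ≤ 1 / 2 * Real.exp (-(E * n / 2)) := by
    have h2 : 12 * n ≤ Real.exp (4 * n) := by
      have := Real.quadratic_le_exp_of_nonneg (by positivity : 0 ≤ 4 * n)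
      nlinarith
    have h3 : Real.exp (4 * n) ≤ Real.exp (E * n / 2) := by
      apply Real.exp_le_exp.2; nlinarith
    have h4 : Real.exp (-(E * n)) * Real.exp (E * n / 2) = Real.exp (-(E * n / 2)) := by
      rw [← Real.exp_add]; congr 1; ring
    have h5 : 4 * (n + 2) ≤ Real.exp (E * n / 2) := by linarith
    have := mul_le_mul_of_nonneg_left h5 (Real.exp_pos (-(E * n))).le
    rw [h4] at this
    linarith
  have h6 : 4 * d * Real.exp (24 * d * Λ * L₁ - E * J) ≤ 1 / 2 * Real.exp (-(E * n / 2)) := by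
    have h7 : E * n ≤ Λ * L₁ := by
      have := mul_le_mul_of_nonneg_right hEL (by linarith : 0 ≤ n)
      have := mul_le_mul_of_nonneg_left hnle hΛ0.le
      linarith
    have h8 : 240 * (d * Λ * L₁) ≤ E * J := by
      have := mul_le_mul hE8 hJge (by positivity) (by linarith)
      linarith
    have h9 : 8 * d ≤ Real.exp (5 * (d * Λ * L₁)) := by
      have h10 := Real.add_one_le_exp (5 * (d * Λ * L₁))
      have h11 : d ≤ d * Λ := le_mul_of_one_le_right (by linarith) hκ
      have h12 : d * Λ * 16 ≤ d * Λ * L₁ := mul_le_mul_of_nonneg_left hL₁16 (by positivity)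
      linarith
    have h13 : Real.exp (24 * d * Λ * L₁ - E * J) * Real.exp (5 * (d * Λ * L₁)) ≤
        Real.exp (-(E * n / 2)) := by
      rw [← Real.exp_add]
      apply Real.exp_le_exp.2
      have h16 : 0 ≤ Λ * L₁ := by positivity
      have h14 : Λ * L₁ ≤ d * Λ * L₁ := by
        have := mul_le_mul_of_nonneg_right (by linarith : 1 ≤ d) h16
        linarith
      linarith
    have := mul_le_mul_of_nonneg_left h9 (Real.exp_pos (24 * d * Λ * L₁ - E * J)).le
    linarith
  have h15 : Real.exp (-(E * n / 2)) ≤ Real.exp (-(E * (L₁ / L) / 4)) := by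
    apply Real.exp_le_exp.2
    have := mul_le_mul_of_nonneg_left hnge' (by linarith : 0 ≤ E)
    linarith
  linarith

/-- One step of the renormalization, with explicit choice of the lateral size. -/
theorem rhoMoment_step (hd : 2 ≤ d) [IsProbabilityMeasure Q] (hQ : IsIIDEnv Q)
    (hell : ∀ᵐ ω ∂Q, ω.Elliptic κ) (hκ : 1 ≤ Real.log (1 / κ))
    (hL : 3 * √(d : ℝ) ≤ L) (hLt : 3 * √(d : ℝ) ≤ Lt) (hL₁ : 4 * L ≤ L₁)
    (ha : 0 < a) (ha1 : a ≤ 1) (hE8 : 8 ≤ E) (hEL : E ≤ Real.log (1 / κ) * L)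
    (hE : ENNReal.ofReal (5 * 4 ^ d * (L₁ ^ 2 / L) *
      nextWidth d (Real.log (1 / κ)) L Lt L₁ ^ (d - 1)) * rhoMoment R Q L Lt a ≤
        ENNReal.ofReal (Real.exp (-(3 * E)))) :
    rhoMoment R Q L₁ (nextWidth d (Real.log (1 / κ)) L Lt L₁) (a / 3) ≤
      ENNReal.ofReal (Real.exp (-(E * (L₁ / L) / 4))) := by
  set Λ := Real.log (1 / κ) with hΛ
  have hΛ0 : 0 < Λ := by linarith
  have hd2 : (2 : ℝ) ≤ d := by exact_mod_cast hd
  have hs : (1.4 : ℝ) ≤ √(d : ℝ) := by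
    apply Real.le_sqrt_of_sq_le; norm_num; linarith
  have hL4 : 4 ≤ L := by linarith
  have hL0 : 0 < L := by linarith
  have hLt0 : 0 < Lt := by linarith
  have hL₁16 : 16 ≤ L₁ := by linarith
  set n : ℕ := ⌊(L₁ - 1) / (L + 1)⌋₊ with hn
  have hquot : 0 ≤ (L₁ - 1) / (L + 1) := div_nonneg (by linarith) (by linarith)
  have hn1 : n * (L + 1) ≤ L₁ - 1 := by
    have := Nat.floor_le hquot
    rwa [le_div_iff₀ (by linarith)] at this
  have hn2 : L₁ - 1 < (n + 1) * (L + 1) := by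
    have := Nat.lt_floor_add_one ((L₁ - 1) / (L + 1))
    rwa [div_lt_iff₀ (by linarith)] at this
  have hn3 : L₁ + 1 ≤ (n + 2) * (L + 1) := by linarith
  have hnge : 1 / 2 * L₁ ≤ n * L := by
    have hn0 : (0 : ℝ) ≤ n := Nat.cast_nonneg n
    have h1 : (n + 1) * (L + 1) ≤ (n + 1) * (5 / 4 * L) :=
      mul_le_mul_of_nonneg_left (by linarith) (by linarith)
    linarith
  have hnle : n * L ≤ L₁ := by
    have hn0 : (0 : ℝ) ≤ n := Nat.cast_nonneg n
    linarith
  have hnN : 1 ≤ n := by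
    by_contra h
    have : n = 0 := by omega
    rw [this] at hnge
    push_cast at hnge
    linarith
  have hnR : (1 : ℝ) ≤ n := by exact_mod_cast hnN
  have hnle' : (n : ℝ) ≤ L₁ / L := by rw [le_div_iff₀ hL0]; exact hnle
  have hnge' : L₁ / L ≤ 2 * n := by rw [div_le_iff₀ hL0]; linarith
  set Lt₁ := nextWidth d Λ L Lt L₁ with hLt₁
  have hdΛ : 1 ≤ d * Λ := by nlinarith
  -- With E ≥ 8 the gain E J is at least 240 dΛL₁, which swamps the loss 24 dΛL₁.
  set J : ℕ := ⌈30 * (d * Λ * L₁)⌉₊ with hJ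
  have hJge : 30 * (d * Λ * L₁) ≤ J := Nat.le_ceil _
  have hdΛL : L₁ ≤ d * Λ * L₁ := le_mul_of_one_le_left (by linarith) hdΛ
  have hJle : (J : ℝ) ≤ 31 * (d * Λ * L₁) := by
    have : (J : ℝ) < 30 * (d * Λ * L₁) + 1 := Nat.ceil_lt_add_one (by positivity)
    linarith
  have hsq : L₁ ^ 2 / L = L₁ * (L₁ / L) := by ring
  have hJLt : J * (2 * Lt * (2 * n + 4)) ≤ Lt₁ := by
    -- The constant in `nextWidth` is 372 = 31 · 2 · 6.
    calc J * (2 * Lt * (2 * n + 4)) ≤ (31 * (d * Λ * L₁)) * (2 * Lt * (6 * (L₁ / L))) := by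
          refine mul_le_mul hJle ?_ (by positivity) (by positivity)
          exact mul_le_mul_of_nonneg_left (by linarith) (by positivity)
      _ = Lt₁ := by rw [hLt₁, nextWidth, hsq]; ring
  have hLt₁ge : 3 * √(d : ℝ) ≤ Lt₁ := by
    refine hLt.trans (le_trans ?_ hJLt)
    have h1 : (1 : ℝ) ≤ J := by linarith
    have h2 : Lt ≤ 2 * Lt * (2 * n + 4) := by nlinarith
    exact h2.trans (le_mul_of_one_le_left (by positivity) h1)
  have hLt₁0 : 0 ≤ Lt₁ := by linarith
  have main := annealed_renormalization (R := R) hd hQ hell hκ hL hLt hnN hn1 hn2.le hn3 hJLt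
    hLt₁ge ha ha1 (by linarith : 0 ≤ E) ?_
  · refine main.trans (ENNReal.ofReal_le_ofReal ?_)
    exact renormalization_bound hd2 hκ hL₁16 hE8 hEL hnR hnle hnge' hJge
  · refine le_trans (mul_le_mul_left (ENNReal.ofReal_le_ofReal ?_) _) hE
    have h1 : (2 * (n : ℝ) + 3) ≤ 5 * (L₁ / L) := by linarith
    calc (2 * (n : ℝ) + 3) * (4 ^ d * (L₁ * Lt₁ ^ (d - 1)))
        ≤ (5 * (L₁ / L)) * (4 ^ d * (L₁ * Lt₁ ^ (d - 1))) :=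
          mul_le_mul_of_nonneg_right h1 (by positivity)
      _ = _ := by rw [hsq]; ring

variable (R Q) in
/-- A scale from which the renormalization can be iterated indefinitely. -/
structure GoodScale (Λ L Lt a A : ℝ) : Prop where
  hL : 3 * √(d : ℝ) ≤ L
  hLt : 3 * √(d : ℝ) ≤ Lt
  ha : 0 < a
  ha1 : a ≤ 1
  hA : 120 * d ≤ A
  hAL : A ≤ 6 * Λ * L
  hZ : 7440 * d * Λ * L * Lt ≤ Real.exp (A / (4 * d))
  hφ : rhoMoment R Q L Lt a ≤ ENNReal.ofReal (Real.exp (-A))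

/-- Apply the renormalization with E = A/6. The prefactor is at most the d-th power of 7440 dΛLL̃
N², and the upper bound on N together with `hZ` makes this at most exp(A/2). Half of exp(-A) is thus
kept, and it equals exp(-3E). -/
theorem GoodScale.step (hd : 2 ≤ d) [IsProbabilityMeasure Q] (hQ : IsIIDEnv Q)
    (hell : ∀ᵐ ω ∂Q, ω.Elliptic κ) (hκ : 1 ≤ Real.log (1 / κ))
    (h : GoodScale R Q (Real.log (1 / κ)) L Lt a A) {N : ℝ} (hN : 4 ≤ N)
    (hN' : N ≤ Real.exp (A / (8 * d))) :
    rhoMoment R Q (N * L) (nextWidth d (Real.log (1 / κ)) L Lt (N * L)) (a / 3) ≤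
      ENNReal.ofReal (Real.exp (-(A * N / 24))) := by
  obtain ⟨hL, hLt, ha, ha1, hA, hAL, hZ, hφ⟩ := h
  set Λ := Real.log (1 / κ) with hΛ
  have hΛ0 : 0 < Λ := by linarith
  have hd2 : (2 : ℝ) ≤ d := by exact_mod_cast hd
  have hd0 : (0 : ℝ) < d := by linarith
  have hs : (1 : ℝ) ≤ √(d : ℝ) := by
    rw [Real.one_le_sqrt]; linarith
  have hL0 : 0 < L := by linarith
  have hLt0 : 0 < Lt := by linarith
  have hN0 : 0 < N := by linarith
  have key := rhoMoment_step (R := R) (L₁ := N * L) (E := A / 6) hd hQ hell hκ hL hLt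
    (by nlinarith) ha ha1 (by linarith) (by linarith) ?_
  · refine key.trans_eq ?_
    congr 3
    field_simp
    ring
  · have hw : nextWidth d Λ L Lt (N * L) = 372 * (d * Λ * L * Lt) * N ^ 2 := by
      unfold nextWidth; field_simp
    set y := d * Λ * L * Lt with hy
    have hy0 : 0 < y := by positivity
    have hyL : L ≤ y := by
      have h1 : 1 ≤ d * Λ := by nlinarith
      have h2 : 1 ≤ d * Λ * Lt := one_le_mul_of_one_le_of_one_le h1 (by linarith)
      calc L ≤ (d * Λ * Lt) * L := le_mul_of_one_le_left hL0.le h2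
        _ = y := by rw [hy]; ring
    have hpoly : 5 * 4 ^ d * ((N * L) ^ 2 / L) * nextWidth d Λ L Lt (N * L) ^ (d - 1) ≤
        (N ^ 2 * (7440 * y)) ^ d := by
      obtain ⟨k, hk⟩ := Nat.exists_eq_succ_of_ne_zero (NeZero.ne d)
      rw [hw, show d - 1 = k by omega]
      conv_lhs => rw [hk]
      conv_rhs => rw [hk]
      have h1 : (1488 * y * N ^ 2) ^ k ≤ (N ^ 2 * (7440 * y)) ^ k := by
        apply pow_le_pow_left₀ (by positivity)
        have : 0 ≤ y * N ^ 2 := by positivity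
        linarith
      calc 5 * 4 ^ (k.succ) * ((N * L) ^ 2 / L) * (372 * y * N ^ 2) ^ k
          = (20 * N ^ 2 * L) * (1488 * y * N ^ 2) ^ k := by
            rw [Nat.succ_eq_add_one, pow_succ,
              show 1488 * y * N ^ 2 = 4 * (372 * y * N ^ 2) by ring, mul_pow 4]
            field_simp
            ring
        _ ≤ (N ^ 2 * (7440 * y)) * (N ^ 2 * (7440 * y)) ^ k := by
            refine mul_le_mul ?_ h1 (by positivity) (by positivity)
            have : N ^ 2 * L ≤ N ^ 2 * y := mul_le_mul_of_nonneg_left hyL (by positivity)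
            have : 0 ≤ N ^ 2 * y := by positivity
            linarith
        _ = _ := by rw [Nat.succ_eq_add_one, pow_succ]; ring
    have hbase : N ^ 2 * (7440 * y) ≤ Real.exp (A / (2 * d)) := by
      have h1 : N ^ 2 ≤ Real.exp (A / (8 * d)) ^ 2 := pow_le_pow_left₀ hN0.le hN' 2
      have h2 : 7440 * y ≤ Real.exp (A / (4 * d)) := by rw [hy]; linarith
      refine (mul_le_mul h1 h2 (by positivity) (by positivity)).trans_eq ?_
      rw [← Real.exp_nat_mul, ← Real.exp_add]
      congr 1
      push_cast
      field_simp
      ring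
    have hfin : 5 * 4 ^ d * ((N * L) ^ 2 / L) * nextWidth d Λ L Lt (N * L) ^ (d - 1) ≤
        Real.exp (A / 2) := by
      refine hpoly.trans ((pow_le_pow_left₀ (by positivity) hbase d).trans_eq ?_)
      rw [← Real.exp_nat_mul]
      congr 1
      field_simp
    refine (mul_le_mul' (ENNReal.ofReal_le_ofReal hfin) hφ).trans ?_
    rw [← ENNReal.ofReal_mul (Real.exp_pos _).le, ← Real.exp_add]
    refine ENNReal.ofReal_le_ofReal (Real.exp_le_exp.2 ?_)
    linarith

/-- The chosen factor is a quarter of the largest allowed, so that the lengths reachable from one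
scale extend up to 4 times the next, exactly where the next one takes over. -/
theorem GoodScale.next (hd : 2 ≤ d) [IsProbabilityMeasure Q] (hQ : IsIIDEnv Q)
    (hell : ∀ᵐ ω ∂Q, ω.Elliptic κ) (hκ : 1 ≤ Real.log (1 / κ))
    (h : GoodScale R Q (Real.log (1 / κ)) L Lt a A) :
    ∃ Lt', GoodScale R Q (Real.log (1 / κ)) (Real.exp (A / (8 * d)) / 4 * L) Lt' (a / 3)
      (A * (Real.exp (A / (8 * d)) / 4) / 24) := by
  have hd2 : (2 : ℝ) ≤ d := by exact_mod_cast hd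
  have hd0 : (0 : ℝ) < d := by linarith
  set N := Real.exp (A / (8 * d)) / 4 with hN
  have hNbig : 84 ≤ N := by
    have h1 : (15 : ℝ) ≤ A / (8 * d) := by
      rw [le_div_iff₀ (by positivity)]; linarith [h.hA]
    have h2 := Real.quadratic_le_exp_of_nonneg (by norm_num : (0 : ℝ) ≤ 6)
    have h3 : Real.exp 12 = Real.exp 6 ^ 2 := by rw [← Real.exp_nat_mul]; norm_num
    have h4 : Real.exp 12 ≤ Real.exp (A / (8 * d)) := Real.exp_le_exp.2 (by linarith)
    rw [hN, le_div_iff₀ (by norm_num)]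
    nlinarith
  have hNle : N ≤ Real.exp (A / (8 * d)) := by
    rw [hN]; linarith [Real.exp_pos (A / (8 * d))]
  have hstep := h.step hd hQ hell hκ (by linarith : 4 ≤ N) hNle
  obtain ⟨hL, hLt, ha, ha1, hA, hAL, hZ, hφ⟩ := h
  set Λ := Real.log (1 / κ) with hΛ
  have hΛ0 : 0 < Λ := by linarith
  have hs : (1 : ℝ) ≤ √(d : ℝ) := by
    rw [Real.one_le_sqrt]; linarith
  have hL0 : 0 < L := by linarith
  have hLt0 : 0 < Lt := by linarith
  have hA0 : 0 < A := by linarith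
  have hw : nextWidth d Λ L Lt (N * L) = 372 * (d * Λ * L * Lt) * N ^ 2 := by
    unfold nextWidth; field_simp
  refine ⟨_, ⟨?_, ?_, by positivity, by linarith, ?_, ?_, ?_, hstep⟩⟩
  · nlinarith
  · rw [hw]
    have h1 : 1 ≤ d * Λ := by nlinarith
    have h2 : 1 ≤ d * Λ * L := one_le_mul_of_one_le_of_one_le h1 (by linarith)
    have h3 : Lt ≤ d * Λ * L * Lt := le_mul_of_one_le_left hLt0.le h2
    have h4 : d * Λ * L * Lt ≤ d * Λ * L * Lt * N ^ 2 :=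
      le_mul_of_one_le_right (by positivity) (by nlinarith)
    have : 0 ≤ d * Λ * L * Lt * N ^ 2 := by positivity
    linarith
  · nlinarith
  · have := mul_le_mul_of_nonneg_right hAL (by linarith : 0 ≤ N)
    have : 0 ≤ Λ * L * N := by positivity
    linarith
  · have h1 : 7440 * d * Λ * (N * L) * nextWidth d Λ L Lt (N * L) ≤
        N ^ 3 * (7440 * d * Λ * L * Lt) ^ 2 := by
      rw [hw]
      have h2 : 7440 * d * Λ * (N * L) * (372 * (d * Λ * L * Lt) * N ^ 2) =
        N ^ 3 * ((372 * (d * Λ * L)) * (7440 * d * Λ * L * Lt)) := by ring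
      rw [h2, sq]
      refine mul_le_mul_of_nonneg_left (mul_le_mul_of_nonneg_right ?_ (by positivity))
        (by positivity)
      have h3 : d * Λ * L ≤ d * Λ * L * Lt := le_mul_of_one_le_right (by positivity) (by linarith)
      have : 0 ≤ d * Λ * L := by positivity
      linarith
    have h4 : N ^ 3 ≤ Real.exp (A / (8 * d)) ^ 3 := pow_le_pow_left₀ (by linarith) hNle 3
    have h5 : (7440 * d * Λ * L * Lt) ^ 2 ≤ Real.exp (A / (4 * d)) ^ 2 :=
      pow_le_pow_left₀ (by positivity) hZ 2
    refine h1.trans ((mul_le_mul h4 h5 (by positivity) (by positivity)).trans ?_)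
    rw [← Real.exp_nat_mul, ← Real.exp_nat_mul, ← Real.exp_add]
    apply Real.exp_le_exp.2
    -- The new `hZ` requires N/24 ≥ 7/2, that is N ≥ 84.
    have h6 : A * 84 ≤ A * N := mul_le_mul_of_nonneg_left hNbig hA0.le
    push_cast
    rw [show 3 * (A / (8 * d)) + 2 * (A / (4 * d)) = (7 / 2 * A) / (4 * d) by field_simp; ring]
    exact div_le_div_of_nonneg_right (by linarith) (by positivity)

end RWRE

end

/-! ### Tower growth of the scales and iterated logarithms -/

noncomputable section

namespace RWRE

section Tower

variable {T : ℕ → ℝ}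

lemma le_iterLog (hTexp : ∀ k, (8 : ℝ) ^ T k ≤ T (k + 1)) {x : ℝ} {k : ℕ}
    (hx : T k ≤ x) : ∀ j ≤ k, T (k - j) ≤ iterLog j x := by
  intro j
  induction j with
  | zero => intro _; simpa [iterLog] using hx
  | succ j ih =>
    intro hj
    have h1 := ih (by omega)
    have h2 := hTexp (k - (j + 1))
    rw [show k - (j + 1) + 1 = k - j by omega] at h2
    unfold iterLog at h1 ⊢
    rw [Function.iterate_succ_apply']
    have h3 : (0 : ℝ) < 8 ^ T (k - (j + 1)) := Real.rpow_pos_of_pos (by norm_num) _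
    rw [Real.le_logb_iff_rpow_le (by norm_num) (h3.trans_le (h2.trans h1))]
    exact h2.trans h1

/-- Exponential bounds along a sequence of scales that grows like a tower give almost exponential
decay. -/
theorem exists_iterLog_limsup {L : ℕ → ℝ} {ν : ℝ} (hν : 0 < ν) (hTk : ∀ k : ℕ, (k : ℝ) + 1 ≤ T k)
    (hTexp : ∀ k, (8 : ℝ) ^ T k ≤ T (k + 1)) (hTL : ∀ k, T k ≤ L k) (hL : Monotone L)
    {P : ℝ → ℝ≥0∞}
    (hP : ∀ k : ℕ, ∀ x : ℝ, 0 < x → 4 * L k ≤ x + 1 → x + 1 ≤ 4 * L (k + 1) →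
      P x ≤ ENNReal.ofReal (Real.exp (-(ν * (24⁻¹ : ℝ) ^ k * x)))) :
    ∃ c : ℝ, 0 < c ∧ ∃ n : ℝ → ℕ, Tendsto n atTop atTop ∧
      (∀ x : ℝ, 0 ≤ x → IterLogDefined (n x) x) ∧
      limsup (fun x : ℝ => ((x⁻¹ * Real.exp (c * iterLog (n x) x) : ℝ) : EReal) *
        ENNReal.log (P x)) atTop < 0 := by
  have hT0 : ∀ k, 0 < T k := fun k => by
    have := hTk k
    have : (0 : ℝ) ≤ k := Nat.cast_nonneg k
    linarith
  have hex : ∀ x : ℝ, ∃ k, x + 1 < 4 * L k := fun x => by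
    obtain ⟨k, hk⟩ := exists_nat_gt (x + 1)
    have h1 := hTk k
    have h2 := hTL k
    have h3 := hT0 k
    exact ⟨k, by linarith⟩
  classical
  set K : ℝ → ℕ := fun x => Nat.find (hex x) with hK
  have hKlt : ∀ x, x + 1 < 4 * L (K x) := fun x => Nat.find_spec (hex x)
  have hKge : ∀ x k, k < K x → 4 * L k ≤ x + 1 := fun x k hk => not_lt.1 (Nat.find_min (hex x) hk)
  have hlog24 : 0 < Real.log 24 := Real.log_pos (by norm_num)
  have hbase : ∀ x k, k < K x → 0 ≤ x → T k ≤ x := fun x k hk hx => by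
    have h1 := hKge x k hk
    have h2 := hTL k
    have h3 := hTk k
    have : (0 : ℝ) ≤ k := Nat.cast_nonneg k
    linarith
  have hKtop : ∀ m : ℕ, ∀ x : ℝ, 4 * L m ≤ x → m < K x := fun m x hx => by
    by_contra h
    have h1 := hKlt x
    have h2 := hL (not_lt.1 h)
    linarith
  -- With k + 1 the first scale beyond x, half of the k available logarithms are taken. The value
  -- left is at least the tower at level k - k/2, hence at least k/2, so twice log 24 times it
  -- exceeds k log 24.
  refine ⟨2 * Real.log 24, by positivity, fun x => (K x - 1) / 2, ?_, ?_, ?_⟩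
  · refine tendsto_atTop.2 fun m => ?_
    filter_upwards [eventually_ge_atTop (4 * L (2 * m + 1))] with x hx
    have := hKtop _ x hx
    omega
  · intro x hx j hj
    have hj' : j < (K x - 1) / 2 := hj
    have hk : K x - 1 < K x := by omega
    have := le_iterLog hTexp (hbase x _ hk hx) j (by omega)
    exact (hT0 _).trans_le this
  · have hbound : ∀ᶠ x : ℝ in atTop,
        ((x⁻¹ * Real.exp (2 * Real.log 24 * iterLog ((K x - 1) / 2) x) : ℝ) : EReal) *
          ENNReal.log (P x) ≤ ((-ν : ℝ) : EReal) := by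
      filter_upwards [eventually_ge_atTop (4 * L 0), eventually_gt_atTop 0] with x hx hx0
      have hK0 := hKtop 0 x hx
      obtain ⟨k, hk⟩ : ∃ k, K x = k + 1 := ⟨K x - 1, by omega⟩
      have hkk : k < K x := by omega
      rw [show K x - 1 = k by omega]
      have h1 := hP k x hx0 (hKge x k hkk) (by rw [← hk]; exact (hKlt x).le)
      have h2 := le_iterLog hTexp (hbase x k hkk hx0.le) (k / 2) (by omega)
      have h3 : (k : ℝ) / 2 ≤ iterLog (k / 2) x := by
        have h4 := hTk (k - k / 2)
        have h5 : k ≤ 2 * (k - k / 2) := by omega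
        have h6 : (k : ℝ) ≤ 2 * ((k - k / 2 : ℕ) : ℝ) := by exact_mod_cast h5
        linarith
      have h7 : (24 : ℝ) ^ k ≤ Real.exp (2 * Real.log 24 * iterLog (k / 2) x) := by
        rw [show (24 : ℝ) ^ k = Real.exp (k * Real.log 24) by
          rw [Real.exp_nat_mul, Real.exp_log (by norm_num)]]
        apply Real.exp_le_exp.2
        have := mul_le_mul_of_nonneg_left h3 hlog24.le
        linarith
      have h8 : ENNReal.log (P x) ≤ ((-(ν * (24⁻¹ : ℝ) ^ k * x) : ℝ) : EReal) := by
        refine (ENNReal.log_monotone h1).trans_eq ?_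
        rw [ENNReal.log_ofReal_of_pos (Real.exp_pos _), Real.log_exp]
      set g := x⁻¹ * Real.exp (2 * Real.log 24 * iterLog (k / 2) x) with hg
      have hg0 : 0 ≤ g := by positivity
      refine (mul_le_mul_of_nonneg_left h8 (EReal.coe_nonneg.2 hg0)).trans ?_
      rw [← EReal.coe_mul]
      refine EReal.coe_le_coe_iff.2 ?_
      have h9 : x⁻¹ * (24 : ℝ) ^ k ≤ g := mul_le_mul_of_nonneg_left h7 (by positivity)
      have h10 : (x⁻¹ * (24 : ℝ) ^ k) * (ν * (24⁻¹ : ℝ) ^ k * x) = ν := by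
        rw [inv_pow]
        field_simp
      have h11 := mul_le_mul_of_nonneg_right h9
        (by positivity : 0 ≤ ν * (24⁻¹ : ℝ) ^ k * x)
      linarith
    refine (limsup_le_of_le (h := hbound)).trans_lt ?_
    exact_mod_cast neg_lt_zero.2 hν

/-- The two real parameters of the successive scales. -/
def scaleSeq (d : ℕ) (s : ℝ × ℝ) : ℕ → ℝ × ℝ
  | 0 => s
  | k + 1 => (Real.exp ((scaleSeq d s k).2 / (8 * d)) / 4 * (scaleSeq d s k).1,
      (scaleSeq d s k).2 * (Real.exp ((scaleSeq d s k).2 / (8 * d)) / 4) / 24)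

variable {d : ℕ} {s : ℝ × ℝ}

/-- A step multiplies the length by N and the rate by N/24, so the rate per unit length loses
exactly a factor 24. -/
lemma scaleSeq_ratio (hs : 0 < s.1) (k : ℕ) :
    0 < (scaleSeq d s k).1 ∧
      (scaleSeq d s k).2 = s.2 / s.1 * (24⁻¹ : ℝ) ^ k * (scaleSeq d s k).1 := by
  induction k with
  | zero => simp only [scaleSeq, pow_zero, mul_one]; exact ⟨hs, by field_simp⟩
  | succ k ih =>
    simp only [scaleSeq]
    refine ⟨mul_pos (by positivity) ih.1, ?_⟩
    rw [pow_succ]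
    set e := Real.exp ((scaleSeq d s k).2 / (8 * d))
    rw [ih.2]
    ring

lemma eight_rpow_le_exp (t : ℝ) (ht : 0 ≤ t) : (8 : ℝ) ^ t ≤ Real.exp (2.1 * t) := by
  rw [Real.rpow_def_of_pos (by norm_num)]
  apply Real.exp_le_exp.2
  have h1 : Real.log 8 = 3 * Real.log 2 := by
    rw [show (8 : ℝ) = 2 ^ 3 by norm_num, Real.log_pow]; norm_num
  rw [h1]
  refine mul_le_mul_of_nonneg_right ?_ ht
  linarith [Real.log_two_lt_d9]

/-- For t = A/(24d) the growth factor contains exp(3t). Base 8 works because log 8 < 3: the surplus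
exp(0.9 t) pays for the constant 96 once t ≥ 5. -/
lemma scaleSeq_growth (hd : 0 < d) (hs : 120 * (d : ℝ) ≤ s.2) (k : ℕ) :
    (k : ℝ) + 5 ≤ (scaleSeq d s k).2 / (24 * d) ∧
      (8 : ℝ) ^ ((scaleSeq d s k).2 / (24 * d)) ≤ (scaleSeq d s (k + 1)).2 / (24 * d) := by
  have hd0 : (0 : ℝ) < d := by exact_mod_cast hd
  have main : ∀ A : ℝ, 5 ≤ A / (24 * d) →
      (8 : ℝ) ^ (A / (24 * d)) ≤ A * (Real.exp (A / (8 * d)) / 4) / 24 / (24 * d) := by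
    intro A hA
    set t := A / (24 * d) with ht
    have e1 : A / (8 * d) = 2.1 * t + 0.9 * t := by rw [ht]; field_simp; ring
    have e2 : A * (Real.exp (A / (8 * d)) / 4) / 24 / (24 * d) =
        t / 96 * Real.exp (0.9 * t) * Real.exp (2.1 * t) := by
      rw [e1, Real.exp_add, ht]; ring
    rw [e2]
    refine (eight_rpow_le_exp t (by linarith)).trans (le_mul_of_one_le_left (Real.exp_pos _).le ?_)
    have h1 : Real.exp 1 ^ 4 ≤ Real.exp (0.9 * t) := by
      rw [← Real.exp_nat_mul]
      apply Real.exp_le_exp.2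
      push_cast; linarith
    have h2 : (2.7 : ℝ) ^ 4 ≤ Real.exp 1 ^ 4 :=
      pow_le_pow_left₀ (by norm_num) (by linarith [Real.exp_one_gt_d9]) 4
    have h3 : (53 : ℝ) ≤ Real.exp (0.9 * t) := le_trans (by norm_num) (h2.trans h1)
    nlinarith
  have h5 : ∀ k : ℕ, (k : ℝ) + 5 ≤ (scaleSeq d s k).2 / (24 * d) := by
    intro k
    induction k with
    | zero =>
      simp only [scaleSeq]
      rw [le_div_iff₀ (by positivity)]
      push_cast; linarith
    | succ k ih =>
      have hk : (0 : ℝ) ≤ k := Nat.cast_nonneg k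
      have h1 := main _ (by linarith : 5 ≤ (scaleSeq d s k).2 / (24 * d))
      set t := (scaleSeq d s k).2 / (24 * d) with ht
      have h2 : t + 1 ≤ (8 : ℝ) ^ t := by
        rw [Real.rpow_def_of_pos (by norm_num)]
        have h3 : 1 ≤ Real.log 8 := by
          rw [Real.le_log_iff_exp_le (by norm_num)]
          linarith [Real.exp_one_lt_d9]
        have h4 := Real.add_one_le_exp (Real.log 8 * t)
        nlinarith
      simp only [scaleSeq]
      push_cast
      linarith
  refine ⟨h5 k, ?_⟩
  have hk : (0 : ℝ) ≤ k := Nat.cast_nonneg k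
  exact main _ (by linarith [h5 k])

end Tower

end RWRE

end

/-! ### From the effective criterion to the decay of the backtracking probability -/

noncomputable section

namespace RWRE

variable {d : ℕ} [NeZero d] {R : EuclideanSpace ℝ (Fin d) ≃ₗᵢ[ℝ] EuclideanSpace ℝ (Fin d)}
  {Q : Measure (Env d)} {κ L Lt a : ℝ}

/-- In the box of parameter L + 1 the back face is exactly at -L, so a walk that leaves through the
front reaches height L without having been at or below -L. -/
lemma backtrack_subset :
    {X : ℕ → Site d | hitBelow (R (basisVec 0)) (-L) X < hitAbove (R (basisVec 0)) L X} ⊆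
      (stdBox R (L + 1) Lt).exitsFrontᶜ := by
  rintro X hX ⟨n, hn, hfront⟩
  rw [exitTime_eq_coe_iff] at hn
  rw [mem_front] at hfront
  refine absurd (show hitBelow (R (basisVec 0)) (-L) X < hitAbove (R (basisVec 0)) L X from hX)
    (not_lt.2 ?_)
  have h1 : hitAbove (R (basisVec 0)) L X ≤ n := by
    refine iInf₂_le n fun h => ?_
    have h2 : coord R 0 (X n) < L := h
    linarith [hfront.2.1]
  refine h1.trans (le_iInf₂ fun m hm => ?_)
  by_contra hlt
  have hmn : m < n := by exact_mod_cast not_le.1 hlt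
  have h3 := (mem_stdBox.1 (hn.2 m hmn)).1.1
  refine hm (show -L < coord R 0 (X m) from ?_)
  linarith

lemma BoxSpec.q_le_one (b : BoxSpec d) (ω : Env d) : b.q ω ≤ 1 := by
  have : IsProbabilityMeasure (quenchedLaw ω (0 : Site d)) := by
    unfold quenchedLaw; infer_instance
  exact prob_le_one

/-- This makes the shrinking moment orders harmless: a bound on any moment of order in (0,1] bounds
the exit probability with no loss. -/
lemma BoxSpec.q_le_rho_rpow (b : BoxSpec d) (ω : Env d) (ha : 0 < a) (ha1 : a ≤ 1) :
    b.q ω ≤ b.rho ω ^ a := by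
  rcases le_total 1 (b.rho ω) with h | h
  · exact (b.q_le_one ω).trans (ENNReal.one_le_rpow h ha)
  · refine (b.q_le_rho ω).trans ?_
    conv_lhs => rw [← ENNReal.rpow_one (b.rho ω)]
    exact ENNReal.rpow_le_rpow_of_exponent_ge h ha1

theorem annealedProb_backtrack_le (ha : 0 < a) (ha1 : a ≤ 1) :
    annealedProb Q 0 {X | hitBelow (R (basisVec 0)) (-L) X < hitAbove (R (basisVec 0)) L X} ≤
      rhoMoment R Q (L + 1) Lt a :=
  lintegral_mono fun ω => (measure_mono backtrack_subset).trans
    ((stdBox R (L + 1) Lt).q_le_rho_rpow ω ha ha1)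

lemma Env.Elliptic.le_inv {ω : Env d} (h : ω.Elliptic κ) : κ * (2 * d) ≤ 1 := by
  have h1 : ∑ e : Dir d, ω.prob 0 e = 1 := (ω 0).2.2
  have h2 : ∑ _e : Dir d, κ ≤ ∑ e : Dir d, ω.prob 0 e := Finset.sum_le_sum fun e _ => h.2 0 e
  rw [h1, Finset.sum_const, Finset.card_univ] at h2
  simp only [Fintype.card_prod, Fintype.card_fin, Fintype.card_units_int, nsmul_eq_mul] at h2
  push_cast at h2
  linarith

/-- The 2d probabilities sum to 1, so κ ≤ 1/4 < 1/e when d ≥ 2. -/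
lemma IsUniformlyElliptic.one_le_log [IsProbabilityMeasure Q] (hd : 2 ≤ d)
    (h : IsUniformlyElliptic Q κ) : 1 ≤ Real.log (1 / κ) := by
  obtain ⟨ω, hω⟩ := h.2.exists
  have h1 := Env.Elliptic.le_inv (ω := ω) ⟨h.1, hω⟩
  have hκ := h.1
  have hd2 : (2 : ℝ) ≤ d := by exact_mod_cast hd
  rw [Real.le_log_iff_exp_le (by positivity), le_div_iff₀ hκ]
  nlinarith [Real.exp_one_lt_d9, Real.exp_pos 1]

lemma exists_mul_lt_of_mul_biInf_lt {ι : Type*} {S : Set ι} (hS : S.Nonempty) {f : ι → ℝ≥0∞}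
    {c r : ℝ≥0∞} (hc : c ≠ ∞) (h : c * ⨅ i ∈ S, f i < r) : ∃ i ∈ S, c * f i < r := by
  have := hS.to_subtype
  rw [iInf_subtype', ENNReal.mul_iInf fun h => absurd h hc] at h
  obtain ⟨i, hi⟩ := iInf_lt_iff.1 h
  exact ⟨i, i.2, hi⟩

lemma exists_pow_le_exp (c : ℝ) (n : ℕ) {b : ℝ} (hb : 0 < b) :
    ∃ y₀ : ℝ, 0 ≤ y₀ ∧ ∀ y, y₀ ≤ y → c * y ^ n ≤ Real.exp (b * y) := by
  have h1 := (isLittleO_pow_exp_pos_mul_atTop n hb).def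
    (show 0 < (|c| + 1)⁻¹ by positivity)
  obtain ⟨y₀, hy₀⟩ := eventually_atTop.1 h1
  refine ⟨max y₀ 0, le_max_right _ _, fun y hy => ?_⟩
  have hy0 : 0 ≤ y := (le_max_right _ _).trans hy
  have h2 := hy₀ y ((le_max_left _ _).trans hy)
  rw [Real.norm_of_nonneg (by positivity), Real.norm_of_nonneg (Real.exp_pos _).le,
    inv_mul_eq_div, le_div_iff₀ (by positivity)] at h2
  have h3 : c * y ^ n ≤ (|c| + 1) * y ^ n :=
    mul_le_mul_of_nonneg_right (by linarith [le_abs_self c]) (by positivity)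
  linarith

/-- The first step produces the powers Λ^(2d-1), L^(2d) and L̃^(d-1); the exponents of the criterion
dominate them for d ≥ 2, with equality at d = 2. -/
lemma effective_constant_le {Λ : ℝ} (hd : 2 ≤ d) (hΛ : 1 ≤ Λ) (hL : 1 ≤ L) (hLt : 0 ≤ Lt) :
    5 * 4 ^ d * (Λ * L ^ 2) * (372 * d * Λ ^ 2 * L ^ 2 * Lt) ^ (d - 1) ≤
      5 * 4 ^ d * (372 * d) ^ (d - 1) *
        (Λ ^ (3 * (d - 1)) * Lt ^ (d - 1) * L ^ (3 * d - 2)) := by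
  obtain ⟨k, hk⟩ : ∃ k, d = k + 2 := ⟨d - 2, by omega⟩
  have e1 : d - 1 = k + 1 := by omega
  have e2 : 3 * d - 2 = 3 * k + 4 := by omega
  rw [e1, e2]
  have h1 : Λ ^ (2 * k + 3) ≤ Λ ^ (3 * (k + 1)) := pow_le_pow_right₀ hΛ (by omega)
  have h2 : L ^ (2 * k + 4) ≤ L ^ (3 * k + 4) := pow_le_pow_right₀ hL (by omega)
  have h3 : Λ ^ (2 * k + 3) * L ^ (2 * k + 4) ≤ Λ ^ (3 * (k + 1)) * L ^ (3 * k + 4) :=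
    mul_le_mul h1 h2 (by positivity) (by positivity)
  calc 5 * 4 ^ d * (Λ * L ^ 2) * (372 * d * Λ ^ 2 * L ^ 2 * Lt) ^ (k + 1)
      = 5 * 4 ^ d * (372 * d) ^ (k + 1) * Lt ^ (k + 1) *
          (Λ ^ (2 * k + 3) * L ^ (2 * k + 4)) := by
        simp only [mul_pow]; ring
    _ ≤ 5 * 4 ^ d * (372 * d) ^ (k + 1) * Lt ^ (k + 1) *
          (Λ ^ (3 * (k + 1)) * L ^ (3 * k + 4)) :=
        mul_le_mul_of_nonneg_left h3 (by positivity)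
    _ = _ := by ring

/-- The effective criterion yields a first good scale. -/
theorem goodScale_init (hd : 2 ≤ d) [IsProbabilityMeasure Q] (hQ : IsIIDEnv Q)
    (hell : ∀ᵐ ω ∂Q, ω.Elliptic κ) (hκ : 1 ≤ Real.log (1 / κ))
    (hL : 3 * √(d : ℝ) ≤ L) (hLt : 3 * √(d : ℝ) ≤ Lt) (hLtL : Lt ≤ L ^ 3)
    (ha : 0 < a) (ha1 : a ≤ 1) {y : ℝ} (hy : y ^ 2 = Real.log (1 / κ) * L) (hy60 : 60 * d ≤ y)
    (hexp : 2767680 * (d : ℝ) ^ 2 * y ^ 13 ≤ Real.exp ((2 * d : ℝ)⁻¹ * y))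
    (hφ : ENNReal.ofReal (5 * 4 ^ d * (372 * d) ^ (d - 1) * Real.exp 24 *
      Real.log (1 / κ) ^ (3 * (d - 1)) * Lt ^ (d - 1) * L ^ (3 * d - 2)) *
        rhoMoment R Q L Lt a < 1) :
    GoodScale R Q (Real.log (1 / κ)) (y * L)
      (nextWidth d (Real.log (1 / κ)) L Lt (y * L)) (a / 3) (2 * y) := by
  set Λ := Real.log (1 / κ) with hΛ
  have hd2 : (2 : ℝ) ≤ d := by exact_mod_cast hd
  have hd0 : (0 : ℝ) < d := by linarith
  have hs : (1 : ℝ) ≤ √(d : ℝ) := by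
    rw [Real.one_le_sqrt]; linarith
  have hL3 : 3 ≤ L := by linarith
  have hL0 : 0 < L := by linarith
  have hLt0 : 0 < Lt := by linarith
  have hΛ0 : 0 < Λ := by linarith
  have hy120 : 120 ≤ y := by linarith
  have hy0 : 0 < y := by linarith
  have hw1 : (y * L) ^ 2 / L = Λ * L ^ 2 := by
    rw [mul_pow, hy]; field_simp
  have hw : nextWidth d Λ L Lt (y * L) = 372 * d * Λ ^ 2 * L ^ 2 * Lt := by
    unfold nextWidth; rw [hw1]; ring
  -- The smallest admissible E = 8 is used, and exp(24) in the criterion is exp(3E). The factor y =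
  -- √(ΛL) makes L₁²/L = ΛL², and the resulting rate is E y/4 = 2y.
  have key := rhoMoment_step (R := R) (L₁ := y * L) (E := 8) hd hQ hell hκ hL hLt
    (by nlinarith) ha ha1 le_rfl (by rw [← hy]; nlinarith) ?_
  · refine ⟨?_, ?_, by positivity, by linarith, by linarith, ?_, ?_, key.trans_eq ?_⟩
    · nlinarith
    · rw [hw]
      have h1 : 1 ≤ d * Λ ^ 2 * L ^ 2 :=
        one_le_mul_of_one_le_of_one_le
          (one_le_mul_of_one_le_of_one_le (by linarith) (one_le_pow₀ hκ))
          (one_le_pow₀ (by linarith))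
      have h2 := mul_le_mul_of_nonneg_right h1 hLt0.le
      have h3 : 0 ≤ d * Λ ^ 2 * L ^ 2 * Lt := by positivity
      linarith
    · have : 1 ≤ Λ * L := one_le_mul_of_one_le_of_one_le hκ (by linarith)
      have := mul_le_mul_of_nonneg_left this hy0.le
      linarith
    · have e1 : 7440 * d * Λ * (y * L) * nextWidth d Λ L Lt (y * L) =
          2767680 * (d : ℝ) ^ 2 * (y * (Λ * L) * (Λ ^ 2 * L ^ 2 * Lt)) := by
        rw [hw]; ring
      have h1 : L ≤ y ^ 2 := by rw [hy]; exact le_mul_of_one_le_left hL0.le hκ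
      -- Here the cubic bound on the width enters: the quantity in `hZ` becomes a polynomial in y
      -- alone, beaten by exp(y/(2d)) for large y.
      have h2 : Λ ^ 2 * L ^ 2 * Lt ≤ y ^ 10 := by
        calc Λ ^ 2 * L ^ 2 * Lt = (y ^ 2) ^ 2 * Lt := by rw [hy]; ring
          _ ≤ (y ^ 2) ^ 2 * (y ^ 2) ^ 3 := mul_le_mul_of_nonneg_left
            (hLtL.trans (pow_le_pow_left₀ hL0.le h1 3)) (by positivity)
          _ = y ^ 10 := by ring
      rw [e1, ← hy]
      refine le_trans (mul_le_mul_of_nonneg_left (mul_le_mul_of_nonneg_left h2 (by positivity))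
        (by positivity)) ?_
      refine (le_of_eq (by ring)).trans (hexp.trans_eq ?_)
      congr 1
      field_simp
      ring
    · congr 3
      field_simp
      ring
  · rw [hw1, hw]
    set Z := Λ ^ (3 * (d - 1)) * Lt ^ (d - 1) * L ^ (3 * d - 2) with hZ
    set C : ℝ := 5 * 4 ^ d * (372 * d) ^ (d - 1) with hC
    have e1 : C * Z = Real.exp (-(3 * 8)) *
        (C * Real.exp 24 * Λ ^ (3 * (d - 1)) * Lt ^ (d - 1) * L ^ (3 * d - 2)) := by
      have : Real.exp (-(3 * 8)) * Real.exp 24 = 1 := by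
        rw [← Real.exp_add]; norm_num
      calc C * Z = (Real.exp (-(3 * 8)) * Real.exp 24) * (C * Z) := by rw [this, one_mul]
        _ = _ := by rw [hZ]; ring
    calc _ ≤ ENNReal.ofReal (C * Z) * rhoMoment R Q L Lt a :=
          mul_le_mul_left (ENNReal.ofReal_le_ofReal
            (effective_constant_le hd hκ (by linarith) hLt0.le)) _
      _ ≤ ENNReal.ofReal (Real.exp (-(3 * 8))) * 1 := by
          rw [e1, ENNReal.ofReal_mul (Real.exp_pos _).le, mul_assoc]
          exact mul_le_mul_right hφ.le _
      _ = _ := mul_one _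

theorem exists_goodScale_scaleSeq (hd : 2 ≤ d) [IsProbabilityMeasure Q] (hQ : IsIIDEnv Q)
    (hell : ∀ᵐ ω ∂Q, ω.Elliptic κ) (hκ : 1 ≤ Real.log (1 / κ)) {s : ℝ × ℝ}
    (h : ∃ Lt a, GoodScale R Q (Real.log (1 / κ)) s.1 Lt a s.2) (k : ℕ) :
    ∃ Lt a, GoodScale R Q (Real.log (1 / κ)) (scaleSeq d s k).1 Lt a (scaleSeq d s k).2 := by
  induction k with
  | zero => exact h
  | succ k ih =>
    obtain ⟨Lt, a, h⟩ := ih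
    obtain ⟨Lt', h'⟩ := h.next hd hQ hell hκ
    exact ⟨Lt', a / 3, h'⟩

/-- A first good scale forces an almost exponential decay of the probability to backtrack. -/
theorem exists_limsup_of_goodScale (hd : 2 ≤ d) [IsProbabilityMeasure Q] (hQ : IsIIDEnv Q)
    (hell : ∀ᵐ ω ∂Q, ω.Elliptic κ) (hκ : 1 ≤ Real.log (1 / κ)) {s : ℝ × ℝ}
    (h : ∃ Lt a, GoodScale R Q (Real.log (1 / κ)) s.1 Lt a s.2) (hs : s.2 ≤ s.1) :
    ∃ c : ℝ, 0 < c ∧ ∃ n : ℝ → ℕ, Tendsto n atTop atTop ∧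
      (∀ x : ℝ, 0 ≤ x → IterLogDefined (n x) x) ∧
      limsup (fun x : ℝ => ((x⁻¹ * Real.exp (c * iterLog (n x) x) : ℝ) : EReal) *
        ENNReal.log (annealedProb Q 0 {X | hitBelow (R (basisVec 0)) (-x) X <
          hitAbove (R (basisVec 0)) x X})) atTop < 0 := by
  have hgood := exists_goodScale_scaleSeq hd hQ hell hκ h
  have hd2 : (2 : ℝ) ≤ d := by exact_mod_cast hd
  have hs2 : 120 * (d : ℝ) ≤ s.2 := by
    obtain ⟨Lt, a, h⟩ := h; exact h.hA
  have hs20 : 0 < s.2 := by linarith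
  have hs1 : 0 < s.1 := hs20.trans_le hs
  have hgrow := scaleSeq_growth (s := s) (by omega : 0 < d) hs2
  have hratio := fun k => scaleSeq_ratio (d := d) hs1 k
  have hA0 : ∀ k, 0 < (scaleSeq d s k).2 := fun k => by
    obtain ⟨Lt, a, h⟩ := hgood k
    linarith [h.hA]
  refine exists_iterLog_limsup (T := fun k => (scaleSeq d s k).2 / (24 * d))
    (L := fun k => (scaleSeq d s k).1) (ν := s.2 / s.1 / 24) (by positivity)
    (fun k => by linarith [(hgrow k).1]) (fun k => (hgrow k).2) (fun k => ?_) ?_ ?_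
  · have h1 : (scaleSeq d s k).2 / (24 * d) ≤ (scaleSeq d s k).2 :=
      div_le_self (hA0 k).le (by linarith)
    refine h1.trans ?_
    rw [(hratio k).2]
    refine mul_le_of_le_one_left (hratio k).1.le (mul_le_one₀ ((div_le_one hs1).2 hs)
      (by positivity) (pow_le_one₀ (by norm_num) (by norm_num)))
  · refine monotone_nat_of_le_succ fun k => ?_
    obtain ⟨Lt, a, h⟩ := hgood k
    refine le_mul_of_one_le_left (hratio k).1.le ?_
    rw [le_div_iff₀ (by norm_num), one_mul]
    have h1 : (15 : ℝ) ≤ (scaleSeq d s k).2 / (8 * d) := by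
      rw [le_div_iff₀ (by positivity)]; linarith [h.hA]
    linarith [Real.add_one_le_exp ((scaleSeq d s k).2 / (8 * d))]
  · intro k x hx0 hx1 hx2
    obtain ⟨Lt, a, h⟩ := hgood k
    obtain ⟨hLk, hAk⟩ := hratio k
    set Lk := (scaleSeq d s k).1
    -- An intermediate length is reached by one last step from scale k; the two bounds on x + 1 are
    -- exactly the admissible range of N.
    have hstep := h.step hd hQ hell hκ (N := (x + 1) / Lk) (by rwa [le_div_iff₀ hLk]) (by
      rw [div_le_iff₀ hLk]
      refine hx2.trans_eq ?_
      simp only [scaleSeq]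
      ring)
    rw [div_mul_cancel₀ _ hLk.ne'] at hstep
    refine (annealedProb_backtrack_le (by linarith [h.ha] : 0 < a / 3)
      (by linarith [h.ha1])).trans (hstep.trans ?_)
    refine ENNReal.ofReal_le_ofReal (Real.exp_le_exp.2 (neg_le_neg ?_))
    have e1 : (scaleSeq d s k).2 * ((x + 1) / Lk) / 24 =
        s.2 / s.1 / 24 * (24⁻¹ : ℝ) ^ k * (x + 1) := by
      rw [hAk]; field_simp
    rw [e1]
    exact mul_le_mul_of_nonneg_left (by linarith) (by positivity)

end RWRE

end

theorem proposition2p2 (d : ℕ) [NeZero d] (hd : 2 ≤ d) :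
    ∃ c₁₄ c₁₅ : ℝ, 3 * √(d : ℝ) ≤ c₁₄ ∧ 1 < c₁₅ ∧
      ∀ (κ : ℝ) (Q : Measure (RWRE.Env d)) [IsProbabilityMeasure Q],
        RWRE.IsIIDEnv Q → RWRE.IsUniformlyElliptic Q κ →
      ∀ (l : EuclideanSpace ℝ (Fin d))
        (R : EuclideanSpace ℝ (Fin d) ≃ₗᵢ[ℝ] EuclideanSpace ℝ (Fin d)),
        R (RWRE.basisVec 0) = l →
      ∀ L₀ Lt₀ : ℝ, c₁₄ ≤ L₀ → 3 * √(d : ℝ) ≤ Lt₀ → Lt₀ ≤ L₀ ^ 3 →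
        ENNReal.ofReal
            (c₁₅ * Real.log (1 / κ) ^ (3 * (d - 1)) * Lt₀ ^ (d - 1) * L₀ ^ (3 * d - 2)) *
          (⨅ a ∈ Set.Ioc (0 : ℝ) 1,
            ∫⁻ ω, (RWRE.BoxSpec.mk R (L₀ - 1) (L₀ + 1) Lt₀).rho ω ^ a ∂Q) < 1 →
      ∃ c : ℝ, 0 < c ∧ ∃ n : ℝ → ℕ, Tendsto n atTop atTop ∧
        (∀ L : ℝ, 0 ≤ L → RWRE.IterLogDefined (n L) L) ∧
        limsup (fun L : ℝ =>
          ((L⁻¹ * Real.exp (c * RWRE.iterLog (n L) L) : ℝ) : EReal) *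
            ENNReal.log (RWRE.annealedProb Q 0
              {X | RWRE.hitBelow l (-L) X < RWRE.hitAbove l L X})) atTop < 0 := by
  have hd2 : (2 : ℝ) ≤ d := by exact_mod_cast hd
  obtain ⟨y₀, hy₀, hy⟩ := RWRE.exists_pow_le_exp (2767680 * (d : ℝ) ^ 2) 13
    (show 0 < (2 * d : ℝ)⁻¹ by positivity)
  -- The square forces √(log(1/κ) L₀) ≥ 60d + y₀ whatever κ is, because log(1/κ) ≥ 1; thus the
  -- constants depend on d only.
  refine ⟨3 * √(d : ℝ) + (60 * d + y₀) ^ 2, 5 * 4 ^ d * (372 * d) ^ (d - 1) * Real.exp 24,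
    le_add_of_nonneg_right (by positivity), ?_, ?_⟩
  · have h1 : (1 : ℝ) ≤ 4 ^ d := one_le_pow₀ (by norm_num)
    have h2 : (1 : ℝ) ≤ (372 * d) ^ (d - 1) := one_le_pow₀ (by linarith)
    have h3 : (1 : ℝ) ≤ Real.exp 24 := Real.one_le_exp (by norm_num)
    have h4 := one_le_mul_of_one_le_of_one_le (one_le_mul_of_one_le_of_one_le h1 h2) h3
    linarith
  intro κ Q _ hQ hell l R hl L₀ Lt₀ hL₀ hLt₀ hLtL hinf
  subst hl
  have hκ := hell.one_le_log hd
  have hell' : ∀ᵐ ω ∂Q, ω.Elliptic κ := hell.2.mono fun ω h => ⟨hell.1, h⟩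
  obtain ⟨a, ha, hφ⟩ := RWRE.exists_mul_lt_of_mul_biInf_lt (Set.nonempty_Ioc.2 one_pos)
    ENNReal.ofReal_ne_top hinf
  have hsq : 3 * √(d : ℝ) ≤ L₀ := le_trans (le_add_of_nonneg_right (by positivity)) hL₀
  have hL0 : 0 < L₀ := lt_of_lt_of_le (by positivity) hsq
  have hyL : L₀ ≤ Real.log (1 / κ) * L₀ := le_mul_of_one_le_left hL0.le hκ
  have hylow : 60 * d + y₀ ≤ √(Real.log (1 / κ) * L₀) := by
    refine Real.le_sqrt_of_sq_le (le_trans ?_ (hL₀.trans hyL))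
    exact le_add_of_nonneg_left (by positivity)
  have hgood := RWRE.goodScale_init hd hQ hell' hκ hsq hLt₀ hLtL ha.1 ha.2
    (Real.sq_sqrt (hL0.le.trans hyL)) (by linarith) (hy _ (by linarith)) hφ
  refine RWRE.exists_limsup_of_goodScale hd hQ hell' hκ (s := (√(Real.log (1 / κ) * L₀) * L₀,
    2 * √(Real.log (1 / κ) * L₀))) ⟨_, _, hgood⟩ ?_
  have hs : (1 : ℝ) ≤ √(d : ℝ) := Real.one_le_sqrt.2 (by linarith)
  have h1 : 2 ≤ L₀ := by linarith
  have := mul_le_mul_of_nonneg_left h1 (Real.sqrt_nonneg (Real.log (1 / κ) * L₀))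
  change 2 * _ ≤ _ * L₀
  linarith
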